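/- **Setting.** Let $(U_i)_{i\ge1}$ and $(U_{\{i,j\}})_{1\le i<j}$ be mutually independent random variables, uniform on $[0,1]$, let $\mathfrak f:[0,1]^3\to\mathbb R$ be Borel measurable and symmetric in its first two arguments, and let $X_{ij}=\mathfrak f(U_i,U_j,U_{\{i,j\}})$ for $i<j$. Assume $\operatorname{Var}(X_{12})>0$. Let $\mathcal X=[a,b]$ be a compact interval strictly contained in the support of $X_{12}$, and let $x$ be an interior point of $\mathcal X$. Assume: (a) On some open set $O\supseteq\mathcal X$: $X_{12}$ has a density $f$, which is twice continuously differentiable, and $f''$ is bounded on $\mathcal X$; $X_{12}$ has a conditional density $f_{X_{12}|U_1}(\cdot\mid u)$ given $U_1=u$, which is twice continuously differentiable for almost every $u$, and whose second derivative in the first argument is bounded on $\mathcal X$ uniformly in $u$; and $X_{12}$ has a conditional density $f_{X_{12}|U_1,U_2}(\cdot\mid u_1,u_2)$ given $(U_1,U_2)=(u_1,u_2)$, which is continuously differentiable for almost every $(u_1,u_2)$, and whose derivative in the first argument is bounded on $\mathcal X$ uniformly in $(u_1,u_2)$. (The uniform bounds are needed only up to null sets of $u$ and of $(u_1,u_2)$.)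 Moreover $f(x)>0$. (b) The kernel $K:\mathbb R\to\mathbb R$ is symmetric, right- or left-continuous, non-negative, bounded, of bounded variation and of bounded support, with $\int K=1$, $\int uK(u)\,du=0$ and $0<\int u^2K(u)\,du<\infty$. (c) The bandwidths $h_n>0$ satisfy $h_n\to0$, $nh_n\to\infty$, $nh_n^2\to\infty$ and $nh_n^{5/2}\to0$. **Statistics.** Put $\theta=f(x)$. For a set $A\subseteq\{1,\dots,n\}$ let $\hat\theta_A=\binom{|A|}{2}^{-1}\sum_{i<j,\ i,j\in A}h_n^{-1}K((x-X_{ij})/h_n)$, and write $\hat\theta,\hat\theta^{(i)},\hat\theta^{(i,j)}$ for $A=\{1,\dots,n\}$, $\{1,\dots,n\}\setminus\{i\}$, $\{1,\dots,n\}\setminus\{i,j\}$. Let $S(t)=\hat\theta-t$, $S^{(i)}(t)=\hat\theta^{(i)}-t$, $S^{(i,j)}(t)=\hat\theta^{(i,j)}-t$ and $V_i(t)=nS(t)-(n-1)S^{(i)}(t)$. Let $$Q_{ij}=\tfrac{n-3}{n-1}\big[nS(\theta)-(n-1)\{S^{(i)}(\theta)+S^{(j)}(\theta)\}+(n-2)S^{(i,j)}(\theta)\big],$$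 $$\Gamma^2=\tfrac1n\sum_{i=1}^nV_i(\theta)^2,\qquad \Gamma_m^2=\tfrac1n\sum_{i=1}^nV_i(\hat\theta)^2-\tfrac1n\sum_{i<j}Q_{ij}^2,$$ $$V_i^m(\theta)=V_i(\hat\theta)-\Gamma\,\Gamma_m^{-1}\{V_i(\hat\theta)-V_i(\theta)\}.$$ (Where $\Gamma_m^2\le0$, read $\Gamma_m^{-1}$ as $0$.) The jackknife empirical likelihood (JEL) statistic is $$\ell(\theta)=-2\sup\Big\{\sum_{i=1}^n\log(nw_i):\ w_i\ge0,\ \sum_iw_i=1,\ \sum_iw_iV_i(\theta)=0\Big\}\in[0,\infty]$$ (with $\log0=-\infty$ and $\sup\emptyset=-\infty$), and the modified JEL statistic $\ell^m(\theta)$ is defined in the same way with $V_i^m(\theta)$ in place of $V_i(\theta)$. Say that $f$ is non-degenerate at $x$ if $\operatorname{Var}(f_{X_{12}|U_1}(x\mid U_1))\ge \underline L$ for some $\underline L>0$, and degenerate at $x$ otherwise. **Theorem.** As $n\to\infty$, $\ell^m(\theta)\to_d\chi^2_1$, whether or not $f$ is degenerate at $x$. Moreover $\ell(\theta)\to_d\chi^2_1$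 if $f$ is non-degenerate at $x$, and $\ell(\theta)\to_d\tfrac12\chi^2_1$ if $f$ is degenerate at $x$. -/

import Mathlib

open MeasureTheory ProbabilityTheory Filter Topology

noncomputable section

namespace DyadicKDE

/-! ### The dyadic array -/

/-- The vertex shocks `U i` and the edge shocks `W (i, j)`, `i < j`, are mutually independent and
uniformly distributed on `[0, 1]`. -/
structure IsIIDUniform {Ω : Type*} [MeasurableSpace Ω] (P : Measure Ω)
    (U : ℕ → Ω → unitInterval) (W : ℕ × ℕ → Ω → unitInterval) : Prop where
  measurable_vertex : ∀ i, Measurable (U i)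
  measurable_edge : ∀ p : ℕ × ℕ, p.1 < p.2 → Measurable (W p)
  law_vertex : ∀ i, P.map (U i) = volume
  law_edge : ∀ p : ℕ × ℕ, p.1 < p.2 → P.map (W p) = volume
  indep : iIndepFun (Sum.elim U fun p : {p : ℕ × ℕ // p.1 < p.2} => W p.1) P

/-- The array `X i j = F (U i, U j, W (i, j))`; only the entries with `i < j` are ever used. -/
def array {Ω : Type*} (F : unitInterval × unitInterval × unitInterval → ℝ)
    (U : ℕ → Ω → unitInterval) (W : ℕ × ℕ → Ω → unitInterval) (ω : Ω) (i j : ℕ) : ℝ :=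
  F (U i ω, U j ω, W (i, j) ω)

/-! ### Densities and conditional densities on an open set -/

/-- `g` is a version on `O` of the density of `X`. -/
structure IsDensityOn {Ω : Type*} [MeasurableSpace Ω] (P : Measure Ω) (X : Ω → ℝ) (O : Set ℝ)
    (g : ℝ → ℝ) : Prop where
  measurable : Measurable g
  nonneg : ∀ y, 0 ≤ g y
  restrict_eq : (P.map X).restrict O =
    (volume.restrict O).withDensity fun y => ENNReal.ofReal (g y)

/-- `g y z` is a jointly measurable version, for `y ∈ O`, of the conditional density at `y`
of `X` given `Z = z`. -/
structure IsCondDensityOn {Ω E : Type*} [MeasurableSpace Ω] [MeasurableSpace E] (P : Measure Ω)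
    [IsFiniteMeasure P] (X : Ω → ℝ) (Z : Ω → E) (O : Set ℝ) (g : ℝ → E → ℝ) : Prop where
  measurable : Measurable (Function.uncurry g)
  nonneg : ∀ y z, 0 ≤ g y z
  restrict_eq : ∀ᵐ z ∂(P.map Z), (condDistrib X Z P z).restrict O =
    (volume.restrict O).withDensity fun y => ENNReal.ofReal (g y z)

/-! ### The assumptions -/

/-- The requirements on the data generating process: `f`, `f₁` and `f₁₂` are the density of
`X₁₂` and its conditional densities given `U₁` and given `(U₁, U₂)`, near the compact interval
`[a, b]`, with the required smoothness. (Vertices are numbered from `0`.) -/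
structure DataAssumption {Ω : Type*} [MeasurableSpace Ω] (P : Measure Ω) [IsProbabilityMeasure P]
    (F : unitInterval × unitInterval × unitInterval → ℝ)
    (U : ℕ → Ω → unitInterval) (W : ℕ × ℕ → Ω → unitInterval)
    (f : ℝ → ℝ) (f₁ : ℝ → unitInterval → ℝ) (f₁₂ : ℝ → unitInterval × unitInterval → ℝ)
    (a b : ℝ) : Prop where
  measurable_map : Measurable F
  symmetric_map : ∀ u v w, F (u, v, w) = F (v, u, w)
  shocks : IsIIDUniform P U W
  /-- The variance of `X₁₂` (possibly infinite) is positive. -/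
  variance_pos : 0 < evariance (fun ω => array F U W ω 0 1) P
  interval_ssubset_support : Set.Icc a b ⊂ (P.map fun ω => array F U W ω 0 1).support
  densities : ∃ O : Set ℝ, IsOpen O ∧ Set.Icc a b ⊆ O ∧
    IsDensityOn P (fun ω => array F U W ω 0 1) O f ∧
    ContDiffOn ℝ 2 f O ∧
    IsCondDensityOn P (fun ω => array F U W ω 0 1) (U 0) O f₁ ∧
    (∀ᵐ u, ContDiffOn ℝ 2 (fun y => f₁ y u) O) ∧
    IsCondDensityOn P (fun ω => array F U W ω 0 1) (fun ω => (U 0 ω, U 1 ω)) O f₁₂ ∧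
    (∀ᵐ u, ContDiffOn ℝ 1 (fun y => f₁₂ y u) O)
  second_deriv_bounded : ∃ C : ℝ, ∀ y ∈ Set.Icc a b, |iteratedDeriv 2 f y| ≤ C
  cond_second_deriv_bounded : ∃ C : ℝ, ∀ᵐ u, ∀ y ∈ Set.Icc a b,
    |iteratedDeriv 2 (fun y => f₁ y u) y| ≤ C
  cond_deriv_bounded : ∃ C : ℝ, ∀ᵐ u, ∀ y ∈ Set.Icc a b, |deriv (fun y => f₁₂ y u) y| ≤ C

/-- The requirements on the kernel. -/
structure KernelAssumption (K : ℝ → ℝ) : Prop where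
  symmetric : ∀ u, K (-u) = K u
  one_sided_continuous :
    (∀ u, ContinuousWithinAt K (Set.Ici u) u) ∨ (∀ u, ContinuousWithinAt K (Set.Iic u) u)
  nonneg : ∀ u, 0 ≤ K u
  bounded_variation : BoundedVariationOn K Set.univ
  bounded : ∃ C : ℝ, ∀ u, |K u| ≤ C
  integral_eq_one : ∫ u, K u = 1
  integral_mul_eq_zero : ∫ u, u * K u = 0
  integrable_sq_mul : Integrable fun u => u ^ 2 * K u
  integral_sq_mul_pos : 0 < ∫ u, u ^ 2 * K u
  bounded_support : Bornology.IsBounded (Function.support K)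

/-- The requirements on the bandwidths. -/
structure BandwidthAssumption (h : ℕ → ℝ) : Prop where
  pos : ∀ n, 0 < h n
  tendsto_zero : Tendsto h atTop (𝓝 0)
  mul_tendsto : Tendsto (fun n : ℕ => (n : ℝ) * h n) atTop atTop
  mul_sq_tendsto : Tendsto (fun n : ℕ => (n : ℝ) * h n ^ 2) atTop atTop
  mul_rpow_tendsto : Tendsto (fun n : ℕ => (n : ℝ) * h n ^ (5 / 2 : ℝ)) atTop (𝓝 0)

/-- Non-degeneracy at `x`: the variance of `f₁ x U₁` is bounded below by a positive constant. -/
def NonDegenerateAt {Ω : Type*} [MeasurableSpace Ω] (P : Measure Ω) (U : ℕ → Ω → unitInterval)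
    (f₁ : ℝ → unitInterval → ℝ) (x : ℝ) : Prop :=
  ∃ L : ℝ, 0 < L ∧ L ≤ variance (fun ω => f₁ x (U 0 ω)) P

/-! ### The statistics

The vertices observed are `0, …, n - 1`. -/

/-- The pairs `(i, j)` of elements of `A` with `i < j`. -/
def pairs (A : Finset ℕ) : Finset (ℕ × ℕ) := (A ×ˢ A).filter fun p => p.1 < p.2

/-- The dyadic kernel density estimator at `x` with bandwidth `b` computed from the array `X`
restricted to the vertices in `A`. -/
def kde (K : ℝ → ℝ) (x b : ℝ) (X : ℕ → ℕ → ℝ) (A : Finset ℕ) : ℝ :=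
  (∑ p ∈ pairs A, 1 / b * K ((x - X p.1 p.2) / b)) / (A.card.choose 2 : ℝ)

section Jackknife

/-! Here `T A` is the estimator computed from the vertices in `A`, and `t` is a value of the
parameter. -/

variable (T : Finset ℕ → ℝ) (n : ℕ)

/-- The estimator `θ̂` from all vertices. -/
def est : ℝ := T (Finset.range n)

/-- `S(t) = θ̂ - t`. -/
def S (t : ℝ) : ℝ := T (Finset.range n) - t

/-- The leave-one-out version of `S(t)`. -/
def S1 (t : ℝ) (i : ℕ) : ℝ := T ((Finset.range n).erase i) - t

/-- The leave-two-out version of `S(t)`. -/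
def S2 (t : ℝ) (i j : ℕ) : ℝ := T (((Finset.range n).erase i).erase j) - t

/-- The jackknife pseudo values `V_i(t)`. -/
def V (t : ℝ) (i : ℕ) : ℝ := (n : ℝ) * S T n t - ((n : ℝ) - 1) * S1 T n t i

/-- The correction terms `Q_{ij}`. -/
def Q (t : ℝ) (i j : ℕ) : ℝ :=
  ((n : ℝ) - 3) / ((n : ℝ) - 1) *
    ((n : ℝ) * S T n t - ((n : ℝ) - 1) * (S1 T n t i + S1 T n t j)
      + ((n : ℝ) - 2) * S2 T n t i j)

/-- `Γ²`. -/
def gammaSq (t : ℝ) : ℝ := 1 / (n : ℝ) * ∑ i ∈ Finset.range n, V T n t i ^ 2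

/-- `Γ_m²`, the bias-corrected jackknife variance estimator. -/
def gammaModSq (t : ℝ) : ℝ :=
  1 / (n : ℝ) * ∑ i ∈ Finset.range n, V T n (est T n) i ^ 2
    - 1 / (n : ℝ) * ∑ p ∈ pairs (Finset.range n), Q T n t p.1 p.2 ^ 2

/-- The modified jackknife pseudo values `V_i^m(t)`. -/
def Vmod (t : ℝ) (i : ℕ) : ℝ :=
  V T n (est T n) i
    - Real.sqrt (gammaSq T n t) * (Real.sqrt (gammaModSq T n t))⁻¹
      * (V T n (est T n) i - V T n t i)

end Jackknife

/-- The weights allowed in the empirical likelihood problem for the pseudo values `v`. -/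
def weights (n : ℕ) (v : ℕ → ℝ) : Set (Fin n → ℝ) :=
  {w | (∀ i, 0 ≤ w i) ∧ ∑ i, w i = 1 ∧ ∑ i, w i * v i = 0}

/-- The empirical likelihood function `-2 sup_w ∑ log (n w_i)`, with `log 0 = -∞` and with the
supremum of the empty set equal to `-∞`. -/
def elStat (n : ℕ) (v : ℕ → ℝ) : EReal :=
  -2 * ⨆ w ∈ weights n v, ∑ i, ENNReal.log (ENNReal.ofReal ((n : ℝ) * w i))

/-- The jackknife empirical likelihood statistic `ℓ(t)`. -/
def jel (K : ℝ → ℝ) (x b : ℝ) (X : ℕ → ℕ → ℝ) (n : ℕ) (t : ℝ) : EReal :=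
  elStat n (V (kde K x b X) n t)

/-- The modified jackknife empirical likelihood statistic `ℓ^m(t)`. -/
def jelMod (K : ℝ → ℝ) (x b : ℝ) (X : ℕ → ℕ → ℝ) (n : ℕ) (t : ℝ) : EReal :=
  elStat n (Vmod (kde K x b X) n t)

end DyadicKDE

end

/-!
The density estimator is the average over the edges `{i, j}` of the array
`Y_{ij} = h⁻¹ K ((x - X_{ij}) / h)`, which has the Hoeffding decomposition
`Y_{ij} = m + (g (U_i) + g (U_j)) + interaction (U_i, U_j) + noise_{ij}`: the first three terms make
up the conditional mean given the vertex shocks, and the noise is centered and independent over the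
edges conditionally on the vertices. Since the conditional densities given one or two vertices are
bounded, `g` and the interaction stay bounded as `h → 0`, and `g` converges to the score
`ξ u = f_{X|U} (x | u) - f x` with a bias of order `h ^ 2` (`IsBump.abs_integral_rescaled_sub_le`),
while the noise has a variance of order `κ / h` with `κ = f x * ∫ K ^ 2`
(`SmoothMap.exists_isLocalArray`).

The jackknife acts linearly on the array. The pseudo value `V_i` is `2 ξ (U_i)` plus `2 / (n - 2)`
times the noise of the edges at `i`, and `Q_{ij}` is `2 / (n - 1)` times the noise of the edge
`{i, j}`, up to terms which are negligible in mean square (`V_eq_main_add_rem`,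
`Q_eq_main_add_rem`, `sum_V_eq_main_add_rem`). The bandwidth condition `n h ^ (5 / 2) → 0` removes
the bias.

For pseudo values `v_i` and a normalization `c` such that `c ∑ v_i` is tight, `c ^ 2 ∑ v_i ^ 2 → d`
and `c max |v_i| → 0`, Wilks' expansion shows that the empirical likelihood statistic is
`(c ∑ v_i) ^ 2 / d + o(1)` (`elStat_expansion`, `elStat_tendstoInDistribution`). If `τ` is the
asymptotic variance of `c ∑ V_i`, then the limit is `τ / d` times a `χ²₁` variable. The structure
`JackknifeLimit` collects these limits, and it adds that `c ^ 2 ∑ Q_{ij} ^ 2 → d - τ`, so that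
`Γ / Γ_m → √(d / τ)`. The modification multiplies the centered sum by this ratio and does not change
the sum of squares asymptotically, so that the limit becomes `χ²₁` whatever `τ` and `d` are
(`JackknifeLimit.tendsto_elStat_Vmod`). It remains to find `τ` and `d`.

* If `x` is a point of non-degeneracy, then `c = 1 / √n`. As `n h → ∞`, the vertex terms dominate,
  and `τ = d = 4 ∫ ξ ^ 2` by the central limit theorem and the law of large numbers for i.i.d.
  variables (`IsLocalArray.jackknifeLimit_nondegenerate`).
* If `x` is a point of degeneracy, then `ξ = 0` and `c = √h`. The noise dominates. Conditionally on
  the vertices its characteristic function is close to a Gaussian one whose variance converges to a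
  constant, which gives the limit law of the sum of all noise terms with `τ = 2 κ`
  (`IsLocalArray.tendstoInDistribution_tot_noise`). The sum of squares of the pseudo values however
  counts the noise of each edge at both of its end points, and `d = 4 κ`; this is the origin of the
  factor `1 / 2` (`IsLocalArray.jackknifeLimit_degenerate`).

Convergence in probability is expressed by a filter, `probFilter`, and all computations take place
on a canonical product space with one shock for each vertex and one for each edge, to which
`IsIIDUniform.tendstoInDistribution` reduces the general case.
-/

noncomputable section

namespace DyadicKDE

/-! ### The empirical likelihood statistic -/

lemma sum_log_ofReal_eq {n : ℕ} (a : Fin n → ℝ) (ha : ∀ i, 0 ≤ a i) :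
    ∑ i, ENNReal.log (ENNReal.ofReal (a i)) = ENNReal.log (ENNReal.ofReal (∏ i, a i)) := by
  classical
  rw [ENNReal.ofReal_prod_of_nonneg fun i _ => ha i]
  refine Finset.induction_on (Finset.univ : Finset (Fin n)) (by simp) fun i s hi ih => ?_
  rw [Finset.sum_insert hi, Finset.prod_insert hi, ENNReal.log_mul_add, ih]

/-- The level sets `{v | ∃ w, φ w ≥ c}` of the profile are projections of closed sets along the
compact simplex, so the profile is upper semicontinuous in the pseudo values. -/
lemma measurable_elStat (n : ℕ) : Measurable (elStat n) := by
  have hcl (c : EReal) : IsClosed {v : ℕ → ℝ | ∃ w ∈ weights n v,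
      c ≤ ∑ i, ENNReal.log (ENNReal.ofReal ((n : ℝ) * w i))} := by
    have hK := isCompact_iff_compactSpace.1 (isCompact_stdSimplex ℝ (Fin n))
    have hC : IsClosed {q : stdSimplex ℝ (Fin n) × (ℕ → ℝ) | ∑ i, q.1.1 i * q.2 i = 0 ∧
        c ≤ ENNReal.log (ENNReal.ofReal (∏ i, ((n : ℝ) * q.1.1 i)))} := by
      have hq (i : Fin n) : Continuous fun q : stdSimplex ℝ (Fin n) × (ℕ → ℝ) => q.1.1 i :=
        (continuous_apply i).comp (continuous_subtype_val.comp continuous_fst)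
      have h2 : Continuous fun q : stdSimplex ℝ (Fin n) × (ℕ → ℝ) =>
          ENNReal.log (ENNReal.ofReal (∏ i, ((n : ℝ) * q.1.1 i))) :=
        ENNReal.continuous_log.comp (ENNReal.continuous_ofReal.comp
          (continuous_finsetProd _ fun i _ => continuous_const.mul (hq i)))
      have h1 : Continuous fun q : stdSimplex ℝ (Fin n) × (ℕ → ℝ) => ∑ i : Fin n, q.1.1 i * q.2 i :=
        continuous_finsetSum _ fun i _ => (hq i).mul
          ((continuous_apply (i : ℕ)).comp continuous_snd)
      exact (isClosed_eq h1 continuous_const).inter (isClosed_Ici.preimage h2)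
    convert isClosedMap_snd_of_compactSpace _ hC using 1
    ext v
    constructor
    · rintro ⟨w, ⟨hw0, hw1, hw⟩, hc⟩
      refine ⟨(⟨w, hw0, hw1⟩, v), ⟨hw, ?_⟩, rfl⟩
      rwa [← sum_log_ofReal_eq _ fun i => mul_nonneg n.cast_nonneg (hw0 i)]
    · rintro ⟨⟨⟨w, hw0, hw1⟩, v⟩, ⟨hw, hc⟩, rfl⟩
      refine ⟨w, ⟨hw0, hw1, hw⟩, ?_⟩
      rwa [sum_log_ofReal_eq _ fun i => mul_nonneg n.cast_nonneg (hw0 i)]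
  have hmeas : Measurable fun v : ℕ → ℝ =>
      ⨆ w ∈ weights n v, ∑ i, ENNReal.log (ENNReal.ofReal ((n : ℝ) * w i)) := by
    refine measurable_of_Ioi fun c => ?_
    obtain ⟨D, hDc, hD⟩ := TopologicalSpace.exists_countable_dense EReal
    have : (fun v : ℕ → ℝ =>
        ⨆ w ∈ weights n v, ∑ i, ENNReal.log (ENNReal.ofReal ((n : ℝ) * w i))) ⁻¹' Set.Ioi c =
        ⋃ d ∈ D ∩ Set.Ioi c, {v : ℕ → ℝ | ∃ w ∈ weights n v,
          d ≤ ∑ i, ENNReal.log (ENNReal.ofReal ((n : ℝ) * w i))} ∪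
        {v : ℕ → ℝ | ∃ w ∈ weights n v, ⊤ ≤
          ∑ i, ENNReal.log (ENNReal.ofReal ((n : ℝ) * w i))} ∩ {_v | c < ⊤} := by
      ext v
      simp only [Set.mem_preimage, Set.mem_Ioi, lt_iSup_iff, Set.mem_iUnion, Set.mem_inter_iff,
        Set.mem_ofPred_eq, Set.mem_union]
      constructor
      · rintro ⟨w, hw, hc⟩
        obtain ⟨d, hdD, hd⟩ := hD.exists_between hc
        exact ⟨d, ⟨hdD, hd.1⟩, Or.inl ⟨w, hw, hd.2.le⟩⟩
      · rintro ⟨d, ⟨-, hd⟩, ⟨w, hw, h⟩ | ⟨⟨w, hw, h⟩, hc⟩⟩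
        · exact ⟨w, hw, lt_of_lt_of_le hd h⟩
        · exact ⟨w, hw, lt_of_lt_of_le hc h⟩
    rw [this]
    refine MeasurableSet.biUnion (hDc.mono Set.inter_subset_left) fun d _ => ?_
    exact (hcl d).measurableSet.union ((hcl ⊤).measurableSet.inter (MeasurableSet.const _))
  exact hmeas.const_mul _

lemma elStat_const_mul {n : ℕ} (v : ℕ → ℝ) {c : ℝ} (hc : c ≠ 0) :
    elStat n (fun i => c * v i) = elStat n v := by
  have : weights n (fun i => c * v i) = weights n v := by
    ext w
    simp only [weights, Set.mem_ofPred_eq]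
    have : ∑ i : Fin n, w i * (c * v i) = c * ∑ i : Fin n, w i * v i := by
      rw [Finset.mul_sum]
      exact Finset.sum_congr rfl fun i _ => by ring
    rw [this, mul_eq_zero, or_iff_right hc]
  simp only [elStat, this]

/-- Taylor expansion of the logarithm to second order. -/
lemma abs_log_one_add_sub_le {y : ℝ} (hy : |y| ≤ 1 / 2) :
    |Real.log (1 + y) - (y - y ^ 2 / 2)| ≤ 2 * |y| ^ 3 := by
  have h := Real.abs_log_sub_add_sum_range_le (x := -y) (by rw [abs_neg]; linarith) 2
  simp only [Finset.sum_range_succ, Finset.sum_range_zero, abs_neg, sub_neg_eq_add] at h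
  have h2 : |y| ^ (2 + 1) / (1 - |y|) ≤ 2 * |y| ^ 3 := by
    rw [div_le_iff₀ (by linarith)]
    norm_num
    nlinarith [pow_nonneg (abs_nonneg y) 3]
  refine le_trans (le_of_eq ?_) (h.trans h2)
  congr 1
  push_cast
  ring

/-- Comparison of `∑ log (1 + y i)` with its second order expansion. -/
lemma abs_sum_log_one_add_sub_le {n : ℕ} (y : Fin n → ℝ) {δ : ℝ} (hδ : δ ≤ 1 / 2)
    (hy : ∀ i, |y i| ≤ δ) :
    |∑ i, Real.log (1 + y i) - (∑ i, y i - (∑ i, y i ^ 2) / 2)| ≤ 2 * δ * ∑ i, y i ^ 2 := by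
  rw [Finset.sum_div, ← Finset.sum_sub_distrib, ← Finset.sum_sub_distrib, Finset.mul_sum]
  refine (Finset.abs_sum_le_sum_abs _ _).trans (Finset.sum_le_sum fun i _ => ?_)
  refine (abs_log_one_add_sub_le ((hy i).trans hδ)).trans ?_
  have : |y i| ^ 3 = |y i| * y i ^ 2 := by rw [pow_succ', sq_abs]
  rw [this]
  nlinarith [mul_le_mul_of_nonneg_right (hy i) (sq_nonneg (y i))]

/-- Duality bound: every multiplier `t` with `1 + t z i > 0` bounds the likelihood from above. -/
lemma sum_log_weights_le {n : ℕ} {z : ℕ → ℝ} {t : ℝ} (ht : ∀ i < n, 0 < 1 + t * z i)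
    {w : Fin n → ℝ} (hw : w ∈ weights n z) :
    ∑ i, ENNReal.log (ENNReal.ofReal ((n : ℝ) * w i)) ≤
      ((-∑ i : Fin n, Real.log (1 + t * z i) : ℝ) : EReal) := by
  obtain ⟨hw0, hw1, hwz⟩ := hw
  rw [sum_log_ofReal_eq _ fun i => mul_nonneg n.cast_nonneg (hw0 i)]
  rcases (Finset.prod_nonneg fun i _ => mul_nonneg n.cast_nonneg (hw0 i) :
    0 ≤ ∏ i, ((n : ℝ) * w i)).eq_or_lt with h | h
  · rw [← h]; simp
  rw [ENNReal.log_ofReal_of_pos h, EReal.coe_le_coe_iff]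
  have hne : ∀ i, (n : ℝ) * w i ≠ 0 := fun i hi =>
    h.ne' (Finset.prod_eq_zero (Finset.mem_univ i) hi)
  rw [Real.log_prod fun i _ => hne i, le_neg_iff_add_nonpos_right, ← Finset.sum_add_distrib]
  calc ∑ i : Fin n, (Real.log ((n : ℝ) * w i) + Real.log (1 + t * z i))
      ≤ ∑ i : Fin n, ((n : ℝ) * w i * (1 + t * z i) - 1) := by
        refine Finset.sum_le_sum fun i _ => ?_
        rw [← Real.log_mul (hne i) (ht i i.2).ne']
        exact Real.log_le_sub_one_of_pos (mul_pos
          (lt_of_le_of_ne (mul_nonneg n.cast_nonneg (hw0 i)) (hne i).symm) (ht i i.2))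
    _ = n * ∑ i, w i + n * t * ∑ i : Fin n, w i * z i - n := by
        simp only [Finset.sum_sub_distrib, Finset.mul_sum, ← Finset.sum_add_distrib]
        simp only [Finset.sum_const, Finset.card_univ, Fintype.card_fin, nsmul_eq_mul, mul_one]
        congr 1
        exact Finset.sum_congr rfl fun i _ => by ring
    _ = 0 := by rw [hw1, hwz]; ring

/-- Wilks expansion, deterministic form: for self-normalized pseudo values with maximum at most `ε`
and sum `T` bounded by `M`, the empirical likelihood statistic is finite and within
`20 M ^ 3 ε` of `T ^ 2`. The lower bound uses the multiplier `T`, the upper bound the affine weights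
`(1 - s (z i - T / n)) / n`, with `s` fixed by the constraint `∑ w i z i = 0`. -/
lemma exists_elStat_eq_of_normalized {n : ℕ} {z : ℕ → ℝ} {T M ε : ℝ}
    (hsum : ∑ i : Fin n, z i = T) (hsq : ∑ i : Fin n, z i ^ 2 = 1) (hmax : ∀ i < n, |z i| ≤ ε)
    (hM : 1 ≤ M) (hT : |T| ≤ M) (hε : ε * M ≤ 1 / 8) :
    ∃ r : ℝ, elStat n z = r ∧ |r - T ^ 2| ≤ 20 * M ^ 3 * ε := by
  have hn : 0 < n := by
    rcases Nat.eq_zero_or_pos n with rfl | h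
    · simp at hsq
    · exact h
  have hnR : (0 : ℝ) < n := by exact_mod_cast hn
  have hε0 : 0 ≤ ε := (abs_nonneg _).trans (hmax 0 hn)
  have hnε : 1 / (n : ℝ) ≤ ε ^ 2 := by
    rw [div_le_iff₀ hnR, ← hsq]
    calc ∑ i : Fin n, z i ^ 2 ≤ ∑ i : Fin n, ε ^ 2 := Finset.sum_le_sum fun i _ => by
          rw [← sq_abs]; exact pow_le_pow_left₀ (abs_nonneg _) (hmax i i.2) 2
      _ = ε ^ 2 * n := by simp [mul_comm]
  have hT2 : T ^ 2 ≤ M ^ 2 := by rw [← sq_abs]; exact pow_le_pow_left₀ (abs_nonneg _) hT 2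
  set a : ℝ := T ^ 2 / n with ha
  have ha0 : 0 ≤ a := by positivity
  have haM : a ≤ M ^ 2 * ε ^ 2 := by
    rw [ha, div_eq_mul_one_div]
    exact mul_le_mul hT2 hnε (by positivity) (by positivity)
  have haε : a ≤ M * ε / 8 := by nlinarith [mul_nonneg (by linarith : 0 ≤ M) hε0]
  have ha64 : a ≤ 1 / 64 := by linarith
  have hMM : M ≤ M ^ 3 := by nlinarith [sq_nonneg M]
  -- upper bound on the likelihood
  have hup : ∀ w ∈ weights n z, ∑ i, ENNReal.log (ENNReal.ofReal ((n : ℝ) * w i)) ≤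
      ((-(T ^ 2 / 2) + 2 * M ^ 3 * ε : ℝ) : EReal) := by
    intro w hw
    have hb : ∀ i : Fin n, |T * z i| ≤ M * ε := fun i => by
      rw [abs_mul]; exact mul_le_mul hT (hmax i i.2) (abs_nonneg _) (by linarith)
    refine (sum_log_weights_le (t := T) (fun i hi => ?_) hw).trans ?_
    · have := abs_le.1 (hb ⟨i, hi⟩)
      simp only at this
      linarith
    rw [EReal.coe_le_coe_iff]
    have h := abs_le.1 (abs_sum_log_one_add_sub_le (fun i : Fin n => T * z i)
      (δ := M * ε) (by linarith) hb)
    simp only [mul_pow, ← Finset.mul_sum, hsum, hsq] at h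
    have : M * ε * T ^ 2 ≤ M * ε * M ^ 2 :=
      mul_le_mul_of_nonneg_left hT2 (mul_nonneg (by linarith) hε0)
    nlinarith [h.1]
  -- the affine weights
  set s : ℝ := T / (1 - a) with hs
  have h1a : 0 < 1 - a := by linarith
  have hsa : s * (1 - a) = T := by rw [hs]; field_simp
  have hsM : |s| ≤ 64 / 63 * M := by
    rw [hs, abs_div, abs_of_pos h1a, div_le_iff₀ h1a]
    nlinarith
  have hTn : |T / n| ≤ M * ε ^ 2 := by
    rw [abs_div, abs_of_pos hnR, div_eq_mul_one_div]
    exact mul_le_mul hT hnε (by positivity) (by linarith)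
  have hy : ∀ i : Fin n, |-s * (z i - T / n)| ≤ 9 / 4 * (M * ε) := fun i => by
    rw [abs_mul, abs_neg]
    have h1 : |z i - T / n| ≤ 9 / 8 * ε := (abs_sub _ _).trans (by
      have := hmax i i.2
      nlinarith)
    calc |s| * |z i - T / n| ≤ (64 / 63 * M) * (9 / 8 * ε) :=
          mul_le_mul hsM h1 (abs_nonneg _) (by linarith)
      _ ≤ _ := by nlinarith [mul_nonneg (by linarith : 0 ≤ M) hε0]
  have hyhalf : 9 / 4 * (M * ε) ≤ 1 / 2 := by linarith
  have hpos : ∀ i : Fin n, 0 < 1 + -s * (z i - T / n) := fun i => by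
    have := abs_le.1 (hy i); linarith
  have hsumy : ∑ i : Fin n, -s * (z i - T / n) = 0 := by
    rw [← Finset.mul_sum, Finset.sum_sub_distrib, hsum]
    simp only [Finset.sum_const, Finset.card_univ, Fintype.card_fin, nsmul_eq_mul]
    field_simp
    ring
  have hsumy2 : ∑ i : Fin n, (-s * (z i - T / n)) ^ 2 = s * T := by
    have : ∀ i : Fin n, (-s * (z i - T / n)) ^ 2 =
        s ^ 2 * z i ^ 2 - 2 * s ^ 2 * (T / n) * z i + s ^ 2 * (T / n) ^ 2 := fun i => by ring
    simp only [this, Finset.sum_add_distrib, Finset.sum_sub_distrib, ← Finset.mul_sum, hsum, hsq]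
    simp only [Finset.sum_const, Finset.card_univ, Fintype.card_fin, nsmul_eq_mul]
    have : s * T = s * (s * (1 - a)) := by rw [hsa]
    rw [this, ha]
    field_simp
    ring
  have hsT : s * T = T ^ 2 / (1 - a) := by rw [hs]; ring
  have hsT2 : s * T ≤ T ^ 2 + M ^ 3 * ε := by
    rw [hsT, div_le_iff₀ h1a]
    have : T ^ 2 * a ≤ M ^ 2 * (M * ε / 8) := mul_le_mul hT2 haε ha0 (by positivity)
    nlinarith [mul_nonneg (pow_nonneg (by linarith : 0 ≤ M) 3) hε0]
  have hsT0 : 0 ≤ s * T := by rw [hsT]; positivity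
  have hsT3 : s * T ≤ 64 / 63 * M ^ 2 := by
    rw [hsT, div_le_iff₀ h1a]; nlinarith [sq_nonneg M]
  have hlow : ((-(T ^ 2 / 2) - 10 * M ^ 3 * ε : ℝ) : EReal) ≤
      ⨆ w ∈ weights n z, ∑ i, ENNReal.log (ENNReal.ofReal ((n : ℝ) * w i)) := by
    refine le_iSup₂_of_le (fun i : Fin n => (1 + -s * (z i - T / n)) / n) ⟨?_, ?_, ?_⟩ ?_
    · exact fun i => (div_pos (hpos i) hnR).le
    · rw [← Finset.sum_div, Finset.sum_add_distrib, hsumy]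
      simp [hnR.ne']
    · have h1 : ∀ i : Fin n, (1 + -s * (z i - T / n)) / n * z i =
          (1 + s * (T / n)) / n * z i - s / n * z i ^ 2 := fun i => by ring
      simp only [h1, Finset.sum_sub_distrib, ← Finset.mul_sum, hsum, hsq]
      have : (1 + s * (T / n)) / n * T - s / n * 1 = (T - s * (1 - a)) / n := by
        rw [ha]; ring
      rw [this, hsa]; simp
    · have h1 : ∀ i : Fin n, (n : ℝ) * ((1 + -s * (z i - T / n)) / n) = 1 + -s * (z i - T / n) :=
        fun i => by field_simp
      simp only [h1]
      rw [sum_log_ofReal_eq _ fun i => (hpos i).le,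
        ENNReal.log_ofReal_of_pos (Finset.prod_pos fun i _ => hpos i), EReal.coe_le_coe_iff,
        Real.log_prod fun i _ => (hpos i).ne']
      have h := (abs_le.1 (abs_sum_log_one_add_sub_le _ hyhalf hy)).1
      rw [hsumy, hsumy2] at h
      have h3 : 9 / 4 * (M * ε) * (s * T) ≤ 9 / 4 * (M * ε) * (64 / 63 * M ^ 2) :=
        mul_le_mul_of_nonneg_left hsT3 (by positivity)
      nlinarith [mul_nonneg (pow_nonneg (by linarith : 0 ≤ M) 3) hε0]
  have hup' : ⨆ w ∈ weights n z, ∑ i, ENNReal.log (ENNReal.ofReal ((n : ℝ) * w i)) ≤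
      ((-(T ^ 2 / 2) + 2 * M ^ 3 * ε : ℝ) : EReal) := iSup₂_le hup
  obtain ⟨Sv, hSv⟩ : ∃ Sv : ℝ,
      ⨆ w ∈ weights n z, ∑ i, ENNReal.log (ENNReal.ofReal ((n : ℝ) * w i)) = Sv := by
    refine ⟨_, (EReal.coe_toReal (fun h => ?_) fun h => ?_).symm⟩
    · rw [h] at hup'; exact EReal.coe_ne_top _ (top_le_iff.1 hup')
    · rw [h] at hlow; exact EReal.coe_ne_bot _ (le_bot_iff.1 hlow)
  rw [hSv, EReal.coe_le_coe_iff] at hup' hlow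
  refine ⟨-2 * Sv, ?_, ?_⟩
  · rw [elStat, hSv]; push_cast; rfl
  · have h0 : 0 ≤ M ^ 3 * ε := mul_nonneg (pow_nonneg (by linarith) 3) hε0
    rw [abs_le]
    constructor <;> linarith

/-! ### Convergence in probability as a filter -/

section ProbFilter

variable {Ω : Type*} [MeasurableSpace Ω]

/-- The filter on `ℕ × Ω` of the sets whose sections at `n` have probability tending to one.
Convergence along this filter to a constant is convergence in probability, so that the usual
filter calculus replaces the calculus of `o_P(1)` terms. -/
def probFilter (P : Measure Ω) : Filter (ℕ × Ω) where
  sets := {B | Tendsto (fun n => P {ω | (n, ω) ∉ B}) atTop (𝓝 0)}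
  univ_sets := by simp
  sets_of_superset {A B} hA hAB := by
    refine tendsto_of_tendsto_of_tendsto_of_le_of_le tendsto_const_nhds hA (fun _ => zero_le)
      fun n => measure_mono fun ω hω h => hω (hAB h)
  inter_sets {A B} hA hB := by
    refine tendsto_of_tendsto_of_tendsto_of_le_of_le tendsto_const_nhds
      (by simpa using Tendsto.add hA hB) (fun _ => zero_le) fun n => ?_
    refine (measure_mono fun ω hω => ?_).trans (measure_union_le _ _)
    by_contra h
    simp only [Set.mem_union, Set.mem_ofPred_eq, not_or, not_not] at h
    exact hω ⟨h.1, h.2⟩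

variable {P : Measure Ω}

lemma mem_probFilter {B : Set (ℕ × Ω)} :
    B ∈ probFilter P ↔ Tendsto (fun n => P {ω | (n, ω) ∉ B}) atTop (𝓝 0) := Iff.rfl

lemma eventually_probFilter {p : ℕ × Ω → Prop} :
    (∀ᶠ q in probFilter P, p q) ↔ Tendsto (fun n => P {ω | ¬ p (n, ω)}) atTop (𝓝 0) := Iff.rfl

lemma tendsto_fst_probFilter : Tendsto Prod.fst (probFilter P) atTop := by
  intro s hs
  rw [mem_map, mem_probFilter]
  refine tendsto_const_nhds.congr' ?_
  filter_upwards [hs] with n hn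
  simp [hn]

lemma tendstoInMeasure_of_probFilter {X : ℕ → Ω → ℝ} {a : ℝ}
    (h : Tendsto (fun q : ℕ × Ω => X q.1 q.2) (probFilter P) (𝓝 a)) :
    TendstoInMeasure P X atTop fun _ => a := by
  rw [tendstoInMeasure_iff_norm]
  intro ε hε
  have := eventually_probFilter.1 (h (Metric.ball_mem_nhds a hε))
  refine this.congr fun n => ?_
  congr 1
  ext ω
  simp [Real.dist_eq]

/-- Markov's inequality. -/
lemma tendsto_probFilter_zero_of_integral_abs_le {X : ℕ → Ω → ℝ} {b : ℕ → ℝ}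
    (hX : ∀ᶠ n in atTop, Integrable (X n) P) (hb : ∀ᶠ n in atTop, ∫ ω, |X n ω| ∂P ≤ b n)
    (hb0 : Tendsto b atTop (𝓝 0)) [IsFiniteMeasure P] :
    Tendsto (fun q : ℕ × Ω => X q.1 q.2) (probFilter P) (𝓝 0) := by
  rw [Metric.tendsto_nhds]
  intro ε hε
  rw [eventually_probFilter]
  have hlim : Tendsto (fun n => ENNReal.ofReal (b n / ε)) atTop (𝓝 0) := by
    have := ENNReal.tendsto_ofReal (hb0.div_const ε)
    simpa using this
  refine tendsto_of_tendsto_of_tendsto_of_le_of_le' tendsto_const_nhds hlim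
    (Eventually.of_forall fun _ => zero_le) ?_
  filter_upwards [hX, hb] with n hn hbn
  have hset : {ω | ¬ dist (X n ω) 0 < ε} = {ω | ε ≤ |X n ω|} := by
    ext ω; simp
  simp only [hset]
  have := mul_meas_ge_le_integral_of_nonneg (μ := P) (f := fun ω => |X n ω|)
    (ae_of_all _ fun ω => abs_nonneg _) hn.abs ε
  rw [← ENNReal.ofReal_toReal (measure_ne_top P _)]
  refine ENNReal.ofReal_le_ofReal ?_
  rw [le_div_iff₀ hε, mul_comm]
  exact this.trans hbn

/-- A sequence which converges in distribution is tight. -/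
lemma exists_eventually_measure_le_of_tendstoInDistribution [IsProbabilityMeasure P]
    {Ω' : Type*} [MeasurableSpace Ω'] {P' : Measure Ω'} [IsProbabilityMeasure P']
    {N : ℕ → Ω → ℝ} {Z : Ω' → ℝ}
    (hN : TendstoInDistribution N atTop Z (fun _ => P) P') {η : ENNReal} (hη : 0 < η) :
    ∃ M : ℝ, ∀ᶠ n in atTop, P {ω | ¬ |N n ω| ≤ M} < η := by
  have hZ := hN.aemeasurable_limit
  have h0 : Tendsto (fun k : ℕ => P'.map Z {y | (k : ℝ) ≤ |y|}) atTop (𝓝 0) := by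
    have := Measure.isProbabilityMeasure_map (μ := P') hZ
    have hmeas (k : ℕ) : MeasurableSet {y : ℝ | (k : ℝ) ≤ |y|} :=
      measurableSet_le measurable_const measurable_norm
    have h := tendsto_measure_iInter_atTop (μ := P'.map Z)
      (s := fun k : ℕ => {y : ℝ | (k : ℝ) ≤ |y|})
      (fun k => (hmeas k).nullMeasurableSet)
      (fun i j hij y (hy : (j : ℝ) ≤ |y|) =>
        show (i : ℝ) ≤ |y| from le_trans (by exact_mod_cast hij) hy) ⟨0, measure_ne_top _ _⟩
    have he : ⋂ k : ℕ, {y : ℝ | (k : ℝ) ≤ |y|} = ∅ := by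
      ext y
      simp only [Set.mem_iInter, Set.mem_ofPred_eq, Set.mem_empty_iff_false, iff_false, not_forall,
        not_le]
      exact exists_nat_gt |y|
    rwa [he, measure_empty] at h
  obtain ⟨k, hk⟩ := (h0.eventually_lt_const hη).exists
  refine ⟨k, ?_⟩
  have hclosed : IsClosed {y : ℝ | (k : ℝ) ≤ |y|} := isClosed_le continuous_const continuous_abs
  have hlim := ProbabilityMeasure.limsup_measure_closed_le_of_tendsto hN.tendsto hclosed
  filter_upwards [eventually_lt_of_limsup_lt (lt_of_le_of_lt hlim hk)] with n hn
  refine lt_of_le_of_lt ?_ hn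
  simp only [ProbabilityMeasure.coe_mk]
  rw [Measure.map_apply_of_aemeasurable (hN.forall_aemeasurable n) hclosed.measurableSet]
  refine measure_mono fun ω hω => ?_
  simp only [Set.mem_ofPred_eq, not_le] at hω
  exact hω.le

/-- A property which holds with probability tending to one on each event `|N| ≤ M` holds with
probability tending to one, if `N` is tight. -/
lemma eventually_probFilter_of_tight [IsProbabilityMeasure P]
    {Ω' : Type*} [MeasurableSpace Ω'] {P' : Measure Ω'} [IsProbabilityMeasure P']
    {N : ℕ → Ω → ℝ} {Z : Ω' → ℝ}
    (hN : TendstoInDistribution N atTop Z (fun _ => P) P') {p : ℕ × Ω → Prop}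
    (h : ∀ M : ℝ, ∀ᶠ q in probFilter P ⊓ 𝓟 {q | |N q.1 q.2| ≤ M}, p q) :
    ∀ᶠ q in probFilter P, p q := by
  rw [eventually_probFilter, ENNReal.tendsto_nhds_zero]
  intro η hη
  obtain ⟨M, hM⟩ := exists_eventually_measure_le_of_tendstoInDistribution hN
    (ENNReal.half_pos hη.ne')
  have h1 := eventually_probFilter.1 (eventually_inf_principal.1 (h M))
  filter_upwards [hM, ENNReal.tendsto_nhds_zero.1 h1 _ (ENNReal.half_pos hη.ne')] with n hn1 hn2
  refine (measure_mono fun ω hω => ?_).trans ((measure_union_le _ _).trans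
    ((add_le_add hn1.le hn2).trans (ENNReal.add_halves η).le))
  by_cases hω' : |N n ω| ≤ M
  · exact Or.inr fun h => hω (h hω')
  · exact Or.inl hω'

/-- Random variables which agree with probability tending to one have the same limit law. The
codomain carries no metric structure here, so that the lemma covers values in `EReal`. -/
lemma tendstoInDistribution_of_eventually_eq [IsProbabilityMeasure P]
    {Ω' : Type*} [MeasurableSpace Ω'] {P' : Measure Ω'} [IsProbabilityMeasure P']
    {E : Type*} [TopologicalSpace E] [MeasurableSpace E] [OpensMeasurableSpace E]
    {X Y : ℕ → Ω → E} {Z : Ω' → E} (hX : TendstoInDistribution X atTop Z (fun _ => P) P')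
    (hY : ∀ n, AEMeasurable (Y n) P) (hXY : ∀ᶠ q in probFilter P, X q.1 q.2 = Y q.1 q.2) :
    TendstoInDistribution Y atTop Z (fun _ => P) P' := by
  refine ⟨hY, hX.aemeasurable_limit, ?_⟩
  have hX' := ProbabilityMeasure.tendsto_iff_forall_integral_tendsto.1 hX.tendsto
  refine ProbabilityMeasure.tendsto_iff_forall_integral_tendsto.2 fun g => ?_
  have hdiff : Tendsto (fun n => ∫ x, g x ∂(P.map (Y n)) - ∫ x, g x ∂(P.map (X n))) atTop
      (𝓝 0) := by
    have h0 : Tendsto (fun n => 2 * ‖g‖ * P.real {ω | ¬ X n ω = Y n ω}) atTop (𝓝 0) := by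
      have := (ENNReal.tendsto_toReal ENNReal.zero_ne_top).comp (eventually_probFilter.1 hXY)
      simpa [measureReal_def] using this.const_mul (2 * ‖g‖)
    refine squeeze_zero_norm (fun n => ?_) h0
    have hgm : ∀ μ : Measure E, AEStronglyMeasurable g μ := fun μ =>
      g.continuous.measurable.aestronglyMeasurable
    rw [integral_map (hY n) (hgm _), integral_map (hX.forall_aemeasurable n) (hgm _)]
    have hi1 : Integrable (fun ω => g (Y n ω)) P := Integrable.of_bound
      (g.continuous.measurable.comp_aemeasurable (hY n)).aestronglyMeasurable ‖g‖
      (ae_of_all _ fun ω => g.norm_coe_le_norm _)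
    have hi2 : Integrable (fun ω => g (X n ω)) P := Integrable.of_bound
      (g.continuous.measurable.comp_aemeasurable (hX.forall_aemeasurable n)).aestronglyMeasurable
      ‖g‖ (ae_of_all _ fun ω => g.norm_coe_le_norm _)
    rw [← integral_sub hi1 hi2]
    set A := {ω | ¬ X n ω = Y n ω} with hA
    have hAs : ∀ ω ∉ toMeasurable P A, g (Y n ω) - g (X n ω) = 0 := fun ω hω => by
      have : ω ∉ A := fun h => hω (subset_toMeasurable P A h)
      simp only [hA, Set.mem_ofPred_eq, not_not] at this
      simp [this]
    rw [← setIntegral_eq_integral_of_forall_compl_eq_zero hAs]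
    refine (norm_setIntegral_le_of_norm_le_const (C := 2 * ‖g‖) ?_ fun ω _ => ?_).trans_eq ?_
    · exact measure_lt_top _ _
    · refine (norm_sub_le _ _).trans ?_
      have := g.norm_coe_le_norm (Y n ω)
      have := g.norm_coe_le_norm (X n ω)
      linarith
    · rw [measureReal_def, measure_toMeasurable, measureReal_def]
  have := hdiff.add (hX' g)
  simpa using this

end ProbFilter

/-! ### The limit law of an empirical likelihood statistic -/

section Wilks

variable {Ω : Type*} [MeasurableSpace Ω] {P : Measure Ω}

/-- Wilks expansion along a filter: if `∑ (c v i) ^ 2 → d > 0`, `max |c v i| → 0` and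
`c ∑ v i` is bounded, then the empirical likelihood statistic is eventually finite, and it is
asymptotically equivalent to `(c ∑ v i) ^ 2 / d`. -/
lemma elStat_expansion {ι : Type*} {l : Filter ι} {n : ι → ℕ} {v : ι → ℕ → ℝ} {c m : ι → ℝ}
    {d M : ℝ} (hc : ∀ᶠ q in l, 0 < c q) (hd : 0 < d)
    (hN : ∀ᶠ q in l, |c q * ∑ i ∈ Finset.range (n q), v q i| ≤ M)
    (hD : Tendsto (fun q => c q ^ 2 * ∑ i ∈ Finset.range (n q), v q i ^ 2) l (𝓝 d))
    (hm : Tendsto m l (𝓝 0)) (hmax : ∀ᶠ q in l, ∀ i < n q, c q * |v q i| ≤ m q) :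
    (∀ᶠ q in l, ((elStat (n q) (v q)).toReal : EReal) = elStat (n q) (v q)) ∧
    Tendsto (fun q => (elStat (n q) (v q)).toReal -
      (c q * ∑ i ∈ Finset.range (n q), v q i) ^ 2 / d) l (𝓝 0) := by
  set N : ι → ℝ := fun q => c q * ∑ i ∈ Finset.range (n q), v q i with hNdef
  set D : ι → ℝ := fun q => c q ^ 2 * ∑ i ∈ Finset.range (n q), v q i ^ 2 with hDdef
  set M' : ℝ := max 1 (M / √(d / 2)) with hM'
  have hM'1 : 1 ≤ M' := le_max_left _ _
  have hDhalf : ∀ᶠ q in l, d / 2 < D q := hD.eventually_const_lt (by linarith)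
  have hε : Tendsto (fun q => m q / √(D q)) l (𝓝 0) := by
    have := hm.div hD.sqrt (Real.sqrt_pos.2 hd).ne'
    rwa [zero_div] at this
  have hkey : ∀ᶠ q in l, ∃ r : ℝ, elStat (n q) (v q) = r ∧
      |r - N q ^ 2 / D q| ≤ 20 * M' ^ 3 * (m q / √(D q)) := by
    have hεM : ∀ᶠ q in l, m q / √(D q) * M' < 1 / 8 :=
      (hε.mul_const M').eventually_lt_const (by norm_num)
    filter_upwards [hc, hN, hmax, hDhalf, hεM] with q hcq hNq hmq hDq hεq
    have hDpos : 0 < D q := by linarith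
    have hs : 0 < √(D q) := Real.sqrt_pos.2 hDpos
    have hcs : c q / √(D q) ≠ 0 := (div_pos hcq hs).ne'
    rw [← elStat_const_mul (v q) hcs]
    have hsumeq (g : ℕ → ℝ) : ∑ i : Fin (n q), g i = ∑ i ∈ Finset.range (n q), g i :=
      Fin.sum_univ_eq_sum_range g (n q)
    have h := exists_elStat_eq_of_normalized (n := n q) (z := fun i => c q / √(D q) * v q i)
      (T := N q / √(D q)) (M := M') (ε := m q / √(D q)) ?_ ?_ ?_ hM'1 ?_ hεq.le
    · rwa [div_pow, Real.sq_sqrt hDpos.le] at h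
    · rw [hsumeq (fun i => c q / √(D q) * v q i), ← Finset.mul_sum, hNdef]
      ring
    · rw [hsumeq (fun i => (c q / √(D q) * v q i) ^ 2)]
      simp only [mul_pow, ← Finset.mul_sum, div_pow, Real.sq_sqrt hDpos.le]
      rw [div_mul_eq_mul_div]
      exact div_self hDpos.ne'
    · intro i hi
      rw [abs_mul, abs_of_pos (div_pos hcq hs), div_mul_eq_mul_div]
      exact div_le_div_of_nonneg_right (hmq i hi) hs.le
    · rw [abs_div, abs_of_pos hs]
      refine le_trans ?_ (le_max_right _ _)
      have hM0 : 0 ≤ M := (abs_nonneg _).trans hNq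
      exact div_le_div₀ hM0 hNq (Real.sqrt_pos.2 (by linarith)) (Real.sqrt_le_sqrt hDq.le)
  refine ⟨?_, ?_⟩
  · filter_upwards [hkey] with q ⟨r, hr, _⟩
    rw [hr, EReal.toReal_coe]
  · have h1 : Tendsto (fun q => 20 * M' ^ 3 * (m q / √(D q)) + M ^ 2 * |1 / D q - 1 / d|) l
        (𝓝 0) := by
      have h2 : Tendsto (fun q => |1 / D q - 1 / d|) l (𝓝 0) := by
        have := ((tendsto_const_nhds (x := (1 : ℝ))).div hD hd.ne').sub_const (1 / d)
        simpa using this.abs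
      simpa using (hε.const_mul (20 * M' ^ 3)).add (h2.const_mul (M ^ 2))
    refine squeeze_zero_norm' ?_ h1
    filter_upwards [hkey, hN] with q ⟨r, hr, hrq⟩ hNq
    rw [hr, EReal.toReal_coe, Real.norm_eq_abs]
    have : r - N q ^ 2 / d = (r - N q ^ 2 / D q) + N q ^ 2 * (1 / D q - 1 / d) := by ring
    rw [this]
    refine (abs_add_le _ _).trans (add_le_add hrq ?_)
    rw [abs_mul, abs_of_nonneg (sq_nonneg (N q)), ← sq_abs (N q)]
    exact mul_le_mul_of_nonneg_right (pow_le_pow_left₀ (abs_nonneg _) hNq 2) (abs_nonneg _)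

/-- The limit law of an empirical likelihood statistic with pseudo values `v n ω i`. -/
theorem elStat_tendstoInDistribution [IsProbabilityMeasure P]
    {Ω' : Type*} [MeasurableSpace Ω'] {P' : Measure Ω'} [IsProbabilityMeasure P']
    {v : ℕ → Ω → ℕ → ℝ} {c : ℕ → ℝ} {m : ℕ × Ω → ℝ} {Z : Ω' → ℝ} {d : ℝ}
    (hv : ∀ n i, Measurable fun ω => v n ω i) (hc : ∀ᶠ n in atTop, 0 < c n) (hd : 0 < d)
    (hN : TendstoInDistribution (fun n ω => c n * ∑ i ∈ Finset.range n, v n ω i) atTop Z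
      (fun _ => P) P')
    (hD : Tendsto (fun q : ℕ × Ω => c q.1 ^ 2 * ∑ i ∈ Finset.range q.1, v q.1 q.2 i ^ 2)
      (probFilter P) (𝓝 d))
    (hm : Tendsto m (probFilter P) (𝓝 0))
    (hmax : ∀ᶠ q in probFilter P, ∀ i < q.1, c q.1 * |v q.1 q.2 i| ≤ m q) :
    TendstoInDistribution (fun n ω => elStat n (v n ω)) atTop
      (fun ω => ((Z ω ^ 2 / d : ℝ) : EReal)) (fun _ => P) P' := by
  have hmeas (n : ℕ) : Measurable fun ω => elStat n (v n ω) :=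
    (measurable_elStat n).comp (measurable_pi_iff.2 fun i => hv n i)
  have hexp (M : ℝ) := elStat_expansion (l := probFilter P ⊓ 𝓟 {q : ℕ × Ω |
    |c q.1 * ∑ i ∈ Finset.range q.1, v q.1 q.2 i| ≤ M}) (n := Prod.fst)
    (v := fun q => v q.1 q.2) (c := fun q => c q.1) (m := m) (M := M)
    ((tendsto_fst_probFilter.eventually hc).filter_mono inf_le_left) hd
    (mem_inf_of_right (mem_principal_self _)) (hD.mono_left inf_le_left) (hm.mono_left inf_le_left)
    (hmax.filter_mono inf_le_left)
  have h1 : ∀ᶠ q in probFilter P, ((elStat q.1 (v q.1 q.2)).toReal : EReal) =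
      elStat q.1 (v q.1 q.2) := eventually_probFilter_of_tight hN fun M => (hexp M).1
  have h2 : Tendsto (fun q : ℕ × Ω => (elStat q.1 (v q.1 q.2)).toReal -
      (c q.1 * ∑ i ∈ Finset.range q.1, v q.1 q.2 i) ^ 2 / d) (probFilter P) (𝓝 0) := by
    rw [Metric.tendsto_nhds]
    exact fun ε hε => eventually_probFilter_of_tight hN fun M =>
      (Metric.tendsto_nhds.1 (hexp M).2) ε hε
  have h3 := hN.continuous_comp (g := fun y : ℝ => y ^ 2 / d) (by fun_prop)
  have h4 := tendstoInDistribution_of_tendstoInMeasure_sub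
    (fun n ω => (elStat n (v n ω)).toReal) _ h3
    (tendstoInMeasure_of_probFilter h2) fun n => (hmeas n).ereal_toReal.aemeasurable
  have h5 := h4.continuous_comp (g := fun y : ℝ => (y : EReal)) continuous_coe_real_ereal
  exact tendstoInDistribution_of_eventually_eq h5 (fun n => (hmeas n).aemeasurable) h1

end Wilks

/-! ### Algebra of the jackknife -/

section JackknifeAlgebra

/-- The pair `p` has `i` as an end point. -/
def Incident (i : ℕ) (p : ℕ × ℕ) : Prop := p.1 = i ∨ p.2 = i

instance (i : ℕ) (p : ℕ × ℕ) : Decidable (Incident i p) := inferInstanceAs (Decidable (_ ∨ _))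

/-- Sum of `y` over all pairs of vertices below `n`. -/
def tot (y : ℕ × ℕ → ℝ) (n : ℕ) : ℝ := ∑ p ∈ pairs (Finset.range n), y p

/-- Sum of `y` over the pairs of vertices below `n` which contain `i`. -/
def row (y : ℕ × ℕ → ℝ) (n i : ℕ) : ℝ :=
  ∑ p ∈ pairs (Finset.range n), if Incident i p then y p else 0

/-- Average of `y` over the pairs from `A`. -/
def pairAvg (y : ℕ × ℕ → ℝ) (A : Finset ℕ) : ℝ := (∑ p ∈ pairs A, y p) / (A.card.choose 2 : ℝ)

lemma mem_pairs_range {n : ℕ} {p : ℕ × ℕ} :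
    p ∈ pairs (Finset.range n) ↔ p.1 < n ∧ p.2 < n ∧ p.1 < p.2 := by
  simp [pairs, and_assoc]

lemma row_eq_sum (y : ℕ × ℕ → ℝ) {n i : ℕ} (hi : i < n) :
    row y n i = ∑ j ∈ Finset.range n,
      ((if i < j then y (i, j) else 0) + if j < i then y (j, i) else 0) := by
  have h : ∀ a b : ℕ, (if a < b then if Incident i (a, b) then y (a, b) else 0 else 0) =
      (if a = i then if i < b then y (i, b) else 0 else 0) +
      (if b = i then if a < i then y (a, i) else 0 else 0) := by
    intro a b
    simp only [Incident]
    by_cases ha : a = i <;> by_cases hb : b = i <;> by_cases hab : a < b <;> subst_vars <;>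
      simp_all
  rw [row, pairs, Finset.sum_filter, Finset.sum_product]
  simp only [h, Finset.sum_add_distrib]
  congr 1
  · rw [Finset.sum_comm]
    refine Finset.sum_congr rfl fun b _ => ?_
    rw [Finset.sum_ite_eq' (Finset.range n) i, if_pos (Finset.mem_range.2 hi)]
  · refine Finset.sum_congr rfl fun a _ => ?_
    rw [Finset.sum_ite_eq' (Finset.range n) i, if_pos (Finset.mem_range.2 hi)]

lemma sum_incident {n : ℕ} {p : ℕ × ℕ} (hp : p ∈ pairs (Finset.range n)) (s : ℕ → ℝ) :
    ∑ i ∈ Finset.range n, (if Incident i p then s i else 0) = s p.1 + s p.2 := by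
  obtain ⟨h1, h2, h3⟩ := mem_pairs_range.1 hp
  have h : ∀ i, (if Incident i p then s i else 0) =
      (if p.1 = i then s i else 0) + if p.2 = i then s i else 0 := by
    intro i
    simp only [Incident]
    by_cases ha : p.1 = i <;> by_cases hb : p.2 = i <;> simp_all
  simp only [h, Finset.sum_add_distrib, Finset.sum_ite_eq, Finset.mem_range, h1, h2, if_true]

lemma sum_row (y : ℕ × ℕ → ℝ) (n : ℕ) :
    ∑ i ∈ Finset.range n, row y n i = 2 * tot y n := by
  simp only [row]
  rw [Finset.sum_comm, tot, Finset.mul_sum]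
  refine Finset.sum_congr rfl fun p hp => ?_
  rw [sum_incident hp fun _ => y p]
  ring

lemma sum_pairs_erase (y : ℕ × ℕ → ℝ) (n i : ℕ) :
    ∑ p ∈ pairs ((Finset.range n).erase i), y p = tot y n - row y n i := by
  have : pairs ((Finset.range n).erase i) =
      (pairs (Finset.range n)).filter fun p => ¬ Incident i p := by
    ext p
    simp only [pairs, Finset.mem_filter, Finset.mem_product, Finset.mem_erase]
    simp only [Incident]
    tauto
  rw [this, Finset.sum_filter, tot, row, ← Finset.sum_sub_distrib]
  refine Finset.sum_congr rfl fun p _ => ?_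
  split_ifs <;> simp_all

lemma sum_pairs_erase_erase (y : ℕ × ℕ → ℝ) {n : ℕ} {p : ℕ × ℕ}
    (hp : p ∈ pairs (Finset.range n)) :
    ∑ q ∈ pairs (((Finset.range n).erase p.1).erase p.2), y q =
      tot y n - row y n p.1 - row y n p.2 + y p := by
  have h : pairs (((Finset.range n).erase p.1).erase p.2) =
      (pairs (Finset.range n)).filter fun q => ¬ (Incident p.1 q ∨ Incident p.2 q) := by
    ext q
    simp only [pairs, Finset.mem_filter, Finset.mem_product, Finset.mem_erase]
    simp only [Incident]
    tauto
  have hy : y p = ∑ q ∈ pairs (Finset.range n), if q = p then y q else 0 := by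
    rw [Finset.sum_ite_eq', if_pos hp]
  rw [h, Finset.sum_filter, hy, tot, row, row, ← Finset.sum_sub_distrib, ← Finset.sum_sub_distrib,
    ← Finset.sum_add_distrib]
  refine Finset.sum_congr rfl fun q hq => ?_
  have h3 := (mem_pairs_range.1 hq).2.2
  have h4 := (mem_pairs_range.1 hp).2.2
  have h5 : q = p ↔ Incident p.1 q ∧ Incident p.2 q := by
    obtain ⟨a, b⟩ := q
    obtain ⟨a', b'⟩ := p
    simp only [Incident, Prod.mk.injEq] at *
    omega
  by_cases h1 : Incident p.1 q <;> by_cases h2 : Incident p.2 q <;> simp [h1, h2, h5]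

lemma cast_choose_two_sub {n k : ℕ} (hk : k + 2 ≤ n) :
    (((n - k).choose 2 : ℕ) : ℝ) = ((n : ℝ) - k) * ((n : ℝ) - k - 1) / 2 := by
  rw [Nat.cast_choose_two, Nat.cast_sub (by omega)]

lemma est_pairAvg (y : ℕ × ℕ → ℝ) {n : ℕ} (hn : 4 ≤ n) :
    est (pairAvg y) n = 2 * tot y n / (n * (n - 1)) := by
  have h := cast_choose_two_sub (n := n) (k := 0) (by omega)
  simp only [Nat.sub_zero, Nat.cast_zero, sub_zero] at h
  rw [est, pairAvg, Finset.card_range, h, tot]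
  field_simp

lemma pairAvg_erase (y : ℕ × ℕ → ℝ) {n i : ℕ} (hn : 4 ≤ n) (hi : i < n) :
    pairAvg y ((Finset.range n).erase i) = 2 * (tot y n - row y n i) / ((n - 1) * (n - 2)) := by
  have h := cast_choose_two_sub (n := n) (k := 1) (by omega)
  rw [pairAvg, Finset.card_erase_of_mem (Finset.mem_range.2 hi), Finset.card_range, h,
    sum_pairs_erase]
  have : ((n : ℝ) - (1 : ℕ)) * ((n : ℝ) - (1 : ℕ) - 1) = (n - 1) * (n - 2) := by
    push_cast; ring
  rw [this]
  field_simp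

lemma pairAvg_erase_erase (y : ℕ × ℕ → ℝ) {n : ℕ} {p : ℕ × ℕ} (hn : 4 ≤ n)
    (hp : p ∈ pairs (Finset.range n)) :
    pairAvg y (((Finset.range n).erase p.1).erase p.2) =
      2 * (tot y n - row y n p.1 - row y n p.2 + y p) / ((n - 2) * (n - 3)) := by
  have h := cast_choose_two_sub (n := n) (k := 2) (by omega)
  obtain ⟨h1, h2, h3⟩ := mem_pairs_range.1 hp
  have hm : p.2 ∈ (Finset.range n).erase p.1 :=
    Finset.mem_erase.2 ⟨h3.ne', Finset.mem_range.2 h2⟩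
  rw [pairAvg, Finset.card_erase_of_mem hm, Finset.card_erase_of_mem (Finset.mem_range.2 h1),
    Finset.card_range, show n - 1 - 1 = n - 2 by omega, h, sum_pairs_erase_erase y hp]
  have : ((n : ℝ) - (2 : ℕ)) * ((n : ℝ) - (2 : ℕ) - 1) = (n - 2) * (n - 3) := by
    push_cast; ring
  rw [this]
  field_simp

lemma V_pairAvg (y : ℕ × ℕ → ℝ) {n i : ℕ} (hn : 4 ≤ n) (hi : i < n) (t : ℝ) :
    V (pairAvg y) n t i =
      2 / (n - 2) * row y n i - 2 / ((n - 1) * (n - 2)) * tot y n - t := by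
  have hn' : (4 : ℝ) ≤ n := by exact_mod_cast hn
  have e := est_pairAvg y hn
  rw [est] at e
  rw [V, S, S1, e, pairAvg_erase y hn hi]
  have h1 : (n : ℝ) - 1 ≠ 0 := by linarith
  have h2 : (n : ℝ) - 2 ≠ 0 := by linarith
  field_simp
  ring

lemma Q_pairAvg (y : ℕ × ℕ → ℝ) {n : ℕ} {p : ℕ × ℕ} (hn : 4 ≤ n)
    (hp : p ∈ pairs (Finset.range n)) (t : ℝ) :
    Q (pairAvg y) n t p.1 p.2 = 2 / (n - 1) * (y p - (row y n p.1 + row y n p.2) / (n - 2) +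
      2 / ((n - 1) * (n - 2)) * tot y n) := by
  have hn' : (4 : ℝ) ≤ n := by exact_mod_cast hn
  have e := est_pairAvg y hn
  rw [est] at e
  obtain ⟨hi, hj, -⟩ := mem_pairs_range.1 hp
  rw [Q, S, S1, S1, S2, e, pairAvg_erase y hn hi, pairAvg_erase y hn hj,
    pairAvg_erase_erase y hn hp]
  have h1 : (n : ℝ) - 1 ≠ 0 := by linarith
  have h2 : (n : ℝ) - 2 ≠ 0 := by linarith
  have h3 : (n : ℝ) - 3 ≠ 0 := by linarith
  field_simp
  ring

/-- The average of the pseudo values is the estimation error. -/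
lemma sum_V_pairAvg (y : ℕ × ℕ → ℝ) {n : ℕ} (hn : 4 ≤ n) (t : ℝ) :
    ∑ i ∈ Finset.range n, V (pairAvg y) n t i = n * (est (pairAvg y) n - t) := by
  have hn' : (4 : ℝ) ≤ n := by exact_mod_cast hn
  rw [Finset.sum_congr rfl fun i hi => V_pairAvg y hn (Finset.mem_range.1 hi) t,
    Finset.sum_sub_distrib, Finset.sum_sub_distrib, ← Finset.mul_sum, sum_row, est_pairAvg y hn]
  simp only [Finset.sum_const, Finset.card_range, nsmul_eq_mul]
  have h1 : (n : ℝ) - 1 ≠ 0 := by linarith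
  have h2 : (n : ℝ) - 2 ≠ 0 := by linarith
  field_simp
  ring

lemma row_congr {y y' : ℕ × ℕ → ℝ} {n : ℕ} (h : ∀ p ∈ pairs (Finset.range n), y p = y' p) (i : ℕ) :
    row y n i = row y' n i :=
  Finset.sum_congr rfl fun p hp => by rw [h p hp]

lemma tot_congr {y y' : ℕ × ℕ → ℝ} {n : ℕ} (h : ∀ p ∈ pairs (Finset.range n), y p = y' p) :
    tot y n = tot y' n := Finset.sum_congr rfl h

lemma row_add (y y' : ℕ × ℕ → ℝ) (n i : ℕ) :
    row (fun p => y p + y' p) n i = row y n i + row y' n i := by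
  rw [row, row, row, ← Finset.sum_add_distrib]
  exact Finset.sum_congr rfl fun p _ => by split_ifs <;> simp

lemma tot_add (y y' : ℕ × ℕ → ℝ) (n : ℕ) :
    tot (fun p => y p + y' p) n = tot y n + tot y' n := Finset.sum_add_distrib

lemma row_additive (s : ℕ → ℝ) {n i : ℕ} (hi : i < n) :
    row (fun p => s p.1 + s p.2) n i = (n - 2) * s i + ∑ j ∈ Finset.range n, s j := by
  rw [row_eq_sum _ hi]
  have h : ∀ j, ((if i < j then s i + s j else 0) + if j < i then s j + s i else 0) =
      s i + s j - if j = i then 2 * s i else 0 := by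
    intro j
    rcases lt_trichotomy i j with h | rfl | h
    · simp [h, h.not_gt, h.ne']
    · simp; ring
    · simp [h, h.not_gt, h.ne]; ring
  simp only [h, Finset.sum_add_distrib, Finset.sum_sub_distrib, Finset.sum_ite_eq',
    Finset.mem_range, hi, if_true, Finset.sum_const, Finset.card_range, nsmul_eq_mul]
  ring

lemma tot_additive (s : ℕ → ℝ) (n : ℕ) :
    tot (fun p => s p.1 + s p.2) n = (n - 1) * ∑ j ∈ Finset.range n, s j := by
  have h := sum_row (fun p => s p.1 + s p.2) n
  rw [Finset.sum_congr rfl fun i hi => row_additive s (Finset.mem_range.1 hi),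
    Finset.sum_add_distrib, ← Finset.mul_sum] at h
  simp only [Finset.sum_const, Finset.card_range, nsmul_eq_mul] at h
  linarith

/-- The pseudo values for data `θ₀ + s i + s j + d (i, j)`: the additive part enters through
`θ₀ + 2 s i` only. -/
lemma V_pairAvg_of_additive {y d : ℕ × ℕ → ℝ} {s : ℕ → ℝ} {θ₀ t : ℝ} {n i : ℕ} (hn : 4 ≤ n)
    (hi : i < n) (hy : ∀ p ∈ pairs (Finset.range n), y p = θ₀ + (s p.1 + s p.2) + d p) :
    V (pairAvg y) n t i = (θ₀ - t) + 2 * s i +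
      (2 / (n - 2) * row d n i - 2 / ((n - 1) * (n - 2)) * tot d n) := by
  have hn' : (4 : ℝ) ≤ n := by exact_mod_cast hn
  have hy' : ∀ p ∈ pairs (Finset.range n),
      y p = ((θ₀ / 2 + s p.1) + (θ₀ / 2 + s p.2)) + d p := fun p hp => by rw [hy p hp]; ring
  rw [V_pairAvg y hn hi, row_congr hy', tot_congr hy',
    row_add (fun p => (θ₀ / 2 + s p.1) + (θ₀ / 2 + s p.2)),
    tot_add (fun p => (θ₀ / 2 + s p.1) + (θ₀ / 2 + s p.2)), row_additive (fun i => θ₀ / 2 + s i) hi,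
    tot_additive (fun i => θ₀ / 2 + s i)]
  simp only [Finset.sum_add_distrib, Finset.sum_const, Finset.card_range, nsmul_eq_mul]
  have h1 : (n : ℝ) - 1 ≠ 0 := by linarith
  have h2 : (n : ℝ) - 2 ≠ 0 := by linarith
  field_simp
  ring

/-- The correction terms annihilate additive data. -/
lemma Q_pairAvg_of_additive {y d : ℕ × ℕ → ℝ} {s : ℕ → ℝ} {θ₀ t : ℝ} {n : ℕ} (hn : 4 ≤ n)
    (hy : ∀ p ∈ pairs (Finset.range n), y p = θ₀ + (s p.1 + s p.2) + d p) {p : ℕ × ℕ}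
    (hp : p ∈ pairs (Finset.range n)) :
    Q (pairAvg y) n t p.1 p.2 = 2 / (n - 1) * (d p - (row d n p.1 + row d n p.2) / (n - 2) +
      2 / ((n - 1) * (n - 2)) * tot d n) := by
  have hn' : (4 : ℝ) ≤ n := by exact_mod_cast hn
  have hy' : ∀ p ∈ pairs (Finset.range n),
      y p = ((θ₀ / 2 + s p.1) + (θ₀ / 2 + s p.2)) + d p := fun p hp => by rw [hy p hp]; ring
  obtain ⟨hi, hj, -⟩ := mem_pairs_range.1 hp
  rw [Q_pairAvg y hn hp, row_congr hy', row_congr hy', tot_congr hy', hy' p hp,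
    row_add (fun p => (θ₀ / 2 + s p.1) + (θ₀ / 2 + s p.2)),
    row_add (fun p => (θ₀ / 2 + s p.1) + (θ₀ / 2 + s p.2)),
    tot_add (fun p => (θ₀ / 2 + s p.1) + (θ₀ / 2 + s p.2)), row_additive (fun i => θ₀ / 2 + s i) hi,
    row_additive (fun i => θ₀ / 2 + s i) hj, tot_additive (fun i => θ₀ / 2 + s i)]
  simp only [Finset.sum_add_distrib, Finset.sum_const, Finset.card_range, nsmul_eq_mul]
  have h1 : (n : ℝ) - 1 ≠ 0 := by linarith
  have h2 : (n : ℝ) - 2 ≠ 0 := by linarith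
  field_simp
  ring

lemma est_pairAvg_of_additive {y d : ℕ × ℕ → ℝ} {s : ℕ → ℝ} {θ₀ : ℝ} {n : ℕ} (hn : 4 ≤ n)
    (hy : ∀ p ∈ pairs (Finset.range n), y p = θ₀ + (s p.1 + s p.2) + d p) :
    est (pairAvg y) n = θ₀ + 2 / n * ∑ j ∈ Finset.range n, s j +
      2 / (n * (n - 1)) * tot d n := by
  have hn' : (4 : ℝ) ≤ n := by exact_mod_cast hn
  have hy' : ∀ p ∈ pairs (Finset.range n),
      y p = ((θ₀ / 2 + s p.1) + (θ₀ / 2 + s p.2)) + d p := fun p hp => by rw [hy p hp]; ring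
  rw [est_pairAvg y hn, tot_congr hy',
    tot_add (fun p => (θ₀ / 2 + s p.1) + (θ₀ / 2 + s p.2)), tot_additive (fun i => θ₀ / 2 + s i)]
  simp only [Finset.sum_add_distrib, Finset.sum_const, Finset.card_range, nsmul_eq_mul]
  have h1 : (n : ℝ) - 1 ≠ 0 := by linarith
  field_simp

lemma V_eq_V_add (T : Finset ℕ → ℝ) (n i : ℕ) (s t : ℝ) : V T n t i = V T n s i + (s - t) := by
  simp only [V, S, S1]; ring

/-- Number of common end points of `p` and `q` among the vertices below `n`. -/
def overlap (n : ℕ) (p q : ℕ × ℕ) : ℝ :=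
  ∑ i ∈ Finset.range n, (if Incident i p then 1 else 0) * (if Incident i q then 1 else 0)

lemma sum_row_sq (y : ℕ × ℕ → ℝ) (n : ℕ) :
    ∑ i ∈ Finset.range n, row y n i ^ 2 =
      ∑ p ∈ pairs (Finset.range n), ∑ q ∈ pairs (Finset.range n), overlap n p q * (y p * y q) := by
  have h (i : ℕ) : row y n i ^ 2 = ∑ p ∈ pairs (Finset.range n), ∑ q ∈ pairs (Finset.range n),
      (if Incident i p then 1 else 0) * (if Incident i q then 1 else 0) * (y p * y q) := by
    rw [sq, row, Finset.sum_mul_sum]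
    refine Finset.sum_congr rfl fun p _ => Finset.sum_congr rfl fun q _ => ?_
    split_ifs <;> simp
  simp only [h, overlap, Finset.sum_mul]
  rw [Finset.sum_comm]
  exact Finset.sum_congr rfl fun p _ => Finset.sum_comm

lemma overlap_nonneg (n : ℕ) (p q : ℕ × ℕ) : 0 ≤ overlap n p q :=
  Finset.sum_nonneg fun i _ => by split_ifs <;> simp

lemma overlap_self {n : ℕ} {p : ℕ × ℕ} (hp : p ∈ pairs (Finset.range n)) : overlap n p p = 2 := by
  have := sum_incident hp fun _ => (1 : ℝ)
  rw [overlap]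
  simp only [mul_ite, mul_one, mul_zero]
  rw [show (2 : ℝ) = 1 + 1 by norm_num, ← this]
  exact Finset.sum_congr rfl fun i _ => by split_ifs <;> simp

lemma overlap_le_two {n : ℕ} {p : ℕ × ℕ} (hp : p ∈ pairs (Finset.range n)) (q : ℕ × ℕ) :
    overlap n p q ≤ 2 := by
  rw [← overlap_self hp]
  exact Finset.sum_le_sum fun i _ => by split_ifs <;> simp

lemma overlap_comm (n : ℕ) (p q : ℕ × ℕ) : overlap n p q = overlap n q p :=
  Finset.sum_congr rfl fun _ _ => mul_comm _ _

lemma one_le_overlap {n i : ℕ} {p q : ℕ × ℕ} (hi : i < n) (hp : Incident i p)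
    (hq : Incident i q) : 1 ≤ overlap n p q := by
  have h := Finset.single_le_sum (f := fun i => (if Incident i p then (1 : ℝ) else 0) *
    (if Incident i q then 1 else 0)) (fun _ _ => by split_ifs <;> simp) (Finset.mem_range.2 hi)
  simpa [hp, hq, overlap] using h

lemma row_one {n i : ℕ} (hi : i < n) : row (fun _ => 1) n i = n - 1 := by
  have h := row_additive (fun _ => (1 / 2 : ℝ)) hi
  norm_num at h
  rw [h]
  ring

lemma card_pairs_range (n : ℕ) : ((pairs (Finset.range n)).card : ℝ) = n * (n - 1) / 2 := by
  have h := tot_additive (fun _ => (1 / 2 : ℝ)) n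
  norm_num [tot] at h
  rw [h]
  ring

lemma card_pairs_range_le (n : ℕ) : ((pairs (Finset.range n)).card : ℝ) ≤ n ^ 2 := by
  rw [card_pairs_range]
  nlinarith [(Nat.cast_nonneg n : (0 : ℝ) ≤ n)]

lemma sum_overlap_le (n : ℕ) :
    ∑ p ∈ pairs (Finset.range n), ∑ q ∈ pairs (Finset.range n), overlap n p q ≤ (n : ℝ) ^ 3 := by
  have h := sum_row_sq (fun _ => 1) n
  simp only [mul_one] at h
  rw [← h, Finset.sum_congr rfl fun i hi => by rw [row_one (Finset.mem_range.1 hi)]]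
  simp only [Finset.sum_const, Finset.card_range, nsmul_eq_mul]
  rcases Nat.eq_zero_or_pos n with rfl | hn
  · simp
  have : (1 : ℝ) ≤ n := by exact_mod_cast hn
  nlinarith

end JackknifeAlgebra

/-! ### Independent centered arrays -/

section CenteredArray

variable {Ω ι : Type*} [MeasurableSpace Ω]

/-- Independent, centered, uniformly bounded random variables with variances `v p`. -/
structure IsCenteredArray (P : Measure Ω) (e : ι → Ω → ℝ) (v : ι → ℝ) (B : ℝ) : Prop where
  measurable : ∀ p, Measurable (e p)
  indep : iIndepFun e P
  bound : ∀ p ω, |e p ω| ≤ B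
  mean : ∀ p, ∫ ω, e p ω ∂P = 0
  var : ∀ p, ∫ ω, e p ω ^ 2 ∂P = v p

variable {P : Measure Ω} {e : ι → Ω → ℝ} {v : ι → ℝ} {B : ℝ}

lemma integrable_of_abs_le {Ω : Type*} [MeasurableSpace Ω] {P : Measure Ω} [IsFiniteMeasure P]
    {f : Ω → ℝ} (hf : Measurable f) {C : ℝ} (hC : ∀ ω, |f ω| ≤ C) : Integrable f P :=
  Integrable.of_bound hf.aestronglyMeasurable C (ae_of_all _ hC)

namespace IsCenteredArray

lemma var_nonneg (he : IsCenteredArray P e v B) (p : ι) : 0 ≤ v p := by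
  rw [← he.var p]; exact integral_nonneg fun ω => sq_nonneg _

lemma integral_pow_mul (he : IsCenteredArray P e v B) {A : Finset ι} {r : ι} (hr : r ∉ A) (k : ℕ)
    {Φ : (A → ℝ) → ℝ} (hΦ : Measurable Φ) :
    ∫ ω, e r ω ^ k * Φ (fun p => e p ω) ∂P =
      (∫ ω, e r ω ^ k ∂P) * ∫ ω, Φ (fun p => e p ω) ∂P := by
  have h := he.indep.indepFun_finset {r} A (Finset.disjoint_singleton_left.2 hr) he.measurable
  have h2 := h.comp (φ := fun x => x ⟨r, Finset.mem_singleton_self r⟩ ^ k) (ψ := Φ)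
    (by fun_prop) hΦ
  have hm : Measurable fun ω => (fun p : A => e p ω) :=
    measurable_pi_iff.2 fun p => he.measurable p
  exact h2.integral_fun_mul_eq_mul_integral
    ((he.measurable r).pow_const k).aestronglyMeasurable (hΦ.comp hm).aestronglyMeasurable

lemma abs_sum_le (he : IsCenteredArray P e v B) (A : Finset ι) (b : ι → ℝ) (ω : Ω) :
    |∑ p ∈ A, b p * e p ω| ≤ ∑ p ∈ A, |b p| * B :=
  (Finset.abs_sum_le_sum_abs _ _).trans (Finset.sum_le_sum fun p _ => by
    rw [abs_mul]; exact mul_le_mul_of_nonneg_left (he.bound p ω) (abs_nonneg _))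

lemma measurable_sum (he : IsCenteredArray P e v B) (A : Finset ι) (b : ι → ℝ) :
    Measurable fun ω => ∑ p ∈ A, b p * e p ω :=
  Finset.measurable_fun_sum _ fun p _ => (he.measurable p).const_mul _

lemma integral_pow_mul_sum_pow (he : IsCenteredArray P e v B) {A : Finset ι} {r : ι} (hr : r ∉ A)
    (b : ι → ℝ) (j k : ℕ) :
    ∫ ω, e r ω ^ j * (∑ p ∈ A, b p * e p ω) ^ k ∂P =
      (∫ ω, e r ω ^ j ∂P) * ∫ ω, (∑ p ∈ A, b p * e p ω) ^ k ∂P := by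
  have h := he.integral_pow_mul hr j (Φ := fun x => (∑ p : A, b p * x p) ^ k) (by fun_prop)
  have h2 : ∀ ω, ∑ p : A, b p * e p ω = ∑ p ∈ A, b p * e p ω := fun ω =>
    Finset.sum_coe_sort A fun p => b p * e p ω
  simpa only [h2] using h

variable [IsProbabilityMeasure P]

lemma integrable_sum_pow (he : IsCenteredArray P e v B) (A : Finset ι) (b : ι → ℝ) (k : ℕ) :
    Integrable (fun ω => (∑ p ∈ A, b p * e p ω) ^ k) P :=
  integrable_of_abs_le ((he.measurable_sum A b).pow_const k) (C := (∑ p ∈ A, |b p| * B) ^ k)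
    fun ω => by rw [abs_pow]; exact pow_le_pow_left₀ (abs_nonneg _) (he.abs_sum_le A b ω) k

lemma integrable_pow (he : IsCenteredArray P e v B) (p : ι) (k : ℕ) :
    Integrable (fun ω => e p ω ^ k) P := by
  simpa using he.integrable_sum_pow {p} (fun _ => 1) k

lemma integrable_pow_mul_sum_pow (he : IsCenteredArray P e v B) (r : ι) (A : Finset ι) (b : ι → ℝ)
    (j k : ℕ) : Integrable (fun ω => e r ω ^ j * (∑ p ∈ A, b p * e p ω) ^ k) P :=
  (he.integrable_sum_pow A b k).bdd_mul
    ((he.measurable r).pow_const j).aestronglyMeasurable (c := B ^ j) (ae_of_all _ fun ω => by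
      rw [Real.norm_eq_abs, abs_pow]; exact pow_le_pow_left₀ (abs_nonneg _) (he.bound r ω) j)

lemma integral_sum (he : IsCenteredArray P e v B) (A : Finset ι) (b : ι → ℝ) :
    ∫ ω, ∑ p ∈ A, b p * e p ω ∂P = 0 := by
  rw [integral_finsetSum _ fun p _ => by simpa using (he.integrable_pow p 1).const_mul (b p)]
  simp [integral_const_mul, he.mean]

lemma integral_sum_sq (he : IsCenteredArray P e v B) (A : Finset ι) (b : ι → ℝ) :
    ∫ ω, (∑ p ∈ A, b p * e p ω) ^ 2 ∂P = ∑ p ∈ A, b p ^ 2 * v p := by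
  classical
  induction A using Finset.induction_on with
  | empty => simp
  | insert r A hr ih =>
    have hexp : ∀ ω, (∑ p ∈ insert r A, b p * e p ω) ^ 2 = b r ^ 2 * e r ω ^ 2 +
        2 * b r * (e r ω ^ 1 * (∑ p ∈ A, b p * e p ω) ^ 1) + (∑ p ∈ A, b p * e p ω) ^ 2 := by
      intro ω; rw [Finset.sum_insert hr]; ring
    have i1 := (he.integrable_pow r 2).const_mul (b r ^ 2)
    have i2 := (he.integrable_pow_mul_sum_pow r A b 1 1).const_mul (2 * b r)
    have i3 := he.integrable_sum_pow A b 2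
    simp only [hexp]
    rw [integral_add (i1.fun_add i2) i3, integral_add i1 i2, integral_const_mul, integral_const_mul,
      he.integral_pow_mul_sum_pow hr, ih, he.var, Finset.sum_insert hr]
    simp [he.mean]

/-- Fourth moment of a sum of independent centered variables. -/
lemma integral_sum_pow_four_le (he : IsCenteredArray P e v B) (A : Finset ι) :
    ∫ ω, (∑ p ∈ A, e p ω) ^ 4 ∂P ≤ 3 * (∑ p ∈ A, v p) ^ 2 + ∑ p ∈ A, ∫ ω, e p ω ^ 4 ∂P := by
  classical
  induction A using Finset.induction_on with
  | empty => simp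
  | insert r A hr ih =>
    have hone : ∀ A : Finset ι, ∀ ω, ∑ p ∈ A, e p ω = ∑ p ∈ A, (fun _ => (1 : ℝ)) p * e p ω := by
      simp
    have hexp : ∀ ω, (∑ p ∈ insert r A, e p ω) ^ 4 = (e r ω ^ 4 +
        4 * (e r ω ^ 3 * (∑ p ∈ A, (fun _ => (1 : ℝ)) p * e p ω) ^ 1)) +
        (6 * (e r ω ^ 2 * (∑ p ∈ A, (fun _ => (1 : ℝ)) p * e p ω) ^ 2) +
        (4 * (e r ω ^ 1 * (∑ p ∈ A, (fun _ => (1 : ℝ)) p * e p ω) ^ 3) +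
        (∑ p ∈ A, (fun _ => (1 : ℝ)) p * e p ω) ^ 4)) := by
      intro ω; rw [Finset.sum_insert hr, hone A]; ring
    have i1 := he.integrable_pow r 4
    have i2 := (he.integrable_pow_mul_sum_pow r A (fun _ => 1) 3 1).const_mul 4
    have i3 := (he.integrable_pow_mul_sum_pow r A (fun _ => 1) 2 2).const_mul 6
    have i4 := (he.integrable_pow_mul_sum_pow r A (fun _ => 1) 1 3).const_mul 4
    have i5 := he.integrable_sum_pow A (fun _ => 1) 4
    have h0 := he.integral_sum A (fun _ => 1)
    simp only [hexp]
    rw [integral_add (i1.fun_add i2) (i3.fun_add (i4.fun_add i5)), integral_add i1 i2,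
      integral_add i3 (i4.fun_add i5), integral_add i4 i5]
    simp only [integral_const_mul]
    rw [he.integral_pow_mul_sum_pow hr, he.integral_pow_mul_sum_pow hr,
      he.integral_pow_mul_sum_pow hr, he.integral_sum_sq, he.var]
    simp only [one_mul] at h0
    simp only [pow_one, he.mean, h0, one_pow, one_mul, mul_zero, zero_mul, add_zero, zero_add,
      Finset.sum_insert hr] at ih ⊢
    nlinarith [sq_nonneg (v r)]

/-- Second moment of an off-diagonal quadratic form. -/
lemma integral_quadratic_sq (he : IsCenteredArray P e v B) (A : Finset ι) {a : ι → ι → ℝ}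
    (ha : ∀ p q, a p q = a q p) (ha0 : ∀ p, a p p = 0) :
    ∫ ω, (∑ p ∈ A, ∑ q ∈ A, a p q * (e p ω * e q ω)) ^ 2 ∂P =
      2 * ∑ p ∈ A, ∑ q ∈ A, a p q ^ 2 * (v p * v q) := by
  classical
  induction A using Finset.induction_on with
  | empty => simp
  | insert r A hr ih =>
    set L : Ω → ℝ := fun ω => ∑ q ∈ A, a r q * e q ω with hL
    set Qf : Ω → ℝ := fun ω => ∑ p ∈ A, ∑ q ∈ A, a p q * (e p ω * e q ω) with hQ
    have hins : ∀ g : ι → ι → ℝ, (∀ p q, g p q = g q p) → g r r = 0 →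
        ∑ p ∈ insert r A, ∑ q ∈ insert r A, g p q =
          2 * ∑ q ∈ A, g r q + ∑ p ∈ A, ∑ q ∈ A, g p q := by
      intro g hg hg0
      simp only [Finset.sum_insert hr, Finset.sum_add_distrib, hg0, fun p => hg p r]
      ring
    have hexp : ∀ ω, (∑ p ∈ insert r A, ∑ q ∈ insert r A, a p q * (e p ω * e q ω)) ^ 2 =
        4 * (e r ω ^ 2 * L ω ^ 2) + (4 * (e r ω ^ 1 * (L ω * Qf ω)) + Qf ω ^ 2) := by
      intro ω
      rw [hins (fun p q => a p q * (e p ω * e q ω)) (fun p q => by rw [ha p q]; ring)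
        (by rw [ha0]; ring)]
      have : ∑ q ∈ A, a r q * (e r ω * e q ω) = e r ω * L ω := by
        rw [hL, Finset.mul_sum]; exact Finset.sum_congr rfl fun q _ => by ring
      rw [this]; ring
    have hB : ∀ p q ω, |a p q * (e p ω * e q ω)| ≤ |a p q| * (B * B) := fun p q ω => by
      rw [abs_mul, abs_mul]
      exact mul_le_mul_of_nonneg_left (mul_le_mul (he.bound p ω) (he.bound q ω) (abs_nonneg _)
        ((abs_nonneg _).trans (he.bound p ω))) (abs_nonneg _)
    have hQb : ∀ ω, |Qf ω| ≤ ∑ p ∈ A, ∑ q ∈ A, |a p q| * (B * B) := fun ω =>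
      (Finset.abs_sum_le_sum_abs _ _).trans (Finset.sum_le_sum fun p _ =>
        (Finset.abs_sum_le_sum_abs _ _).trans (Finset.sum_le_sum fun q _ => hB p q ω))
    have hQm : Measurable Qf := Finset.measurable_fun_sum _ fun p _ =>
      Finset.measurable_fun_sum _ fun q _ =>
        ((he.measurable p).mul (he.measurable q)).const_mul _
    have hLm : Measurable L := he.measurable_sum A (a r)
    have i1 := (he.integrable_pow_mul_sum_pow r A (a r) 2 2).const_mul 4
    have i3 : Integrable (fun ω => Qf ω ^ 2) P := integrable_of_abs_le (hQm.pow_const 2)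
      fun ω => by rw [abs_pow]; exact pow_le_pow_left₀ (abs_nonneg _) (hQb ω) 2
    have i2 : Integrable (fun ω => 4 * (e r ω ^ 1 * (L ω * Qf ω))) P := by
      refine (Integrable.bdd_mul (c := B) ?_
        (he.measurable r |>.pow_const 1).aestronglyMeasurable (ae_of_all _ fun ω => ?_)).const_mul 4
      · refine integrable_of_abs_le (hLm.mul hQm) (C := (∑ p ∈ A, |a r p| * B) *
          ∑ p ∈ A, ∑ q ∈ A, |a p q| * (B * B)) fun ω => ?_
        rw [abs_mul]
        exact mul_le_mul (he.abs_sum_le A (a r) ω) (hQb ω) (abs_nonneg _)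
          ((abs_nonneg _).trans (he.abs_sum_le A (a r) ω))
      · rw [Real.norm_eq_abs, pow_one]; exact he.bound r ω
    have hcross : ∫ ω, e r ω ^ 1 * (L ω * Qf ω) ∂P = 0 := by
      have h := he.integral_pow_mul hr 1 (Φ := fun x => (∑ p : A, a r p * x p) *
        ∑ p : A, ∑ q : A, a p q * (x p * x q)) (by fun_prop)
      have h2 : ∀ ω, (∑ p : A, a r p * e p ω) * ∑ p : A, ∑ q : A, a p q * (e p ω * e q ω) =
          L ω * Qf ω := fun ω => by
        rw [Finset.sum_coe_sort A fun p => a r p * e p ω,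
          Finset.sum_coe_sort A fun p => ∑ q : A, a p q * (e p ω * e q ω)]
        simp only [hL, hQ]
        congr 1
        exact Finset.sum_congr rfl fun p _ =>
          Finset.sum_coe_sort A fun q => a p q * (e p ω * e q ω)
      simp only [h2] at h
      rw [h]
      simp [he.mean]
    simp only [hexp]
    rw [integral_add i1 (i2.fun_add i3), integral_add i2 i3, integral_const_mul, integral_const_mul,
      hcross, ih, he.integral_pow_mul_sum_pow hr, he.var, he.integral_sum_sq,
      hins (fun p q => a p q ^ 2 * (v p * v q)) (fun p q => by rw [ha p q]; ring)
      (by rw [ha0]; ring)]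
    have : ∑ q ∈ A, a r q ^ 2 * (v r * v q) = v r * ∑ q ∈ A, a r q ^ 2 * v q := by
      rw [Finset.mul_sum]; exact Finset.sum_congr rfl fun q _ => by ring
    rw [this]; ring

lemma integral_pow_four_le (he : IsCenteredArray P e v B) (p : ι) :
    ∫ ω, e p ω ^ 4 ∂P ≤ B ^ 2 * v p := by
  rw [← he.var p, ← integral_const_mul]
  refine integral_mono (he.integrable_pow p 4) ((he.integrable_pow p 2).const_mul _) fun ω => ?_
  have h1 : e p ω ^ 2 ≤ B ^ 2 := by
    rw [← sq_abs]; exact pow_le_pow_left₀ (abs_nonneg _) (he.bound p ω) 2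
  calc e p ω ^ 4 = e p ω ^ 2 * e p ω ^ 2 := by ring
    _ ≤ B ^ 2 * e p ω ^ 2 := mul_le_mul_of_nonneg_right h1 (sq_nonneg _)

/-- Concentration of the sum of squares. -/
lemma integral_sum_sq_sub_sq_le (he : IsCenteredArray P e v B) (A : Finset ι) :
    ∫ ω, (∑ p ∈ A, (e p ω ^ 2 - v p)) ^ 2 ∂P ≤ ∑ p ∈ A, B ^ 2 * v p := by
  have hB : ∀ p ω, e p ω ^ 2 ≤ B ^ 2 := fun p ω => by
    rw [← sq_abs]; exact pow_le_pow_left₀ (abs_nonneg _) (he.bound p ω) 2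
  have hvB : ∀ p, v p ≤ B ^ 2 := fun p => by
    rw [← he.var p]
    refine (integral_mono (he.integrable_pow p 2) (integrable_const (B ^ 2)) (hB p)).trans ?_
    simp
  have he' : IsCenteredArray P (fun p ω => e p ω ^ 2 - v p)
      (fun p => ∫ ω, (e p ω ^ 2 - v p) ^ 2 ∂P) (B ^ 2) :=
    { measurable := fun p => ((he.measurable p).pow_const 2).sub_const _
      indep := he.indep.comp (fun p x => x ^ 2 - v p) fun p => by fun_prop
      bound := fun p ω => abs_le.2 ⟨by nlinarith [sq_nonneg (e p ω), hvB p],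
        by linarith [hB p ω, he.var_nonneg p]⟩
      mean := fun p => by
        rw [integral_sub (he.integrable_pow p 2) (integrable_const _), he.var]; simp
      var := fun p => rfl }
  have h := he'.integral_sum_sq A fun _ => 1
  simp only [one_mul, one_pow] at h
  rw [h]
  refine Finset.sum_le_sum fun p _ => le_trans ?_ (he.integral_pow_four_le p)
  have hexp : ∀ ω, (e p ω ^ 2 - v p) ^ 2 = e p ω ^ 4 - 2 * v p * e p ω ^ 2 + v p ^ 2 :=
    fun ω => by ring
  simp only [hexp]
  have i1 := (he.integrable_pow p 2).const_mul (2 * v p)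
  have i2 : Integrable (fun ω => e p ω ^ 4 - 2 * v p * e p ω ^ 2) P :=
    (he.integrable_pow p 4).sub i1
  rw [integral_add i2 (integrable_const _), integral_sub (he.integrable_pow p 4) i1,
    integral_const_mul, he.var]
  simp only [integral_const, probReal_univ, one_smul]
  nlinarith [sq_nonneg (v p)]

end IsCenteredArray

lemma norm_prod_sub_prod_le {A : Finset ι} {z w : ι → ℂ} (hz : ∀ p, ‖z p‖ ≤ 1)
    (hw : ∀ p, ‖w p‖ ≤ 1) : ‖∏ p ∈ A, z p - ∏ p ∈ A, w p‖ ≤ ∑ p ∈ A, ‖z p - w p‖ := by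
  classical
  induction A using Finset.induction_on with
  | empty => simp
  | insert r A hr ih =>
    rw [Finset.prod_insert hr, Finset.prod_insert hr, Finset.sum_insert hr]
    have : z r * ∏ p ∈ A, z p - w r * ∏ p ∈ A, w p =
        (z r - w r) * ∏ p ∈ A, z p + w r * (∏ p ∈ A, z p - ∏ p ∈ A, w p) := by ring
    rw [this]
    refine (norm_add_le _ _).trans ?_
    rw [norm_mul, norm_mul]
    refine add_le_add ?_ ?_
    · refine mul_le_of_le_one_right (norm_nonneg _) ?_
      rw [norm_prod]
      exact Finset.prod_le_one (fun _ _ => norm_nonneg _) fun p _ => hz p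
    · exact (mul_le_of_le_one_left (norm_nonneg _) (hw r)).trans ih

namespace IsCenteredArray

variable [IsProbabilityMeasure P]

lemma norm_charFun_sub_le (he : IsCenteredArray P e v B) (p : ι) {t : ℝ} (ht : |t| * B ≤ 1) :
    ‖charFun (P.map (e p)) t - (Real.exp (-(t ^ 2 * v p / 2)) : ℂ)‖ ≤
      |t| ^ 3 * B * v p + t ^ 4 * v p ^ 2 := by
  have hB0 : 0 ≤ B := by
    obtain ⟨ω⟩ := nonempty_of_isProbabilityMeasure P
    exact (abs_nonneg _).trans (he.bound p ω)
  have hB : ∀ ω, e p ω ^ 2 ≤ B ^ 2 := fun ω => by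
    rw [← sq_abs]; exact pow_le_pow_left₀ (abs_nonneg _) (he.bound p ω) 2
  have hvB : v p ≤ B ^ 2 := by
    rw [← he.var p]
    refine (integral_mono (he.integrable_pow p 2) (integrable_const (B ^ 2)) hB).trans ?_
    simp
  have hv0 := he.var_nonneg p
  have ht2 : t ^ 2 * v p ≤ 1 := by
    have : (|t| * B) ^ 2 ≤ 1 := pow_le_one₀ (by positivity) ht
    rw [mul_pow, sq_abs] at this
    nlinarith [mul_le_mul_of_nonneg_left hvB (sq_nonneg t)]
  have h1 : ‖charFun (P.map (e p)) t - ((1 - t ^ 2 * v p / 2 : ℝ) : ℂ)‖ ≤ |t| ^ 3 * B * v p := by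
    rw [charFun_apply_real, integral_map (he.measurable p).aemeasurable
      (by fun_prop)]
    have hi1 : Integrable (fun ω => Complex.exp (t * (e p ω : ℂ) * Complex.I)) P := by
      refine Integrable.of_bound (C := 1) ?_ (ae_of_all _ fun ω => ?_)
      · have := he.measurable p
        exact (by fun_prop : Measurable _).aestronglyMeasurable
      · rw [← Complex.ofReal_mul, Complex.norm_exp_ofReal_mul_I]
    have hpoly : ((1 - t ^ 2 * v p / 2 : ℝ) : ℂ) =
        ∫ ω, (1 + t * (e p ω : ℂ) * Complex.I - (t ^ 2 / 2 : ℝ) * ((e p ω ^ 2 : ℝ) : ℂ)) ∂P := by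
      have j1 : Integrable (fun ω => t * (e p ω : ℂ) * Complex.I) P := by
        have := (he.integrable_pow p 1).ofReal (𝕜 := ℂ)
        simp only [pow_one] at this
        exact (this.const_mul (t : ℂ)).mul_const _
      have j2 : Integrable (fun ω => ((t ^ 2 / 2 : ℝ) : ℂ) * ((e p ω ^ 2 : ℝ) : ℂ)) P :=
        ((he.integrable_pow p 2).ofReal (𝕜 := ℂ)).const_mul _
      rw [integral_sub ((integrable_const _).fun_add j1) j2, integral_add (integrable_const _) j1,
        integral_mul_const, integral_const_mul, integral_const_mul, integral_complex_ofReal,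
        integral_complex_ofReal, he.mean, he.var]
      simp
      ring
    have j3 : Integrable (fun ω => (1 + t * (e p ω : ℂ) * Complex.I -
        (t ^ 2 / 2 : ℝ) * ((e p ω ^ 2 : ℝ) : ℂ))) P := by
      have := (he.integrable_pow p 1).ofReal (𝕜 := ℂ)
      simp only [pow_one] at this
      exact ((integrable_const _).add ((this.const_mul (t : ℂ)).mul_const _)).sub
        (((he.integrable_pow p 2).ofReal (𝕜 := ℂ)).const_mul _)
    rw [hpoly, ← integral_sub hi1 j3, ← he.var p, ← integral_const_mul]
    refine (norm_integral_le_integral_norm _).trans (integral_mono (hi1.sub j3).norm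
      ((he.integrable_pow p 2).const_mul _) fun ω => ?_)
    have hx : ‖(t : ℂ) * (e p ω : ℂ) * Complex.I‖ = |t| * |e p ω| := by simp
    have hx1 : ‖(t : ℂ) * (e p ω : ℂ) * Complex.I‖ ≤ 1 := by
      rw [hx]; exact (mul_le_mul_of_nonneg_left (he.bound p ω) (abs_nonneg _)).trans ht
    have hb := Complex.exp_bound hx1 (n := 3) (by norm_num)
    rw [hx] at hb
    have hs : ∑ m ∈ Finset.range 3, ((t : ℂ) * (e p ω : ℂ) * Complex.I) ^ m / (m.factorial : ℂ) =
        1 + t * (e p ω : ℂ) * Complex.I - (t ^ 2 / 2 : ℝ) * ((e p ω ^ 2 : ℝ) : ℂ) := by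
      simp only [Finset.sum_range_succ, Finset.sum_range_zero]
      have hI : Complex.I ^ 2 = -1 := Complex.I_sq
      simp only [mul_pow, hI]
      push_cast
      norm_num [Nat.factorial]
      ring
    rw [hs] at hb
    refine hb.trans ?_
    have h3 : (|t| * |e p ω|) ^ 3 ≤ |t| ^ 3 * B * e p ω ^ 2 := by
      rw [mul_pow, pow_succ |e p ω| 2, sq_abs]
      nlinarith [mul_le_mul_of_nonneg_left (he.bound p ω)
        (mul_nonneg (pow_nonneg (abs_nonneg t) 3) (sq_nonneg (e p ω)))]
    have h4 : ((Nat.succ 3 : ℕ) : ℝ) * (((Nat.factorial 3 : ℕ) : ℝ) * (3 : ℕ))⁻¹ ≤ 1 := by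
      norm_num [Nat.factorial]
    exact (mul_le_of_le_one_right (by positivity) h4).trans h3
  have h2 : ‖((1 - t ^ 2 * v p / 2 : ℝ) : ℂ) - (Real.exp (-(t ^ 2 * v p / 2)) : ℂ)‖ ≤
      t ^ 4 * v p ^ 2 := by
    rw [← Complex.ofReal_sub, Complex.norm_real, Real.norm_eq_abs, abs_sub_comm]
    have hy0 : 0 ≤ t ^ 2 * v p / 2 := by positivity
    have := Real.abs_exp_sub_one_sub_id_le (x := -(t ^ 2 * v p / 2))
      (by rw [abs_neg, abs_of_nonneg hy0]; linarith)
    have he : Real.exp (-(t ^ 2 * v p / 2)) - (1 - t ^ 2 * v p / 2) =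
      Real.exp (-(t ^ 2 * v p / 2)) - 1 - -(t ^ 2 * v p / 2) := by ring
    rw [he]
    refine this.trans ?_
    nlinarith [mul_nonneg (pow_nonneg (sq_nonneg t) 2) (sq_nonneg (v p))]
  calc _ = ‖(charFun (P.map (e p)) t - ((1 - t ^ 2 * v p / 2 : ℝ) : ℂ)) +
        (((1 - t ^ 2 * v p / 2 : ℝ) : ℂ) - (Real.exp (-(t ^ 2 * v p / 2)) : ℂ))‖ := by
        congr 1; ring
    _ ≤ _ := (norm_add_le _ _).trans (add_le_add h1 h2)

/-- Quantitative Lyapunov central limit theorem at the level of characteristic functions. -/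
lemma norm_integral_cexp_sub_le (he : IsCenteredArray P e v B) (A : Finset ι) {t w : ℝ}
    (ht : |t| * B ≤ 1) (hw : ∀ p ∈ A, v p ≤ w) :
    ‖∫ ω, Complex.exp (t * ((∑ p ∈ A, e p ω : ℝ) : ℂ) * Complex.I) ∂P -
      (Real.exp (-(t ^ 2 * (∑ p ∈ A, v p) / 2)) : ℂ)‖ ≤
      A.card * (|t| ^ 3 * B * w + t ^ 4 * w ^ 2) := by
  have hcf : ∫ ω, Complex.exp (t * ((∑ p ∈ A, e p ω : ℝ) : ℂ) * Complex.I) ∂P =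
      ∏ p ∈ A, charFun (P.map (e p)) t := by
    have h := iIndepFun.charFun_map_fun_finsetSum_eq_prod (s := A) (P := P) (X := e)
      (fun p _ => (he.measurable p).aemeasurable)
      (he.indep.precomp (g := fun p : A => (p : ι)) Subtype.val_injective)
    have h2 := congrFun h t
    rw [charFun_apply_real, integral_map
      (Finset.measurable_fun_sum _ fun p _ => he.measurable p).aemeasurable (by fun_prop)] at h2
    rw [h2, Finset.prod_apply]
  have hexp : (Real.exp (-(t ^ 2 * (∑ p ∈ A, v p) / 2)) : ℂ) =
      ∏ p ∈ A, (Real.exp (-(t ^ 2 * v p / 2)) : ℂ) := by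
    rw [← Complex.ofReal_prod, ← Real.exp_sum, Finset.sum_neg_distrib, Finset.mul_sum,
      Finset.sum_div]
  rw [hcf, hexp]
  refine (norm_prod_sub_prod_le (fun p => ?_) fun p => ?_).trans ?_
  · have := Measure.isProbabilityMeasure_map (μ := P) (he.measurable p).aemeasurable
    exact norm_charFun_le_one _
  · rw [Complex.norm_real, Real.norm_eq_abs, abs_of_pos (Real.exp_pos _), Real.exp_le_one_iff]
    have := he.var_nonneg p
    have : 0 ≤ t ^ 2 * v p / 2 := by positivity
    linarith
  · rw [← nsmul_eq_mul]
    refine Finset.sum_le_card_nsmul _ _ _ fun p hp => (he.norm_charFun_sub_le p ht).trans ?_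
    have hB0 : 0 ≤ B := by
      obtain ⟨ω⟩ := nonempty_of_isProbabilityMeasure P
      exact (abs_nonneg _).trans (he.bound p ω)
    have h0 := he.var_nonneg p
    have h4 : (0 : ℝ) ≤ t ^ 4 := by positivity
    exact add_le_add (mul_le_mul_of_nonneg_left (hw p hp) (by positivity))
      (mul_le_mul_of_nonneg_left (pow_le_pow_left₀ h0 (hw p hp) 2) h4)

end IsCenteredArray

end CenteredArray

/-! ### Bounded measurable random variables -/

section BddMeas

variable {Ω : Type*} [MeasurableSpace Ω]

/-- Bounded measurable functions; every moment computation takes place in this class. -/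
def BddMeas (X : Ω → ℝ) : Prop := Measurable X ∧ ∃ C, ∀ ω, |X ω| ≤ C

namespace BddMeas

variable {X Y : Ω → ℝ}

lemma integrable (hX : BddMeas X) {P : Measure Ω} [IsFiniteMeasure P] : Integrable X P :=
  integrable_of_abs_le hX.1 hX.2.choose_spec

lemma const (c : ℝ) : BddMeas fun _ : Ω => c := ⟨measurable_const, |c|, fun _ => le_rfl⟩

lemma add (hX : BddMeas X) (hY : BddMeas Y) : BddMeas fun ω => X ω + Y ω := by
  obtain ⟨hX, C, hC⟩ := hX
  obtain ⟨hY, D, hD⟩ := hY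
  exact ⟨hX.add hY, C + D, fun ω => (abs_add_le _ _).trans (add_le_add (hC ω) (hD ω))⟩

lemma mul (hX : BddMeas X) (hY : BddMeas Y) : BddMeas fun ω => X ω * Y ω := by
  obtain ⟨hX, C, hC⟩ := hX
  obtain ⟨hY, D, hD⟩ := hY
  exact ⟨hX.mul hY, C * D, fun ω => by
    rw [abs_mul]
    exact mul_le_mul (hC ω) (hD ω) (abs_nonneg _) ((abs_nonneg _).trans (hC ω))⟩

lemma const_mul (hX : BddMeas X) (c : ℝ) : BddMeas fun ω => c * X ω := (const c).mul hX

lemma neg (hX : BddMeas X) : BddMeas fun ω => -X ω := by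
  simpa using hX.const_mul (-1)

lemma sub (hX : BddMeas X) (hY : BddMeas Y) : BddMeas fun ω => X ω - Y ω := by
  simpa [sub_eq_add_neg] using hX.add hY.neg

lemma pow (hX : BddMeas X) (k : ℕ) : BddMeas fun ω => X ω ^ k := by
  obtain ⟨hX, C, hC⟩ := hX
  exact ⟨hX.pow_const k, C ^ k, fun ω => by
    rw [abs_pow]; exact pow_le_pow_left₀ (abs_nonneg _) (hC ω) k⟩

lemma sum {ι : Type*} {A : Finset ι} {X : ι → Ω → ℝ} (hX : ∀ i ∈ A, BddMeas (X i)) :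
    BddMeas fun ω => ∑ i ∈ A, X i ω := by
  classical
  induction A using Finset.induction_on with
  | empty => simpa using const 0
  | insert r A hr ih =>
    simp only [Finset.sum_insert hr]
    exact (hX r (Finset.mem_insert_self r A)).add
      (ih fun i hi => hX i (Finset.mem_insert_of_mem hi))

lemma comp {Ω' : Type*} [MeasurableSpace Ω'] (hX : BddMeas X) {φ : Ω' → Ω} (hφ : Measurable φ) :
    BddMeas fun ω => X (φ ω) :=
  ⟨hX.1.comp hφ, hX.2.choose, fun _ => hX.2.choose_spec _⟩

lemma integral_right {Ω' : Type*} [MeasurableSpace Ω'] {P' : Measure Ω'} [IsProbabilityMeasure P']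
    {Z : Ω × Ω' → ℝ} (hZ : BddMeas Z) : BddMeas fun ω => ∫ ω', Z (ω, ω') ∂P' := by
  obtain ⟨hm, C, hC⟩ := hZ
  refine ⟨(hm.stronglyMeasurable.integral_prod_right (f := fun ω ω' => Z (ω, ω'))).measurable,
    C, fun ω => ?_⟩
  have := norm_integral_le_of_norm_le_const (μ := P') (f := fun ω' => Z (ω, ω')) (C := C)
    (ae_of_all _ fun ω' => hC (ω, ω'))
  simpa using this

lemma row {X : ℕ × ℕ → Ω → ℝ} (hX : ∀ p, BddMeas (X p)) (n i : ℕ) :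
    BddMeas fun ω => DyadicKDE.row (fun p => X p ω) n i :=
  BddMeas.sum fun p _ => by
    by_cases h : Incident i p
    · simpa [h] using hX p
    · simpa [h] using const 0

lemma tot {X : ℕ × ℕ → Ω → ℝ} (hX : ∀ p, BddMeas (X p)) (n : ℕ) :
    BddMeas fun ω => DyadicKDE.tot (fun p => X p ω) n :=
  BddMeas.sum fun p _ => hX p

end BddMeas

lemma tendsto_probFilter_zero_of_integral_sq_le {P : Measure Ω} [IsFiniteMeasure P]
    {X : ℕ → Ω → ℝ} {b : ℕ → ℝ} (hX : ∀ᶠ n in atTop, BddMeas (X n))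
    (hb : ∀ᶠ n in atTop, ∫ ω, X n ω ^ 2 ∂P ≤ b n) (hb0 : Tendsto b atTop (𝓝 0)) :
    Tendsto (fun q : ℕ × Ω => X q.1 q.2) (probFilter P) (𝓝 0) := by
  have h := tendsto_probFilter_zero_of_integral_abs_le (P := P) (X := fun n ω => X n ω ^ 2) (b := b)
    (hX.mono fun n hn => (hn.pow 2).integrable) (by simpa only [abs_pow, sq_abs] using hb) hb0
  have h2 := h.sqrt
  simp only [Real.sqrt_sq_eq_abs, Real.sqrt_zero] at h2
  exact (tendsto_zero_iff_abs_tendsto_zero _).2 h2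

lemma integral_add_sq_le {P : Measure Ω} [IsFiniteMeasure P] {X Y : Ω → ℝ} {a b : ℝ}
    (hX : BddMeas X) (hY : BddMeas Y) (ha : ∫ ω, X ω ^ 2 ∂P ≤ a) (hb : ∫ ω, Y ω ^ 2 ∂P ≤ b) :
    ∫ ω, (X ω + Y ω) ^ 2 ∂P ≤ 2 * (a + b) := by
  have h1 := (hX.pow 2).integrable (P := P)
  have h2 := (hY.pow 2).integrable (P := P)
  calc ∫ ω, (X ω + Y ω) ^ 2 ∂P ≤ ∫ ω, 2 * (X ω ^ 2 + Y ω ^ 2) ∂P :=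
        integral_mono ((hX.add hY).pow 2).integrable ((h1.add h2).const_mul 2)
          fun ω => add_sq_le
    _ = 2 * (∫ ω, X ω ^ 2 ∂P + ∫ ω, Y ω ^ 2 ∂P) := by
        rw [integral_const_mul, integral_add h1 h2]
    _ ≤ _ := by linarith

lemma integral_const_mul_sq_le {P : Measure Ω} {X : Ω → ℝ} {a c c' : ℝ}
    (hc : c ^ 2 ≤ c') (ha : ∫ ω, X ω ^ 2 ∂P ≤ a) : ∫ ω, (c * X ω) ^ 2 ∂P ≤ c' * a := by
  simp only [mul_pow]
  rw [integral_const_mul]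
  exact mul_le_mul hc ha (integral_nonneg fun ω => sq_nonneg _) ((sq_nonneg c).trans hc)

end BddMeas

/-! ### Functions of independent vertices -/

section Vertices

variable {Ω E : Type*} [MeasurableSpace Ω] [MeasurableSpace E] {P : Measure Ω}
  {ρ : Measure E}

/-- `U` is an i.i.d. sequence with law `ρ`. -/
structure IsIID (P : Measure Ω) (ρ : Measure E) (U : ℕ → Ω → E) : Prop where
  measurable : ∀ i, Measurable (U i)
  law : ∀ i, P.map (U i) = ρ
  indep : iIndepFun U P

variable {U : ℕ → Ω → E}

namespace IsIID

lemma ae_vertex (hU : IsIID P ρ U) (i : ℕ) {p : E → Prop} (h : ∀ᵐ z ∂ρ, p z) :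
    ∀ᵐ ω ∂P, p (U i ω) := by
  rw [← hU.law i] at h
  exact ae_of_ae_map (hU.measurable i).aemeasurable h

variable [IsProbabilityMeasure P]

lemma map_prodMk (hU : IsIID P ρ U) {i j : ℕ} (hij : i ≠ j) :
    P.map (fun ω => (U i ω, U j ω)) = ρ.prod ρ := by
  have := (indepFun_iff_map_prod_eq_prod_map_map (hU.measurable i).aemeasurable
    (hU.measurable j).aemeasurable).1 (hU.indep.indepFun hij)
  rw [this, hU.law, hU.law]

lemma integral_pair (hU : IsIID P ρ U) {i j : ℕ} (hij : i ≠ j) {φ : E × E → ℝ}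
    (hφ : Measurable φ) : ∫ ω, φ (U i ω, U j ω) ∂P = ∫ z, φ z ∂(ρ.prod ρ) := by
  rw [← hU.map_prodMk hij, integral_map ((hU.measurable i).prodMk (hU.measurable j)).aemeasurable
    hφ.aestronglyMeasurable]

lemma ae_pair (hU : IsIID P ρ U) {i j : ℕ} (hij : i ≠ j) {p : E × E → Prop}
    (h : ∀ᵐ z ∂(ρ.prod ρ), p z) : ∀ᵐ ω ∂P, p (U i ω, U j ω) := by
  rw [← hU.map_prodMk hij] at h
  exact ae_of_ae_map ((hU.measurable i).prodMk (hU.measurable j)).aemeasurable h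

variable [IsProbabilityMeasure ρ]

/-- A kernel with vanishing partial integrals is orthogonal to every function of pairs which
do not contain its first vertex. -/
lemma integral_mul_eq_zero (hU : IsIID P ρ U) {i j k l : ℕ} (hji : j ≠ i) (hjk : j ≠ k)
    (hjl : j ≠ l) {φ ψ : E × E → ℝ} (hφ : BddMeas φ) (hψ : BddMeas ψ)
    (h0 : ∀ᵐ b ∂ρ, ∫ a, φ (a, b) ∂ρ = 0) :
    ∫ ω, φ (U j ω, U i ω) * ψ (U k ω, U l ω) ∂P = 0 := by
  classical
  have mj : j ∈ ({j} : Finset ℕ) := by simp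
  have mi : i ∈ ({i, k, l} : Finset ℕ) := by simp
  have mk : k ∈ ({i, k, l} : Finset ℕ) := by simp
  have ml : l ∈ ({i, k, l} : Finset ℕ) := by simp
  have m1 : Measurable fun x : ({j} : Finset ℕ) → E => x ⟨j, mj⟩ := by fun_prop
  have m2 : Measurable fun x : ({i, k, l} : Finset ℕ) → E =>
      (x ⟨i, mi⟩, (x ⟨k, mk⟩, x ⟨l, ml⟩)) := by fun_prop
  have hind := (hU.indep.indepFun_finset {j} {i, k, l} (by simp [hji, hjk, hjl])
    hU.measurable).comp m1 m2
  have hT : Measurable fun ω => (U i ω, (U k ω, U l ω)) :=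
    (hU.measurable i).prodMk ((hU.measurable k).prodMk (hU.measurable l))
  have hprod := (indepFun_iff_map_prod_eq_prod_map_map (hU.measurable j).aemeasurable
    hT.aemeasurable).1 hind
  have hΦ : BddMeas fun z : E × (E × (E × E)) => φ (z.1, z.2.1) * ψ z.2.2 :=
    (hφ.comp (by fun_prop)).mul (hψ.comp (by fun_prop))
  have hmap := integral_map (μ := P) ((hU.measurable j).prodMk hT).aemeasurable
    hΦ.1.aestronglyMeasurable
  have := Measure.isProbabilityMeasure_map (μ := P) hT.aemeasurable
  rw [← hmap, hprod, hU.law, integral_prod_symm _ hΦ.integrable]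
  rw [integral_eq_zero_of_ae]
  have h1 : ∀ᵐ t ∂(P.map fun ω => (U i ω, (U k ω, U l ω))), ∫ a, φ (a, t.1) ∂ρ = 0 := by
    refine (ae_map_iff hT.aemeasurable ?_).2 (hU.ae_vertex i h0)
    have hm : BddMeas fun b => ∫ a, φ (a, b) ∂ρ :=
      BddMeas.integral_right (Z := fun z : E × E => φ (z.2, z.1)) (hφ.comp measurable_swap)
    exact measurableSet_eq_fun (hm.1.comp measurable_fst) measurable_const
  filter_upwards [h1] with t ht
  simp only [integral_mul_const, ht, zero_mul, Pi.zero_apply]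

/-- Sums of a completely degenerate symmetric kernel over distinct pairs are sums of orthogonal
variables. -/
lemma integral_sum_degenerate_sq (hU : IsIID P ρ U) {φ : E × E → ℝ} (hφ : BddMeas φ)
    (hs : ∀ a b, φ (a, b) = φ (b, a)) (h0 : ∀ᵐ b ∂ρ, ∫ a, φ (a, b) ∂ρ = 0)
    {A : Finset (ℕ × ℕ)} (hA : ∀ p ∈ A, p.1 < p.2) :
    ∫ ω, (∑ p ∈ A, φ (U p.1 ω, U p.2 ω)) ^ 2 ∂P = A.card * ∫ z, φ z ^ 2 ∂(ρ.prod ρ) := by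
  have hb : ∀ p : ℕ × ℕ, BddMeas fun ω => φ (U p.1 ω, U p.2 ω) := fun p =>
    hφ.comp ((hU.measurable _).prodMk (hU.measurable _))
  have hdiag : ∀ p ∈ A, ∫ ω, φ (U p.1 ω, U p.2 ω) * φ (U p.1 ω, U p.2 ω) ∂P =
      ∫ z, φ z ^ 2 ∂(ρ.prod ρ) := fun p hp => by
    rw [← hU.integral_pair (hA p hp).ne (hφ.pow 2).1]
    exact integral_congr_ae (ae_of_all _ fun ω => (sq _).symm)
  have hoff : ∀ p ∈ A, ∀ q ∈ A, p ≠ q →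
      ∫ ω, φ (U p.1 ω, U p.2 ω) * φ (U q.1 ω, U q.2 ω) ∂P = 0 := by
    intro p hp q hq hpq
    have hp' := hA p hp
    have hq' := hA q hq
    by_cases h1 : p.1 = q.1 ∨ p.1 = q.2
    · have h2 : p.2 ≠ q.1 ∧ p.2 ≠ q.2 := by
        obtain ⟨a, b⟩ := p
        obtain ⟨a', b'⟩ := q
        simp only [ne_eq, Prod.mk.injEq] at *
        omega
      simp only [hs (U p.1 _)]
      exact hU.integral_mul_eq_zero hp'.ne' h2.1 h2.2 hφ hφ h0
    · push Not at h1
      exact hU.integral_mul_eq_zero hp'.ne h1.1 h1.2 hφ hφ h0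
  simp only [sq, Finset.sum_mul_sum]
  rw [integral_finsetSum _ fun p _ => (BddMeas.sum fun q _ => (hb p).mul (hb q)).integrable]
  have : ∀ p ∈ A, ∫ ω, ∑ q ∈ A, φ (U p.1 ω, U p.2 ω) * φ (U q.1 ω, U q.2 ω) ∂P =
      ∫ z, φ z ^ 2 ∂(ρ.prod ρ) := fun p hp => by
    rw [integral_finsetSum _ fun q _ => ((hb p).mul (hb q)).integrable,
      Finset.sum_eq_single_of_mem p hp fun q hq hqp => hoff p hp q hq hqp.symm, hdiag p hp]
  rw [Finset.sum_congr rfl this, Finset.sum_const, nsmul_eq_mul]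
  simp only [sq]

/-- Law of large numbers, in quadratic mean, for averages of a bounded kernel over pairs. -/
lemma integral_sum_pairs_sq_le (hU : IsIID P ρ U) {φ : E × E → ℝ} (hφ : BddMeas φ) {C : ℝ}
    (hC : ∀ᵐ z ∂(ρ.prod ρ), |φ z| ≤ C) (h0 : ∫ z, φ z ∂(ρ.prod ρ) = 0) (n : ℕ) :
    ∫ ω, (∑ p ∈ pairs (Finset.range n), φ (U p.1 ω, U p.2 ω)) ^ 2 ∂P ≤ C ^ 2 * n ^ 3 := by
  have hb : ∀ p : ℕ × ℕ, BddMeas fun ω => φ (U p.1 ω, U p.2 ω) := fun p =>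
    hφ.comp ((hU.measurable _).prodMk (hU.measurable _))
  have hC0 : 0 ≤ C := by
    obtain ⟨z, hz⟩ := hC.exists
    exact (abs_nonneg _).trans hz
  have hpq : ∀ p ∈ pairs (Finset.range n), ∀ q ∈ pairs (Finset.range n),
      ∫ ω, φ (U p.1 ω, U p.2 ω) * φ (U q.1 ω, U q.2 ω) ∂P ≤ C ^ 2 * overlap n p q := by
    intro p hp q hq
    obtain ⟨hp1, hp2, hp3⟩ := mem_pairs_range.1 hp
    have hq3 := (mem_pairs_range.1 hq).2.2
    have hle : ∫ ω, φ (U p.1 ω, U p.2 ω) * φ (U q.1 ω, U q.2 ω) ∂P ≤ C ^ 2 := by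
      have : ∫ _ω, C ^ 2 ∂P = C ^ 2 := by simp
      rw [← this]
      refine integral_mono_ae ((hb p).mul (hb q)).integrable (integrable_const _) ?_
      filter_upwards [hU.ae_pair hp3.ne hC, hU.ae_pair hq3.ne hC] with ω h1 h2
      refine (le_abs_self _).trans ?_
      rw [abs_mul, sq]
      exact mul_le_mul h1 h2 (abs_nonneg _) hC0
    by_cases h1 : Incident p.1 q
    · have := one_le_overlap hp1 (Or.inl rfl : Incident p.1 p) h1
      nlinarith [sq_nonneg C]
    by_cases h2 : Incident p.2 q
    · have := one_le_overlap hp2 (Or.inr rfl : Incident p.2 p) h2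
      nlinarith [sq_nonneg C]
    · have hind := (hU.indep.indepFun_prodMk_prodMk hU.measurable p.1 p.2 q.1 q.2
        (fun h => h1 (Or.inl h.symm)) (fun h => h1 (Or.inr h.symm))
        (fun h => h2 (Or.inl h.symm)) (fun h => h2 (Or.inr h.symm))).comp hφ.1 hφ.1
      have := hind.integral_fun_mul_eq_mul_integral (hb p).1.aestronglyMeasurable
        (hb q).1.aestronglyMeasurable
      simp only [Function.comp_apply] at this
      rw [this, hU.integral_pair hp3.ne hφ.1, h0, zero_mul]
      exact mul_nonneg (sq_nonneg _) (overlap_nonneg _ _ _)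
  simp only [sq (∑ p ∈ _, _), Finset.sum_mul_sum]
  rw [integral_finsetSum _ fun p _ => (BddMeas.sum fun q _ => (hb p).mul (hb q)).integrable]
  calc _ ≤ ∑ p ∈ pairs (Finset.range n), ∑ q ∈ pairs (Finset.range n), C ^ 2 * overlap n p q := by
        refine Finset.sum_le_sum fun p hp => ?_
        rw [integral_finsetSum _ fun q _ => ((hb p).mul (hb q)).integrable]
        exact Finset.sum_le_sum fun q hq => hpq p hp q hq
    _ ≤ C ^ 2 * n ^ 3 := by
        simp only [← Finset.mul_sum]
        exact mul_le_mul_of_nonneg_left (sum_overlap_le n) (sq_nonneg C)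

end IsIID

end Vertices

/-! ### Moments of a dyadic array -/

section Dyadic

variable {E : Type*} [MeasurableSpace E] (ρ : Measure E)

/-- The joint law of independent vertex shocks `ω.1 i` and edge shocks `ω.2 (i, j)`. -/
def shockLaw [IsProbabilityMeasure ρ] : Measure ((ℕ → E) × (ℕ × ℕ → E)) :=
  (Measure.infinitePi fun _ => ρ).prod (Measure.infinitePi fun _ => ρ)

/-- Conditional mean of `y (u, v, W)` given the vertex shocks `z = (u, v)`. -/
def edgeMean (y : E × E × E → ℝ) (z : E × E) : ℝ := ∫ w, y (z.1, z.2, w) ∂ρ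

/-- Conditional variance of `y (u, v, W)` given the vertex shocks `z = (u, v)`. -/
def edgeVar (y : E × E × E → ℝ) (z : E × E) : ℝ := ∫ w, (y (z.1, z.2, w) - edgeMean ρ y z) ^ 2 ∂ρ

/-- Conditional mean of `y (u, V, W)` given one vertex shock `u`. -/
def vertexMean (y : E × E × E → ℝ) (u : E) : ℝ := ∫ v, edgeMean ρ y (u, v) ∂ρ

/-- Mean of `y (U, V, W)`. -/
def totalMean (y : E × E × E → ℝ) : ℝ := ∫ u, vertexMean ρ y u ∂ρ

/-- The part of `edgeMean` which is not additive in the two vertices. -/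
def interaction (y : E × E × E → ℝ) (z : E × E) : ℝ :=
  edgeMean ρ y z - vertexMean ρ y z.1 - vertexMean ρ y z.2 + totalMean ρ y

/-- The edge noise of the dyadic array: its fluctuation around the conditional mean given all the
vertex shocks. -/
def noise (y : E × E × E → ℝ) (ω : (ℕ → E) × (ℕ × ℕ → E)) (p : ℕ × ℕ) : ℝ :=
  y (ω.1 p.1, ω.1 p.2, ω.2 p) - edgeMean ρ y (ω.1 p.1, ω.1 p.2)

/-- The doubly degenerate part of the Hoeffding decomposition. -/
def residual (y : E × E × E → ℝ) (ω : (ℕ → E) × (ℕ × ℕ → E)) (p : ℕ × ℕ) : ℝ :=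
  noise ρ y ω p + interaction ρ y (ω.1 p.1, ω.1 p.2)

/-- Bounded nonnegative kernels, symmetric in the two vertex shocks, with conditional means given
the vertices bounded by `B`. -/
structure IsDyadicKernel (y : E × E × E → ℝ) (b B : ℝ) : Prop where
  measurable : Measurable y
  symm : ∀ u v w, y (u, v, w) = y (v, u, w)
  nonneg : ∀ t, 0 ≤ y t
  le : ∀ t, y t ≤ b
  edgeMean_le : ∀ᵐ z ∂(ρ.prod ρ), edgeMean ρ y z ≤ B

instance [IsProbabilityMeasure ρ] : IsProbabilityMeasure (shockLaw ρ) := by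
  unfold shockLaw; infer_instance

variable {ρ}

lemma edgeVar_nonneg (y : E × E × E → ℝ) (z : E × E) : 0 ≤ edgeVar ρ y z :=
  integral_nonneg fun _ => sq_nonneg _

namespace IsDyadicKernel

variable {y : E × E × E → ℝ} {b B : ℝ}

lemma bddMeas (hy : IsDyadicKernel ρ y b B) : BddMeas y :=
  ⟨hy.measurable, b, fun t => by rw [abs_of_nonneg (hy.nonneg t)]; exact hy.le t⟩

lemma edgeMean_nonneg (hy : IsDyadicKernel ρ y b B) (z : E × E) : 0 ≤ edgeMean ρ y z :=
  integral_nonneg fun _ => hy.nonneg _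

lemma edgeMean_symm (hy : IsDyadicKernel ρ y b B) (u v : E) :
    edgeMean ρ y (u, v) = edgeMean ρ y (v, u) := by
  simp only [edgeMean, hy.symm u v]

lemma bddMeas_section (hy : IsDyadicKernel ρ y b B) (z : E × E) :
    BddMeas fun w => y (z.1, z.2, w) := hy.bddMeas.comp (by fun_prop)

lemma vertexMean_nonneg (hy : IsDyadicKernel ρ y b B) (u : E) : 0 ≤ vertexMean ρ y u :=
  integral_nonneg fun _ => hy.edgeMean_nonneg _

lemma interaction_symm (hy : IsDyadicKernel ρ y b B) (u v : E) :
    interaction ρ y (u, v) = interaction ρ y (v, u) := by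
  simp only [interaction, hy.edgeMean_symm u v]; ring

lemma totalMean_nonneg (hy : IsDyadicKernel ρ y b B) : 0 ≤ totalMean ρ y :=
  integral_nonneg fun _ => hy.vertexMean_nonneg _

end IsDyadicKernel

variable [IsProbabilityMeasure ρ]

lemma isIID_vertex : IsIID (shockLaw ρ) ρ fun i ω => ω.1 i := by
  have hmap : ∀ i, (shockLaw ρ).map (fun ω => ω.1 i) = ρ := fun i => by
    have : (fun ω : (ℕ → E) × (ℕ × ℕ → E) => ω.1 i) = (fun u => u i) ∘ Prod.fst := rfl
    rw [this, ← Measure.map_map (measurable_pi_apply i) measurable_fst, shockLaw,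
      Measure.map_fst_prod, measure_univ, one_smul, Measure.infinitePi_map_eval]
  refine ⟨fun i => by fun_prop, hmap, ?_⟩
  rw [iIndepFun_iff_map_fun_eq_infinitePi_map fun i => by fun_prop]
  simp only [hmap]
  change (shockLaw ρ).map Prod.fst = _
  rw [shockLaw, Measure.map_fst_prod, measure_univ, one_smul]

/-- Conditioning on the vertex shocks. -/
lemma integral_shockLaw_le {X : (ℕ → E) × (ℕ × ℕ → E) → ℝ} (hX : BddMeas X) {c : ℝ}
    (h : ∀ᵐ u ∂(Measure.infinitePi fun _ : ℕ => ρ),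
      ∫ w, X (u, w) ∂(Measure.infinitePi fun _ => ρ) ≤ c) :
    ∫ ω, X ω ∂(shockLaw ρ) ≤ c := by
  rw [shockLaw, integral_prod _ hX.integrable]
  refine (integral_mono_ae (hX.integral_right).integrable (integrable_const c) h).trans ?_
  simp

lemma ae_infinitePi_pair {p : E × E → Prop} (h : ∀ᵐ z ∂(ρ.prod ρ), p z) (n : ℕ) :
    ∀ᵐ u ∂(Measure.infinitePi fun _ : ℕ => ρ), ∀ q ∈ pairs (Finset.range n), p (u q.1, u q.2) := by
  have hU : IsIID (Measure.infinitePi fun _ : ℕ => ρ) ρ fun i u => u i :=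
    ⟨fun i => measurable_pi_apply i, fun i => Measure.infinitePi_map_eval _ i,
      iIndepFun_infinitePi (X := fun _ x => x) fun _ => measurable_id⟩
  rw [ae_all_iff]
  intro q
  by_cases hq : q ∈ pairs (Finset.range n)
  · filter_upwards [hU.ae_pair (mem_pairs_range.1 hq).2.2.ne h] with u hu _ using hu
  · exact ae_of_all _ fun u h => absurd h hq

namespace IsDyadicKernel

variable {y : E × E × E → ℝ} {b B : ℝ}

lemma bddMeas_edgeMean (hy : IsDyadicKernel ρ y b B) : BddMeas (edgeMean ρ y) :=
  BddMeas.integral_right (Z := fun t : (E × E) × E => y (t.1.1, t.1.2, t.2))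
    (hy.bddMeas.comp (by fun_prop))

lemma bddMeas_vertexMean (hy : IsDyadicKernel ρ y b B) : BddMeas (vertexMean ρ y) :=
  BddMeas.integral_right (Z := edgeMean ρ y) hy.bddMeas_edgeMean

lemma bddMeas_edgeVar (hy : IsDyadicKernel ρ y b B) : BddMeas (edgeVar ρ y) :=
  BddMeas.integral_right
    (Z := fun t : (E × E) × E => (y (t.1.1, t.1.2, t.2) - edgeMean ρ y t.1) ^ 2)
    (((hy.bddMeas.comp (by fun_prop)).sub (hy.bddMeas_edgeMean.comp measurable_fst)).pow 2)

lemma bddMeas_interaction (hy : IsDyadicKernel ρ y b B) : BddMeas (interaction ρ y) :=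
  ((hy.bddMeas_edgeMean.sub (hy.bddMeas_vertexMean.comp measurable_fst)).sub
    (hy.bddMeas_vertexMean.comp measurable_snd)).add (BddMeas.const _)

lemma bddMeas_noise (hy : IsDyadicKernel ρ y b B) (p : ℕ × ℕ) :
    BddMeas fun ω => noise ρ y ω p :=
  (hy.bddMeas.comp (by fun_prop)).sub (hy.bddMeas_edgeMean.comp (by fun_prop))

lemma bddMeas_interaction_pair (hy : IsDyadicKernel ρ y b B) (p : ℕ × ℕ) :
    BddMeas fun ω : (ℕ → E) × (ℕ × ℕ → E) => interaction ρ y (ω.1 p.1, ω.1 p.2) :=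
  hy.bddMeas_interaction.comp (by fun_prop)

lemma bddMeas_residual (hy : IsDyadicKernel ρ y b B) (p : ℕ × ℕ) :
    BddMeas fun ω => residual ρ y ω p :=
  (hy.bddMeas_noise p).add (hy.bddMeas_interaction_pair p)

lemma edgeMean_le_bound (hy : IsDyadicKernel ρ y b B) (z : E × E) : edgeMean ρ y z ≤ b := by
  refine (integral_mono (hy.bddMeas_section z).integrable (integrable_const b)
    fun w => hy.le _).trans ?_
  simp

lemma bound_nonneg (hy : IsDyadicKernel ρ y b B) : 0 ≤ b := by
  obtain ⟨u⟩ := nonempty_of_isProbabilityMeasure ρ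
  exact (hy.nonneg (u, u, u)).trans (hy.le _)

lemma meanBound_nonneg (hy : IsDyadicKernel ρ y b B) : 0 ≤ B := by
  obtain ⟨z, hz⟩ := hy.edgeMean_le.exists
  exact (hy.edgeMean_nonneg z).trans hz

lemma vertexMean_le (hy : IsDyadicKernel ρ y b B) : ∀ᵐ u ∂ρ, vertexMean ρ y u ≤ B := by
  filter_upwards [Measure.ae_ae_of_ae_prod hy.edgeMean_le] with u hu
  refine (integral_mono_ae (hy.bddMeas_edgeMean.comp (φ := fun v => (u, v))
    (by fun_prop)).integrable (integrable_const B) hu).trans ?_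
  simp

lemma totalMean_le (hy : IsDyadicKernel ρ y b B) : totalMean ρ y ≤ B := by
  refine (integral_mono_ae hy.bddMeas_vertexMean.integrable (integrable_const B)
    hy.vertexMean_le).trans ?_
  simp

lemma integral_interaction (hy : IsDyadicKernel ρ y b B) (v : E) :
    ∫ u, interaction ρ y (u, v) ∂ρ = 0 := by
  have h1 := (hy.bddMeas_edgeMean.comp (φ := fun u => (u, v)) (by fun_prop)).integrable (P := ρ)
  have h2 := hy.bddMeas_vertexMean.integrable (P := ρ)
  have h3 : ∫ u, edgeMean ρ y (u, v) ∂ρ = vertexMean ρ y v := by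
    simp only [fun u => hy.edgeMean_symm u v]; rfl
  have h4 : Integrable (fun u => edgeMean ρ y (u, v) - vertexMean ρ y u) ρ := h1.sub h2
  have h5 : Integrable (fun u => edgeMean ρ y (u, v) - vertexMean ρ y u - vertexMean ρ y v) ρ :=
    h4.sub (integrable_const _)
  simp only [interaction]
  rw [integral_add h5 (integrable_const _), integral_sub h4 (integrable_const _),
    integral_sub h1 h2, h3]
  simp [totalMean]

lemma interaction_sq_le (hy : IsDyadicKernel ρ y b B) :
    ∫ z, interaction ρ y z ^ 2 ∂(ρ.prod ρ) ≤ 4 * B ^ 2 := by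
  have h1 := (Measure.quasiMeasurePreserving_fst (μ := ρ) (ν := ρ)).ae hy.vertexMean_le
  have h2 := (Measure.quasiMeasurePreserving_snd (μ := ρ) (ν := ρ)).ae hy.vertexMean_le
  refine (integral_mono_ae (hy.bddMeas_interaction.pow 2).integrable
    (integrable_const (4 * B ^ 2)) ?_).trans (by simp)
  filter_upwards [hy.edgeMean_le, h1, h2] with z hz h1 h2
  have e1 := hy.edgeMean_nonneg z
  have e2 := hy.vertexMean_nonneg z.1
  have e3 := hy.vertexMean_nonneg z.2
  have e4 := hy.totalMean_nonneg
  have e5 := hy.totalMean_le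
  have : |interaction ρ y z| ≤ 2 * B := by
    rw [interaction, abs_le]; constructor <;> linarith
  rw [← sq_abs]
  nlinarith [abs_nonneg (interaction ρ y z)]

lemma edgeVar_eq (hy : IsDyadicKernel ρ y b B) (z : E × E) :
    edgeVar ρ y z = ∫ w, y (z.1, z.2, w) ^ 2 ∂ρ - edgeMean ρ y z ^ 2 := by
  have h1 := ((hy.bddMeas_section z).pow 2).integrable (P := ρ)
  have h2 := ((hy.bddMeas_section z).const_mul (2 * edgeMean ρ y z)).integrable (P := ρ)
  have hexp : ∀ w, (y (z.1, z.2, w) - edgeMean ρ y z) ^ 2 =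
      y (z.1, z.2, w) ^ 2 - 2 * edgeMean ρ y z * y (z.1, z.2, w) + edgeMean ρ y z ^ 2 :=
    fun w => by ring
  have h3 : Integrable (fun w => y (z.1, z.2, w) ^ 2 - 2 * edgeMean ρ y z * y (z.1, z.2, w)) ρ :=
    h1.sub h2
  have hm : ∫ w, y (z.1, z.2, w) ∂ρ = edgeMean ρ y z := rfl
  rw [edgeVar]
  simp only [hexp]
  rw [integral_add h3 (integrable_const _), integral_sub h1 h2, integral_const_mul, hm]
  simp
  ring

lemma edgeVar_le (hy : IsDyadicKernel ρ y b B) : ∀ᵐ z ∂(ρ.prod ρ), edgeVar ρ y z ≤ b * B := by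
  filter_upwards [hy.edgeMean_le] with z hz
  rw [hy.edgeVar_eq]
  have h1 : ∫ w, y (z.1, z.2, w) ^ 2 ∂ρ ≤ ∫ w, b * y (z.1, z.2, w) ∂ρ :=
    integral_mono ((hy.bddMeas_section z).pow 2).integrable
      ((hy.bddMeas_section z).const_mul b).integrable fun w => by
        simp only [sq]; exact mul_le_mul_of_nonneg_right (hy.le _) (hy.nonneg _)
  rw [integral_const_mul] at h1
  have h2 : b * edgeMean ρ y z ≤ b * B := mul_le_mul_of_nonneg_left hz hy.bound_nonneg
  have h3 : ∫ w, y (z.1, z.2, w) ∂ρ = edgeMean ρ y z := rfl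
  rw [h3] at h1
  nlinarith [sq_nonneg (edgeMean ρ y z)]

/-- Given the vertex shocks, the edge noise is an array of independent centered variables. -/
lemma isCenteredArray (hy : IsDyadicKernel ρ y b B) (u : ℕ → E) :
    IsCenteredArray (Measure.infinitePi fun _ : ℕ × ℕ => ρ) (fun p w => noise ρ y (u, w) p)
      (fun p => edgeVar ρ y (u p.1, u p.2)) b := by
  have hm : ∀ p : ℕ × ℕ, BddMeas fun w : E =>
      y (u p.1, u p.2, w) - edgeMean ρ y (u p.1, u p.2) := fun p =>
    (hy.bddMeas_section (u p.1, u p.2)).sub (BddMeas.const _)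
  have hint : ∀ (p : ℕ × ℕ) {φ : E → ℝ}, Measurable φ →
      ∫ w : ℕ × ℕ → E, φ (w p) ∂(Measure.infinitePi fun _ => ρ) = ∫ w, φ w ∂ρ := by
    intro p φ hφ
    have := integral_map (μ := Measure.infinitePi fun _ : ℕ × ℕ => ρ)
      (measurable_pi_apply p).aemeasurable hφ.aestronglyMeasurable
    rw [← this, Measure.infinitePi_map_eval]
  refine ⟨fun p => (hm p).1.comp (measurable_pi_apply p), ?_, fun p w => ?_, fun p => ?_,
    fun p => ?_⟩
  · exact iIndepFun_infinitePi (P := fun _ : ℕ × ℕ => ρ)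
      (X := fun p w => y (u p.1, u p.2, w) - edgeMean ρ y (u p.1, u p.2))
      fun p => (hm p).1
  · have h1 := hy.nonneg (u p.1, u p.2, w p)
    have h2 := hy.le (u p.1, u p.2, w p)
    have h3 := hy.edgeMean_nonneg (u p.1, u p.2)
    have h4 := hy.edgeMean_le_bound (u p.1, u p.2)
    rw [noise, abs_le]
    constructor <;> linarith
  · refine (hint p (hm p).1).trans ?_
    rw [integral_sub (hy.bddMeas_section (u p.1, u p.2)).integrable (integrable_const _)]
    simp [edgeMean]
  · exact (hint p ((hm p).pow 2).1)

end IsDyadicKernel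

end Dyadic

lemma row_eq_sum_filter (y : ℕ × ℕ → ℝ) (n i : ℕ) :
    row y n i = ∑ p ∈ (pairs (Finset.range n)).filter fun p => Incident i p, y p := by
  rw [row, Finset.sum_filter]

lemma card_filter_incident_le {n i : ℕ} (hi : i < n) :
    (((pairs (Finset.range n)).filter fun p => Incident i p).card : ℝ) ≤ n := by
  have := row_one hi
  rw [row_eq_sum_filter] at this
  simp only [Finset.sum_const, nsmul_eq_mul, mul_one] at this
  linarith

lemma tot_sub (y y' : ℕ × ℕ → ℝ) (n : ℕ) :
    tot (fun p => y p - y' p) n = tot y n - tot y' n := Finset.sum_sub_distrib _ _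

namespace IsDyadicKernel

variable {E : Type*} [MeasurableSpace E] {ρ : Measure E} [IsProbabilityMeasure ρ]
  {y : E × E × E → ℝ} {b B : ℝ}

lemma noiseBound_nonneg (hy : IsDyadicKernel ρ y b B) : 0 ≤ b * B :=
  mul_nonneg hy.bound_nonneg hy.meanBound_nonneg

/-- A moment of the noise is bounded if its conditional versions, given vertex shocks with all
conditional variances at most `b * B`, are bounded. -/
lemma integral_le_of_forall_vertex (hy : IsDyadicKernel ρ y b B)
    {X : (ℕ → E) × (ℕ × ℕ → E) → ℝ} (hX : BddMeas X) {c : ℝ} (n : ℕ)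
    (h : ∀ u : ℕ → E, (∀ p ∈ pairs (Finset.range n), edgeVar ρ y (u p.1, u p.2) ≤ b * B) →
      ∫ w, X (u, w) ∂(Measure.infinitePi fun _ => ρ) ≤ c) :
    ∫ ω, X ω ∂(shockLaw ρ) ≤ c :=
  integral_shockLaw_le hX ((ae_infinitePi_pair hy.edgeVar_le n).mono h)

lemma sum_le_card_mul {A : Finset (ℕ × ℕ)} {v : ℕ × ℕ → ℝ} {w N : ℝ} (hv : ∀ p ∈ A, v p ≤ w)
    (hw : 0 ≤ w) (hN : (A.card : ℝ) ≤ N) : ∑ p ∈ A, v p ≤ N * w := by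
  refine (Finset.sum_le_card_nsmul A v w hv).trans ?_
  rw [nsmul_eq_mul]
  exact mul_le_mul_of_nonneg_right hN hw

lemma integral_sum_noise_sq_le (hy : IsDyadicKernel ρ y b B) {n : ℕ} {A : Finset (ℕ × ℕ)}
    (hA : A ⊆ pairs (Finset.range n)) {N : ℝ} (hN : (A.card : ℝ) ≤ N) :
    ∫ ω, (∑ p ∈ A, noise ρ y ω p) ^ 2 ∂(shockLaw ρ) ≤ N * (b * B) := by
  refine hy.integral_le_of_forall_vertex
    ((BddMeas.sum fun p _ => hy.bddMeas_noise p).pow 2) n fun u hu => ?_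
  have h := (hy.isCenteredArray u).integral_sum_sq A fun _ => 1
  simp only [one_mul, one_pow] at h
  rw [h]
  exact sum_le_card_mul (fun p hp => hu p (hA hp)) hy.noiseBound_nonneg hN

lemma integral_tot_noise_sq_le (hy : IsDyadicKernel ρ y b B) (n : ℕ) :
    ∫ ω, tot (noise ρ y ω) n ^ 2 ∂(shockLaw ρ) ≤ n ^ 2 * (b * B) :=
  hy.integral_sum_noise_sq_le subset_rfl (card_pairs_range_le n)

lemma integral_row_noise_sq_le (hy : IsDyadicKernel ρ y b B) {n i : ℕ} (hi : i < n) :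
    ∫ ω, row (noise ρ y ω) n i ^ 2 ∂(shockLaw ρ) ≤ n * (b * B) := by
  simp only [row_eq_sum_filter]
  exact hy.integral_sum_noise_sq_le (Finset.filter_subset _ _) (card_filter_incident_le hi)

lemma integral_row_noise_pow_four_le (hy : IsDyadicKernel ρ y b B) {n i : ℕ} (hi : i < n) :
    ∫ ω, row (noise ρ y ω) n i ^ 4 ∂(shockLaw ρ) ≤
      3 * (n * (b * B)) ^ 2 + n * (b ^ 2 * (b * B)) := by
  refine hy.integral_le_of_forall_vertex
    ((BddMeas.row (fun p => hy.bddMeas_noise p) n i).pow 4) n fun u hu => ?_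
  simp only [row_eq_sum_filter]
  have he := hy.isCenteredArray u
  refine (he.integral_sum_pow_four_le _).trans ?_
  have hu' : ∀ p ∈ (pairs (Finset.range n)).filter fun p => Incident i p,
      edgeVar ρ y (u p.1, u p.2) ≤ b * B := fun p hp => hu p (Finset.mem_filter.1 hp).1
  refine add_le_add (mul_le_mul_of_nonneg_left (pow_le_pow_left₀ ?_ ?_ 2) (by norm_num)) ?_
  · exact Finset.sum_nonneg fun p _ => edgeVar_nonneg y _
  · exact sum_le_card_mul hu' hy.noiseBound_nonneg (card_filter_incident_le hi)
  · refine sum_le_card_mul (fun p hp => (he.integral_pow_four_le p).trans ?_)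
      (mul_nonneg (sq_nonneg b) hy.noiseBound_nonneg) (card_filter_incident_le hi)
    exact mul_le_mul_of_nonneg_left (hu' p hp) (sq_nonneg b)

/-- The cross products of the noise are negligible in the sum of squared row sums. -/
lemma integral_sum_row_noise_sq_sub_le (hy : IsDyadicKernel ρ y b B) (n : ℕ) :
    ∫ ω, (∑ i ∈ Finset.range n, row (noise ρ y ω) n i ^ 2 -
        2 * tot (fun p => noise ρ y ω p ^ 2) n) ^ 2 ∂(shockLaw ρ) ≤ 4 * (b * B) ^ 2 * n ^ 3 := by
  set a : ℕ × ℕ → ℕ × ℕ → ℝ := fun p q => if p = q then 0 else overlap n p q with ha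
  have hsplit : ∀ z : ℕ × ℕ → ℝ,
      ∑ i ∈ Finset.range n, row z n i ^ 2 - 2 * tot (fun p => z p ^ 2) n =
      ∑ p ∈ pairs (Finset.range n), ∑ q ∈ pairs (Finset.range n), a p q * (z p * z q) := by
    intro z
    rw [sum_row_sq, tot, Finset.mul_sum, ← Finset.sum_sub_distrib]
    refine Finset.sum_congr rfl fun p hp => ?_
    have : 2 * z p ^ 2 = ∑ q ∈ pairs (Finset.range n), if p = q then 2 * z p ^ 2 else 0 := by
      rw [Finset.sum_ite_eq, if_pos hp]
    rw [this, ← Finset.sum_sub_distrib]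
    refine Finset.sum_congr rfl fun q _ => ?_
    by_cases hpq : p = q
    · subst hpq; simp [ha, overlap_self hp]; ring
    · simp [ha, hpq]
  refine hy.integral_le_of_forall_vertex ((BddMeas.sub (BddMeas.sum fun i _ =>
    (BddMeas.row (fun p => hy.bddMeas_noise p) n i).pow 2) ((BddMeas.tot (fun p =>
      (hy.bddMeas_noise p).pow 2) n).const_mul 2)).pow 2) n fun u hu => ?_
  simp only [hsplit]
  rw [(hy.isCenteredArray u).integral_quadratic_sq (pairs (Finset.range n)) (a := a)
    (fun p q => by simp only [ha, eq_comm (a := p), overlap_comm n p q]) (fun p => by simp [ha])]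
  have hle : ∀ p ∈ pairs (Finset.range n), ∀ q ∈ pairs (Finset.range n),
      a p q ^ 2 * (edgeVar ρ y (u p.1, u p.2) * edgeVar ρ y (u q.1, u q.2)) ≤
      2 * (b * B) ^ 2 * overlap n p q := by
    intro p hp q hq
    have h0 := overlap_nonneg n p q
    have h2 := overlap_le_two hp q
    have h1 : a p q ^ 2 ≤ 2 * overlap n p q := by
      simp only [ha]; split_ifs
      · simp [h0]
      · nlinarith
    have hvv : edgeVar ρ y (u p.1, u p.2) * edgeVar ρ y (u q.1, u q.2) ≤ (b * B) ^ 2 := by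
      rw [sq]
      exact mul_le_mul (hu p hp) (hu q hq) (edgeVar_nonneg y _) hy.noiseBound_nonneg
    calc _ ≤ (2 * overlap n p q) * (b * B) ^ 2 := mul_le_mul h1 hvv
          (mul_nonneg (edgeVar_nonneg y _) (edgeVar_nonneg y _)) (by linarith)
      _ = _ := by ring
  calc _ ≤ 2 * ∑ p ∈ pairs (Finset.range n), ∑ q ∈ pairs (Finset.range n),
        2 * (b * B) ^ 2 * overlap n p q :=
        mul_le_mul_of_nonneg_left (Finset.sum_le_sum fun p hp => Finset.sum_le_sum fun q hq =>
          hle p hp q hq) (by norm_num)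
    _ ≤ _ := by
        simp only [← Finset.mul_sum]
        have := mul_le_mul_of_nonneg_left (sum_overlap_le n) (sq_nonneg (b * B))
        linarith

/-- Given the vertices, the squared noise averages out to its conditional variance. -/
lemma integral_tot_noise_sq_sub_sq_le (hy : IsDyadicKernel ρ y b B) (n : ℕ) :
    ∫ ω, (tot (fun p => noise ρ y ω p ^ 2) n - tot (fun p => edgeVar ρ y (ω.1 p.1, ω.1 p.2)) n) ^ 2
      ∂(shockLaw ρ) ≤ n ^ 2 * (b ^ 2 * (b * B)) := by
  refine hy.integral_le_of_forall_vertex (((BddMeas.tot (fun p =>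
      (hy.bddMeas_noise p).pow 2) n).sub (BddMeas.tot (fun p =>
      hy.bddMeas_edgeVar.comp (by fun_prop)) n)).pow 2) n fun u hu => ?_
  simp only [← tot_sub]
  refine ((hy.isCenteredArray u).integral_sum_sq_sub_sq_le (pairs (Finset.range n))).trans ?_
  exact sum_le_card_mul (fun p hp => mul_le_mul_of_nonneg_left (hu p hp) (sq_nonneg b))
    (mul_nonneg (sq_nonneg b) hy.noiseBound_nonneg) (card_pairs_range_le n)

/-- The conditional variances average out over the vertices. -/
lemma integral_tot_edgeVar_sub_sq_le (hy : IsDyadicKernel ρ y b B) (n : ℕ) :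
    ∫ ω, (tot (fun p => edgeVar ρ y (ω.1 p.1, ω.1 p.2)) n -
        (pairs (Finset.range n)).card * ∫ z, edgeVar ρ y z ∂(ρ.prod ρ)) ^ 2 ∂(shockLaw ρ) ≤
      (b * B) ^ 2 * n ^ 3 := by
  have hb := hy.bddMeas_edgeVar
  have hm0 : 0 ≤ ∫ z, edgeVar ρ y z ∂(ρ.prod ρ) := integral_nonneg fun z => edgeVar_nonneg y z
  have hm1 : ∫ z, edgeVar ρ y z ∂(ρ.prod ρ) ≤ b * B := by
    refine (integral_mono_ae hb.integrable (integrable_const (b * B)) hy.edgeVar_le).trans ?_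
    simp
  have h := isIID_vertex.integral_sum_pairs_sq_le (P := shockLaw ρ) (ρ := ρ)
    (φ := fun z => edgeVar ρ y z - ∫ z, edgeVar ρ y z ∂(ρ.prod ρ)) (hb.sub (BddMeas.const _))
    (C := b * B) (by
      filter_upwards [hy.edgeVar_le] with z hz
      have := edgeVar_nonneg (ρ := ρ) y z
      rw [abs_le]; constructor <;> linarith)
    (by rw [integral_sub hb.integrable (integrable_const _)]; simp) n
  simpa only [Finset.sum_sub_distrib, Finset.sum_const, nsmul_eq_mul] using! h

lemma integral_sum_interaction_sq_le (hy : IsDyadicKernel ρ y b B) {A : Finset (ℕ × ℕ)}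
    (hA : ∀ p ∈ A, p.1 < p.2) {N : ℝ} (hN : (A.card : ℝ) ≤ N) :
    ∫ ω, (∑ p ∈ A, interaction ρ y (ω.1 p.1, ω.1 p.2)) ^ 2 ∂(shockLaw ρ) ≤ N * (4 * B ^ 2) := by
  rw [isIID_vertex.integral_sum_degenerate_sq (ρ := ρ) hy.bddMeas_interaction hy.interaction_symm
    (ae_of_all _ hy.integral_interaction) hA]
  exact mul_le_mul hN hy.interaction_sq_le (integral_nonneg fun _ => sq_nonneg _)
    ((Nat.cast_nonneg _).trans hN)

lemma integral_tot_interaction_sq_le (hy : IsDyadicKernel ρ y b B) (n : ℕ) :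
    ∫ ω, tot (fun p => interaction ρ y (ω.1 p.1, ω.1 p.2)) n ^ 2 ∂(shockLaw ρ) ≤
      n ^ 2 * (4 * B ^ 2) :=
  hy.integral_sum_interaction_sq_le (fun _ hp => (mem_pairs_range.1 hp).2.2)
    (card_pairs_range_le n)

lemma integral_row_interaction_sq_le (hy : IsDyadicKernel ρ y b B) {n i : ℕ} (hi : i < n) :
    ∫ ω, row (fun p => interaction ρ y (ω.1 p.1, ω.1 p.2)) n i ^ 2 ∂(shockLaw ρ) ≤
      n * (4 * B ^ 2) := by
  simp only [row_eq_sum_filter]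
  exact hy.integral_sum_interaction_sq_le
    (fun _ hp => (mem_pairs_range.1 (Finset.mem_filter.1 hp).1).2.2) (card_filter_incident_le hi)

lemma integral_interaction_sq_le (hy : IsDyadicKernel ρ y b B) {p : ℕ × ℕ} (hp : p.1 < p.2) :
    ∫ ω, interaction ρ y (ω.1 p.1, ω.1 p.2) ^ 2 ∂(shockLaw ρ) ≤ 4 * B ^ 2 := by
  have := hy.integral_sum_interaction_sq_le (A := {p}) (by simpa using hp) (N := 1) (by simp)
  simpa using this

lemma integral_tot_residual_sq_le (hy : IsDyadicKernel ρ y b B) (n : ℕ) :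
    ∫ ω, tot (residual ρ y ω) n ^ 2 ∂(shockLaw ρ) ≤ n ^ 2 * (2 * (b * B) + 8 * B ^ 2) := by
  have := integral_add_sq_le (BddMeas.tot (fun p => hy.bddMeas_noise p) n)
    (BddMeas.tot (fun p => hy.bddMeas_interaction_pair p) n) (hy.integral_tot_noise_sq_le n)
    (hy.integral_tot_interaction_sq_le n)
  have h2 : ∀ ω, tot (residual ρ y ω) n = tot (fun p => noise ρ y ω p) n +
      tot (fun p => interaction ρ y (ω.1 p.1, ω.1 p.2)) n := fun ω => tot_add _ _ n
  simp only [h2]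
  linarith

lemma integral_row_residual_sq_le (hy : IsDyadicKernel ρ y b B) {n i : ℕ} (hi : i < n) :
    ∫ ω, row (residual ρ y ω) n i ^ 2 ∂(shockLaw ρ) ≤ n * (2 * (b * B) + 8 * B ^ 2) := by
  have := integral_add_sq_le (BddMeas.row (fun p => hy.bddMeas_noise p) n i)
    (BddMeas.row (fun p => hy.bddMeas_interaction_pair p) n i) (hy.integral_row_noise_sq_le hi)
    (hy.integral_row_interaction_sq_le hi)
  have h2 : ∀ ω, row (residual ρ y ω) n i = row (fun p => noise ρ y ω p) n i +
      row (fun p => interaction ρ y (ω.1 p.1, ω.1 p.2)) n i := fun ω => row_add _ _ n i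
  simp only [h2]
  linarith

end IsDyadicKernel

/-! ### From jackknife limits to likelihood limits -/

section JackknifeLimit

variable {Ω : Type*} [MeasurableSpace Ω] {P : Measure Ω}

/-- A product of a null sequence and a tight one is null, in probability. -/
lemma tendsto_mul_zero_of_tight [IsProbabilityMeasure P]
    {Ω' : Type*} [MeasurableSpace Ω'] {P' : Measure Ω'} [IsProbabilityMeasure P']
    {N : ℕ → Ω → ℝ} {Z : Ω' → ℝ}
    (hN : TendstoInDistribution N atTop Z (fun _ => P) P') {a : ℕ × Ω → ℝ}
    (ha : Tendsto a (probFilter P) (𝓝 0)) :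
    Tendsto (fun q => a q * N q.1 q.2) (probFilter P) (𝓝 0) := by
  rw [Metric.tendsto_nhds]
  intro ε hε
  refine eventually_probFilter_of_tight hN fun M => ?_
  have h : Tendsto (fun q => |a q| * |M|) (probFilter P) (𝓝 0) := by
    simpa using ha.abs.mul_const |M|
  filter_upwards [(h.eventually_lt_const hε).filter_mono inf_le_left,
    mem_inf_of_right (mem_principal_self _)] with q hq hqM
  have hqM' : |N q.1 q.2| ≤ M := hqM
  rw [Real.dist_eq, sub_zero, abs_mul]
  exact lt_of_le_of_lt (mul_le_mul_of_nonneg_left (hqM'.trans (le_abs_self M)) (abs_nonneg _)) hq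

/-- The limits of the jackknife statistics of the array `Y`, with normalization `c`: the estimation
error has asymptotic variance `τ`, the jackknife variance estimator has limit `d`, and the
correction terms account for the difference. -/
structure JackknifeLimit (P : Measure Ω) [IsProbabilityMeasure P] (Y : ℕ → Ω → ℕ × ℕ → ℝ) (θ : ℝ)
    (c : ℕ → ℝ) (m : ℕ × Ω → ℝ) (τ d : ℝ) : Prop where
  measurable : ∀ n p, Measurable fun ω => Y n ω p
  scale_pos : ∀ᶠ n in atTop, 0 < c n
  var_pos : 0 < τ
  sq_pos : 0 < d
  sum : TendstoInDistribution
    (fun n ω => c n * ∑ i ∈ Finset.range n, V (pairAvg (Y n ω)) n θ i) atTop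
    (fun z : ℝ => √τ * z) (fun _ => P) (gaussianReal 0 1)
  sq : Tendsto (fun q : ℕ × Ω => c q.1 ^ 2 *
    ∑ i ∈ Finset.range q.1, V (pairAvg (Y q.1 q.2)) q.1 θ i ^ 2) (probFilter P) (𝓝 d)
  corr : Tendsto (fun q : ℕ × Ω => c q.1 ^ 2 *
    ∑ p ∈ pairs (Finset.range q.1), Q (pairAvg (Y q.1 q.2)) q.1 θ p.1 p.2 ^ 2) (probFilter P)
    (𝓝 (d - τ))
  tendsto_max : Tendsto m (probFilter P) (𝓝 0)
  le_max : ∀ᶠ q : ℕ × Ω in probFilter P, ∀ i < q.1,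
    c q.1 * |V (pairAvg (Y q.1 q.2)) q.1 θ i| ≤ m q

/-- Since the pseudo values at `t` sum to `n (est - t)`, recentering them at the estimator removes
the square of their mean. -/
lemma sum_V_est_sq (y : ℕ × ℕ → ℝ) {n : ℕ} (hn : 4 ≤ n) (t : ℝ) :
    ∑ i ∈ Finset.range n, V (pairAvg y) n (est (pairAvg y) n) i ^ 2 =
      ∑ i ∈ Finset.range n, V (pairAvg y) n t i ^ 2 - n * (est (pairAvg y) n - t) ^ 2 := by
  have h : ∀ i, V (pairAvg y) n (est (pairAvg y) n) i ^ 2 = V (pairAvg y) n t i ^ 2 -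
      2 * (est (pairAvg y) n - t) * V (pairAvg y) n t i + (est (pairAvg y) n - t) ^ 2 := fun i => by
    rw [V_eq_V_add _ n i t (est (pairAvg y) n)]; ring
  simp only [h, Finset.sum_add_distrib, Finset.sum_sub_distrib, ← Finset.mul_sum,
    sum_V_pairAvg y hn, Finset.sum_const, Finset.card_range, nsmul_eq_mul]
  ring

/-- The modified pseudo values differ from the original ones by a shift which is common to all
vertices. -/
lemma Vmod_eq (T : Finset ℕ → ℝ) (n i : ℕ) (t : ℝ) :
    Vmod T n t i =
      V T n t i + (√(gammaSq T n t) * (√(gammaModSq T n t))⁻¹ - 1) * (est T n - t) := by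
  rw [Vmod, V_eq_V_add T n i t (est T n)]; ring

lemma sqrt_mul_inv_sqrt_of_scale {k A A' C C' : ℝ} (hk : 0 < k) (hA : k * A = A')
    (hC : k * C = C') : √A * (√C)⁻¹ = √A' * (√C')⁻¹ := by
  have hk' := (Real.sqrt_pos.2 hk).ne'
  rw [← hA, ← hC, Real.sqrt_mul hk.le, Real.sqrt_mul hk.le]
  field_simp

section Measurability

variable {y : Ω → ℕ × ℕ → ℝ}

lemma measurable_pairAvg (hy : ∀ p, Measurable fun ω => y ω p) (A : Finset ℕ) :
    Measurable fun ω => pairAvg (y ω) A :=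
  (Finset.measurable_fun_sum _ fun p _ => hy p).div_const _

lemma measurable_V (hy : ∀ p, Measurable fun ω => y ω p) (n i : ℕ) (t : ℝ) :
    Measurable fun ω => V (pairAvg (y ω)) n t i :=
  (((measurable_pairAvg hy _).sub_const t).const_mul _).sub
    (((measurable_pairAvg hy _).sub_const t).const_mul _)

lemma measurable_V_est (hy : ∀ p, Measurable fun ω => y ω p) (n i : ℕ) :
    Measurable fun ω => V (pairAvg (y ω)) n (est (pairAvg (y ω)) n) i :=
  (((measurable_pairAvg hy _).sub (measurable_pairAvg hy _)).const_mul _).sub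
    (((measurable_pairAvg hy _).sub (measurable_pairAvg hy _)).const_mul _)

lemma measurable_Q (hy : ∀ p, Measurable fun ω => y ω p) (n i j : ℕ) (t : ℝ) :
    Measurable fun ω => Q (pairAvg (y ω)) n t i j := by
  have h (A : Finset ℕ) := (measurable_pairAvg hy A).sub_const t
  exact ((((h _).const_mul _).sub (((h _).add (h _)).const_mul _)).add
    ((h _).const_mul _)).const_mul _

lemma measurable_gamma_ratio (hy : ∀ p, Measurable fun ω => y ω p) (n : ℕ) (t : ℝ) :
    Measurable fun ω =>
      √(gammaSq (pairAvg (y ω)) n t) * (√(gammaModSq (pairAvg (y ω)) n t))⁻¹ := by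
  refine Measurable.mul (Measurable.sqrt ?_) (Measurable.inv (Measurable.sqrt ?_))
  · exact (Finset.measurable_fun_sum _ fun i _ => (measurable_V hy n i t).pow_const 2).const_mul _
  · exact ((Finset.measurable_fun_sum _ fun i _ =>
      (measurable_V_est hy n i).pow_const 2).const_mul _).sub
      ((Finset.measurable_fun_sum _ fun p _ =>
        (measurable_Q hy n p.1 p.2 t).pow_const 2).const_mul _)

lemma measurable_Vmod (hy : ∀ p, Measurable fun ω => y ω p) (n i : ℕ) (t : ℝ) :
    Measurable fun ω => Vmod (pairAvg (y ω)) n t i :=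
  (measurable_V_est hy n i).sub ((measurable_gamma_ratio hy n t).mul
    ((measurable_V_est hy n i).sub (measurable_V hy n i t)))

end Measurability

namespace JackknifeLimit

variable [IsProbabilityMeasure P] {Y : ℕ → Ω → ℕ × ℕ → ℝ} {θ : ℝ} {c : ℕ → ℝ} {m : ℕ × Ω → ℝ}
  {τ d : ℝ}

/-- The likelihood statistic standardizes the sum of the pseudo values by `d` in place of its
asymptotic variance `τ`. -/
theorem tendsto_elStat_V (H : JackknifeLimit P Y θ c m τ d) :
    TendstoInDistribution (fun n ω => elStat n (V (pairAvg (Y n ω)) n θ)) atTop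
      (fun z : ℝ => ((τ / d * z ^ 2 : ℝ) : EReal)) (fun _ => P) (gaussianReal 0 1) := by
  have h := elStat_tendstoInDistribution (v := fun n ω => V (pairAvg (Y n ω)) n θ)
    (fun n i => measurable_V (H.measurable n) n i θ) H.scale_pos H.sq_pos H.sum H.sq H.tendsto_max
    H.le_max
  convert h using 3 with z
  rw [mul_pow, Real.sq_sqrt H.var_pos.le]
  ring_nf

/-- The ratio `Γ / Γ_m` corrects the asymptotic variance. -/
lemma tendsto_gamma_ratio (H : JackknifeLimit P Y θ c m τ d) :
    Tendsto (fun q : ℕ × Ω => √(gammaSq (pairAvg (Y q.1 q.2)) q.1 θ) *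
      (√(gammaModSq (pairAvg (Y q.1 q.2)) q.1 θ))⁻¹) (probFilter P) (𝓝 (√d * (√τ)⁻¹)) := by
  set N : ℕ → Ω → ℝ := fun n ω => c n * ∑ i ∈ Finset.range n, V (pairAvg (Y n ω)) n θ i with hN
  have h1 : Tendsto (fun q : ℕ × Ω => 1 / (q.1 : ℝ)) (probFilter P) (𝓝 0) :=
    (tendsto_one_div_atTop_nhds_zero_nat (𝕜 := ℝ)).comp tendsto_fst_probFilter
  -- recentering at the estimator costs `N ^ 2 / n`, which vanishes as `N` is tight
  have h2 := tendsto_mul_zero_of_tight H.sum (tendsto_mul_zero_of_tight H.sum h1)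
  have h3 := (H.sq.sub h2).sub H.corr
  rw [sub_zero, sub_sub_cancel] at h3
  refine (H.sq.sqrt.mul (h3.sqrt.inv₀ (Real.sqrt_pos.2 H.var_pos).ne')).congr' ?_
  filter_upwards [tendsto_fst_probFilter.eventually H.scale_pos,
    tendsto_fst_probFilter.eventually (eventually_ge_atTop 4)] with q hc hn
  have hn0 : (0 : ℝ) < q.1 := by exact_mod_cast (by omega : 0 < q.1)
  refine (sqrt_mul_inv_sqrt_of_scale (k := c q.1 ^ 2 * q.1) (by positivity) ?_ ?_).symm
  · rw [gammaSq]; field_simp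
  · rw [gammaModSq, sum_V_est_sq _ hn θ, sum_V_pairAvg _ hn θ]
    field_simp

/-- The modification rescales the sum of the pseudo values so that its asymptotic variance becomes
`d`, and leaves the sum of their squares asymptotically unchanged. -/
theorem tendsto_elStat_Vmod (H : JackknifeLimit P Y θ c m τ d) :
    TendstoInDistribution (fun n ω => elStat n (Vmod (pairAvg (Y n ω)) n θ)) atTop
      (fun z : ℝ => ((z ^ 2 : ℝ) : EReal)) (fun _ => P) (gaussianReal 0 1) := by
  set N : ℕ → Ω → ℝ := fun n ω => c n * ∑ i ∈ Finset.range n, V (pairAvg (Y n ω)) n θ i with hN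
  set R : ℕ → Ω → ℝ := fun n ω => √(gammaSq (pairAvg (Y n ω)) n θ) *
      (√(gammaModSq (pairAvg (Y n ω)) n θ))⁻¹ with hR
  have hRlim : Tendsto (fun q : ℕ × Ω => R q.1 q.2) (probFilter P) (𝓝 (√d * (√τ)⁻¹)) :=
    H.tendsto_gamma_ratio
  have hRmeas : ∀ n, Measurable (R n) := fun n => measurable_gamma_ratio (H.measurable n) n θ
  have hNmeas : ∀ n, Measurable (N n) := fun n =>
    (Finset.measurable_fun_sum _ fun i _ => measurable_V (H.measurable n) n i θ).const_mul _
  have h1 : Tendsto (fun q : ℕ × Ω => 1 / (q.1 : ℝ)) (probFilter P) (𝓝 0) :=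
    (tendsto_one_div_atTop_nhds_zero_nat (𝕜 := ℝ)).comp tendsto_fst_probFilter
  have h2 : Tendsto (fun q : ℕ × Ω => 1 / (q.1 : ℝ) * N q.1 q.2) (probFilter P) (𝓝 0) :=
    tendsto_mul_zero_of_tight H.sum h1
  have h3 : Tendsto (fun q : ℕ × Ω => 1 / (q.1 : ℝ) * N q.1 q.2 * N q.1 q.2) (probFilter P)
      (𝓝 0) := tendsto_mul_zero_of_tight H.sum h2
  have hτ := Real.sqrt_pos.2 H.var_pos
  have hn4 : ∀ᶠ q : ℕ × Ω in probFilter P, 4 ≤ q.1 :=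
    tendsto_fst_probFilter.eventually (eventually_ge_atTop 4)
  -- the centered sum is multiplied by `Γ / Γ_m`
  have hsumeq : ∀ q : ℕ × Ω, 4 ≤ q.1 → R q.1 q.2 * N q.1 q.2 =
      c q.1 * ∑ i ∈ Finset.range q.1, Vmod (pairAvg (Y q.1 q.2)) q.1 θ i := by
    intro q hn
    simp only [Vmod_eq, Finset.sum_add_distrib, Finset.sum_const, Finset.card_range, nsmul_eq_mul,
      hN, hR, sum_V_pairAvg _ hn]
    ring
  have hprod : TendstoInDistribution (fun n ω => R n ω * N n ω) atTop
      (fun z : ℝ => (√d * (√τ)⁻¹) * (√τ * z)) (fun _ => P) (gaussianReal 0 1) :=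
    H.sum.continuous_comp_prodMk_of_tendstoInMeasure_const (g := fun x : ℝ × ℝ => x.2 * x.1)
      (by fun_prop) (tendstoInMeasure_of_probFilter hRlim) fun n => (hRmeas n).aemeasurable
  have hsum := tendstoInDistribution_of_eventually_eq (Y := fun n ω =>
    c n * ∑ i ∈ Finset.range n, Vmod (pairAvg (Y n ω)) n θ i) hprod
    (fun n => ((Finset.measurable_fun_sum _ fun i _ =>
      measurable_Vmod (H.measurable n) n i θ).const_mul _).aemeasurable)
    (hn4.mono fun q hn => hsumeq q hn)
  have hsq : Tendsto (fun q : ℕ × Ω => c q.1 ^ 2 *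
      ∑ i ∈ Finset.range q.1, Vmod (pairAvg (Y q.1 q.2)) q.1 θ i ^ 2) (probFilter P) (𝓝 d) := by
    have h := H.sq.add (((hRlim.pow 2).sub_const 1).mul h3)
    rw [mul_zero, add_zero] at h
    refine h.congr' ?_
    filter_upwards [hn4] with q hn
    have hn0 : (q.1 : ℝ) ≠ 0 := by exact_mod_cast (by omega : q.1 ≠ 0)
    have hexp : ∀ i, Vmod (pairAvg (Y q.1 q.2)) q.1 θ i ^ 2 =
        V (pairAvg (Y q.1 q.2)) q.1 θ i ^ 2 +
        2 * ((R q.1 q.2 - 1) * (est (pairAvg (Y q.1 q.2)) q.1 - θ)) *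
          V (pairAvg (Y q.1 q.2)) q.1 θ i +
        ((R q.1 q.2 - 1) * (est (pairAvg (Y q.1 q.2)) q.1 - θ)) ^ 2 := fun i => by
      rw [Vmod_eq]; ring
    simp only [hexp, Finset.sum_add_distrib, ← Finset.mul_sum, hN, sum_V_pairAvg _ hn,
      Finset.sum_const, Finset.card_range, nsmul_eq_mul]
    field_simp
    ring
  have hmlim : Tendsto (fun q : ℕ × Ω => m q + |R q.1 q.2 - 1| * |1 / (q.1 : ℝ) * N q.1 q.2|)
      (probFilter P) (𝓝 0) := by
    have := H.tendsto_max.add ((hRlim.sub_const 1).abs.mul h2.abs)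
    simpa using this
  have hmax : ∀ᶠ q : ℕ × Ω in probFilter P, ∀ i < q.1,
      c q.1 * |Vmod (pairAvg (Y q.1 q.2)) q.1 θ i| ≤
        m q + |R q.1 q.2 - 1| * |1 / (q.1 : ℝ) * N q.1 q.2| := by
    filter_upwards [hn4, H.le_max, tendsto_fst_probFilter.eventually H.scale_pos] with q hn hle hc
    intro i hi
    have hn0 : (q.1 : ℝ) ≠ 0 := by exact_mod_cast (by omega : q.1 ≠ 0)
    have : 1 / (q.1 : ℝ) * N q.1 q.2 = c q.1 * (est (pairAvg (Y q.1 q.2)) q.1 - θ) := by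
      simp only [hN, sum_V_pairAvg _ hn]; field_simp
    rw [this, Vmod_eq, abs_mul, abs_of_pos hc]
    refine (mul_le_mul_of_nonneg_left (abs_add_le _ _) hc.le).trans ?_
    rw [mul_add, abs_mul]
    refine add_le_add (hle i hi) (le_of_eq ?_)
    ring
  have h := elStat_tendstoInDistribution (v := fun n ω => Vmod (pairAvg (Y n ω)) n θ)
    (fun n i => measurable_Vmod (H.measurable n) n i θ) H.scale_pos H.sq_pos hsum hsq hmlim hmax
  convert h using 3 with z
  have hd := H.sq_pos
  rw [mul_pow, mul_pow, mul_pow, inv_pow, Real.sq_sqrt H.var_pos.le, Real.sq_sqrt hd.le]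
  have := H.var_pos.ne'
  field_simp

end JackknifeLimit

end JackknifeLimit

/-! ### Remainders in the expansion of the jackknife statistics -/

section Remainders

variable {E : Type*} [MeasurableSpace E] (ρ : Measure E)

/-- Contribution of the smoothing bias to a pseudo value, when `ξ` is the first order projection of
the limiting array. -/
def biasTerm (y : E × E × E → ℝ) (θ : ℝ) (ξ : E → ℝ) (u : E) : ℝ :=
  2 * (vertexMean ρ y u - θ - ξ u) - (totalMean ρ y - θ)

/-- The part of the pseudo value `V_i` which is negligible in mean square. -/
def vertexRem (y : E × E × E → ℝ) (θ : ℝ) (ξ : E → ℝ) (n : ℕ) (ω : (ℕ → E) × (ℕ × ℕ → E))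
    (i : ℕ) : ℝ :=
  biasTerm ρ y θ ξ (ω.1 i) +
    (2 / ((n : ℝ) - 2) * row (fun p => interaction ρ y (ω.1 p.1, ω.1 p.2)) n i +
      -(2 / (((n : ℝ) - 1) * ((n : ℝ) - 2))) * tot (residual ρ y ω) n)

/-- The part of the correction term `Q_{ij}` which is negligible in mean square. -/
def edgeRem (y : E × E × E → ℝ) (n : ℕ) (ω : (ℕ → E) × (ℕ × ℕ → E)) (p : ℕ × ℕ) : ℝ :=
  2 / ((n : ℝ) - 1) * (interaction ρ y (ω.1 p.1, ω.1 p.2) +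
    (-(1 / ((n : ℝ) - 2)) * (row (residual ρ y ω) n p.1 + row (residual ρ y ω) n p.2) +
      2 / (((n : ℝ) - 1) * ((n : ℝ) - 2)) * tot (residual ρ y ω) n))

/-- The part of the sum of the pseudo values which is negligible in mean square. -/
def sumRem (y : E × E × E → ℝ) (θ : ℝ) (ξ : E → ℝ) (n : ℕ) (ω : (ℕ → E) × (ℕ × ℕ → E)) : ℝ :=
  ∑ i ∈ Finset.range n, biasTerm ρ y θ ξ (ω.1 i) +
    2 / ((n : ℝ) - 1) * tot (fun p => interaction ρ y (ω.1 p.1, ω.1 p.2)) n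

variable {ρ} {y : E × E × E → ℝ} {θ : ℝ} {ξ : E → ℝ} {n : ℕ}

lemma sub_ne_zero_of_four_le (hn : 4 ≤ n) : (n : ℝ) ≠ 0 ∧ (n : ℝ) - 1 ≠ 0 ∧ (n : ℝ) - 2 ≠ 0 := by
  have : (4 : ℝ) ≤ n := by exact_mod_cast hn
  exact ⟨by linarith, by linarith, by linarith⟩

/-- The Hoeffding decomposition of one entry of the array. -/
lemma kernel_eq_hoeffding (ω : (ℕ → E) × (ℕ × ℕ → E)) (p : ℕ × ℕ) :
    y (ω.1 p.1, ω.1 p.2, ω.2 p) = totalMean ρ y +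
      ((vertexMean ρ y (ω.1 p.1) - totalMean ρ y) + (vertexMean ρ y (ω.1 p.2) - totalMean ρ y)) +
      residual ρ y ω p := by
  simp only [residual, noise, interaction]; ring

/-- A pseudo value is, up to a negligible term, the first order projection at its vertex plus the
noise of the edges at this vertex. -/
lemma V_eq_main_add_rem (hn : 4 ≤ n) (ω : (ℕ → E) × (ℕ × ℕ → E)) {i : ℕ} (hi : i < n) :
    V (pairAvg fun p => y (ω.1 p.1, ω.1 p.2, ω.2 p)) n θ i =
      (2 * ξ (ω.1 i) + 2 / ((n : ℝ) - 2) * row (noise ρ y ω) n i) + vertexRem ρ y θ ξ n ω i := by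
  rw [V_pairAvg_of_additive (s := fun i => vertexMean ρ y (ω.1 i) - totalMean ρ y) hn hi
    fun p _ => kernel_eq_hoeffding ω p, vertexRem, biasTerm]
  have : row (residual ρ y ω) n i = row (noise ρ y ω) n i +
      row (fun p => interaction ρ y (ω.1 p.1, ω.1 p.2)) n i := row_add _ _ _ _
  rw [this]; ring

/-- The second order difference `Q` annihilates the additive part of the Hoeffding decomposition and
isolates the noise of a single edge. -/
lemma Q_eq_main_add_rem (hn : 4 ≤ n) (ω : (ℕ → E) × (ℕ × ℕ → E)) {p : ℕ × ℕ}
    (hp : p ∈ pairs (Finset.range n)) :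
    Q (pairAvg fun p => y (ω.1 p.1, ω.1 p.2, ω.2 p)) n θ p.1 p.2 =
      2 / ((n : ℝ) - 1) * noise ρ y ω p + edgeRem ρ y n ω p := by
  rw [Q_pairAvg_of_additive (s := fun i => vertexMean ρ y (ω.1 i) - totalMean ρ y) hn
    (fun p _ => kernel_eq_hoeffding ω p) hp, edgeRem]
  have : residual ρ y ω p = noise ρ y ω p + interaction ρ y (ω.1 p.1, ω.1 p.2) := rfl
  rw [this]; ring

/-- The noise of an edge enters the pseudo values of both of its end points, which gives the total
noise the weight `2 / (n - 1)`. -/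
lemma sum_V_eq_main_add_rem (hn : 4 ≤ n) (ω : (ℕ → E) × (ℕ × ℕ → E)) :
    ∑ i ∈ Finset.range n, V (pairAvg fun p => y (ω.1 p.1, ω.1 p.2, ω.2 p)) n θ i =
      (2 * ∑ i ∈ Finset.range n, ξ (ω.1 i) + 2 / ((n : ℝ) - 1) * tot (noise ρ y ω) n) +
        sumRem ρ y θ ξ n ω := by
  obtain ⟨h0, h1, -⟩ := sub_ne_zero_of_four_le hn
  rw [sum_V_pairAvg _ hn,
    est_pairAvg_of_additive (s := fun i => vertexMean ρ y (ω.1 i) - totalMean ρ y) hn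
    fun p _ => kernel_eq_hoeffding ω p, sumRem]
  have : tot (residual ρ y ω) n = tot (noise ρ y ω) n +
      tot (fun p => interaction ρ y (ω.1 p.1, ω.1 p.2)) n := tot_add _ _ _
  rw [this]
  simp only [biasTerm, Finset.sum_sub_distrib, ← Finset.mul_sum, Finset.sum_const,
    Finset.card_range, nsmul_eq_mul]
  field_simp
  ring

variable [IsProbabilityMeasure ρ] {b B β : ℝ}

lemma bddMeas_biasTerm (hy : IsDyadicKernel ρ y b B) (hξ : BddMeas ξ) :
    BddMeas (biasTerm ρ y θ ξ) :=
  (((hy.bddMeas_vertexMean.sub (BddMeas.const θ)).sub hξ).const_mul 2).sub (BddMeas.const _)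

lemma bddMeas_vertexRem (hy : IsDyadicKernel ρ y b B) (hξ : BddMeas ξ) (i : ℕ) :
    BddMeas fun ω => vertexRem ρ y θ ξ n ω i :=
  ((bddMeas_biasTerm hy hξ).comp (by fun_prop)).add
    (((BddMeas.row hy.bddMeas_interaction_pair n i).const_mul _).add
      ((BddMeas.tot hy.bddMeas_residual n).const_mul _))

lemma bddMeas_edgeRem (hy : IsDyadicKernel ρ y b B) (p : ℕ × ℕ) :
    BddMeas fun ω => edgeRem ρ y n ω p :=
  ((hy.bddMeas_interaction_pair p).add ((((BddMeas.row hy.bddMeas_residual n _).add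
    (BddMeas.row hy.bddMeas_residual n _)).const_mul _).add
      ((BddMeas.tot hy.bddMeas_residual n).const_mul _))).const_mul _

lemma bddMeas_sumRem (hy : IsDyadicKernel ρ y b B) (hξ : BddMeas ξ) :
    BddMeas fun ω => sumRem ρ y θ ξ n ω :=
  (BddMeas.sum fun i _ => (bddMeas_biasTerm hy hξ).comp (φ := fun ω : (ℕ → E) × (ℕ × ℕ → E) =>
    ω.1 i) (by fun_prop)).add ((BddMeas.tot hy.bddMeas_interaction_pair n).const_mul _)

lemma integral_sq_le_of_ae_abs_le {Ω : Type*} [MeasurableSpace Ω] {P : Measure Ω}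
    [IsProbabilityMeasure P] {X : Ω → ℝ} (hX : BddMeas X) (h : ∀ᵐ ω ∂P, |X ω| ≤ β) :
    ∫ ω, X ω ^ 2 ∂P ≤ β ^ 2 := by
  refine (integral_mono_ae (hX.pow 2).integrable (integrable_const (β ^ 2)) ?_).trans (by simp)
  filter_upwards [h] with ω hω
  rw [← sq_abs]
  exact pow_le_pow_left₀ (abs_nonneg _) hω 2

lemma sq_two_div_sub_two_le (hn : 4 ≤ n) : (2 / ((n : ℝ) - 2)) ^ 2 ≤ 16 / (n : ℝ) ^ 2 := by
  have : (4 : ℝ) ≤ n := by exact_mod_cast hn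
  rw [div_pow, div_le_div_iff₀ (by nlinarith) (by nlinarith)]
  nlinarith

lemma sq_two_div_sub_one_le (hn : 4 ≤ n) : (2 / ((n : ℝ) - 1)) ^ 2 ≤ 16 / (n : ℝ) ^ 2 := by
  have : (4 : ℝ) ≤ n := by exact_mod_cast hn
  rw [div_pow, div_le_div_iff₀ (by nlinarith) (by nlinarith)]
  nlinarith

lemma sq_two_div_mul_le (hn : 4 ≤ n) :
    (2 / (((n : ℝ) - 1) * ((n : ℝ) - 2))) ^ 2 ≤ 64 / (n : ℝ) ^ 4 := by
  have h4 : (4 : ℝ) ≤ n := by exact_mod_cast hn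
  have h : ((n : ℝ) ^ 2) ^ 2 ≤ (4 * (((n : ℝ) - 1) * ((n : ℝ) - 2))) ^ 2 :=
    pow_le_pow_left₀ (by positivity) (by nlinarith) 2
  have hpos : 0 < ((n : ℝ) - 1) * ((n : ℝ) - 2) := by nlinarith
  rw [div_pow, div_le_div_iff₀ (by positivity) (by positivity)]
  nlinarith

lemma integral_vertexRem_sq_le (hy : IsDyadicKernel ρ y b B) (hξ : BddMeas ξ)
    (hβ : ∀ᵐ u ∂ρ, |biasTerm ρ y θ ξ u| ≤ β) (hn : 4 ≤ n) {i : ℕ} (hi : i < n) :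
    ∫ ω, vertexRem ρ y θ ξ n ω i ^ 2 ∂(shockLaw ρ) ≤
      2 * β ^ 2 + 256 * B ^ 2 / n + 256 * (2 * (b * B) + 8 * B ^ 2) / n ^ 2 := by
  have h0 := (sub_ne_zero_of_four_le hn).1
  have h := integral_add_sq_le ((bddMeas_biasTerm (θ := θ) hy hξ).comp (by fun_prop :
      Measurable fun ω : (ℕ → E) × (ℕ × ℕ → E) => ω.1 i))
    (((BddMeas.row hy.bddMeas_interaction_pair n i).const_mul (2 / ((n : ℝ) - 2))).add
      ((BddMeas.tot hy.bddMeas_residual n).const_mul (-(2 / (((n : ℝ) - 1) * ((n : ℝ) - 2))))))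
    (integral_sq_le_of_ae_abs_le ((bddMeas_biasTerm hy hξ).comp (by fun_prop))
      (isIID_vertex.ae_vertex i hβ))
    (integral_add_sq_le ((BddMeas.row hy.bddMeas_interaction_pair n i).const_mul _)
      ((BddMeas.tot hy.bddMeas_residual n).const_mul _)
      (integral_const_mul_sq_le (sq_two_div_sub_two_le hn) (hy.integral_row_interaction_sq_le hi))
      (integral_const_mul_sq_le ((neg_sq _).le.trans (sq_two_div_mul_le hn))
        (hy.integral_tot_residual_sq_le n)))
  refine h.trans (le_of_eq ?_)
  field_simp
  ring

lemma integral_edgeRem_sq_le (hy : IsDyadicKernel ρ y b B) (hn : 4 ≤ n) {p : ℕ × ℕ}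
    (hp : p ∈ pairs (Finset.range n)) :
    ∫ ω, edgeRem ρ y n ω p ^ 2 ∂(shockLaw ρ) ≤
      16 / n ^ 2 * (8 * B ^ 2 + 128 * (2 * (b * B) + 8 * B ^ 2) / n) := by
  have hn4 : (4 : ℝ) ≤ n := by exact_mod_cast hn
  have h0 := (sub_ne_zero_of_four_le hn).1
  obtain ⟨hp1, hp2, hlt⟩ := mem_pairs_range.1 hp
  have hs : 0 ≤ 2 * (b * B) + 8 * B ^ 2 := by
    have := hy.noiseBound_nonneg; positivity
  have hc : (-(1 / ((n : ℝ) - 2))) ^ 2 ≤ 4 / (n : ℝ) ^ 2 := by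
    have := sq_two_div_sub_two_le hn
    rw [neg_sq]
    have h1 : (1 / ((n : ℝ) - 2)) ^ 2 = (2 / ((n : ℝ) - 2)) ^ 2 / 4 := by ring
    have h2 : 4 / (n : ℝ) ^ 2 = 16 / (n : ℝ) ^ 2 / 4 := by ring
    rw [h1, h2]
    linarith
  refine integral_const_mul_sq_le (sq_two_div_sub_one_le hn) ?_
  refine (integral_add_sq_le (hy.bddMeas_interaction_pair p)
    ((((BddMeas.row hy.bddMeas_residual n _).add (BddMeas.row hy.bddMeas_residual n _)).const_mul
      _).add ((BddMeas.tot hy.bddMeas_residual n).const_mul _))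
    (hy.integral_interaction_sq_le hlt) (integral_add_sq_le (((BddMeas.row hy.bddMeas_residual n
      _).add (BddMeas.row hy.bddMeas_residual n _)).const_mul _)
      ((BddMeas.tot hy.bddMeas_residual n).const_mul _)
      (integral_const_mul_sq_le hc (integral_add_sq_le (BddMeas.row hy.bddMeas_residual n _)
        (BddMeas.row hy.bddMeas_residual n _) (hy.integral_row_residual_sq_le hp1)
        (hy.integral_row_residual_sq_le hp2)))
      (integral_const_mul_sq_le (sq_two_div_mul_le hn)
        (hy.integral_tot_residual_sq_le n)))).trans ?_
  have h1 : 64 / (n : ℝ) ^ 4 * (n ^ 2 * (2 * (b * B) + 8 * B ^ 2)) ≤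
      16 * (2 * (b * B) + 8 * B ^ 2) / n := by
    have : 64 / (n : ℝ) ^ 4 * (n ^ 2 * (2 * (b * B) + 8 * B ^ 2)) =
        16 * (2 * (b * B) + 8 * B ^ 2) / n * (4 / n) := by field_simp; ring
    rw [this]
    exact mul_le_of_le_one_right (by positivity) ((div_le_one (by linarith)).2 hn4)
  have h2 : 4 / (n : ℝ) ^ 2 * (2 * (n * (2 * (b * B) + 8 * B ^ 2) +
      n * (2 * (b * B) + 8 * B ^ 2))) = 16 * (2 * (b * B) + 8 * B ^ 2) / n := by field_simp; ring
  rw [h2]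
  have h3 : 128 * (2 * (b * B) + 8 * B ^ 2) / n = 8 * (16 * (2 * (b * B) + 8 * B ^ 2) / n) := by
    ring
  rw [h3]
  linarith

/-- The interaction terms are orthogonal, so their sum is of order `n` only; the bias terms
add up. -/
lemma integral_sumRem_sq_le (hy : IsDyadicKernel ρ y b B) (hξ : BddMeas ξ)
    (hβ : ∀ᵐ u ∂ρ, |biasTerm ρ y θ ξ u| ≤ β) (hn : 4 ≤ n) :
    ∫ ω, sumRem ρ y θ ξ n ω ^ 2 ∂(shockLaw ρ) ≤ 2 * (n * β) ^ 2 + 128 * B ^ 2 := by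
  have h0 := (sub_ne_zero_of_four_le hn).1
  have hm : BddMeas fun ω : (ℕ → E) × (ℕ × ℕ → E) =>
      ∑ i ∈ Finset.range n, biasTerm ρ y θ ξ (ω.1 i) :=
    BddMeas.sum fun i _ => (bddMeas_biasTerm hy hξ).comp (by fun_prop)
  refine (integral_add_sq_le hm ((BddMeas.tot hy.bddMeas_interaction_pair n).const_mul _)
    (integral_sq_le_of_ae_abs_le hm (β := n * β) ?_)
    (integral_const_mul_sq_le (sq_two_div_sub_one_le hn)
      (hy.integral_tot_interaction_sq_le n))).trans (le_of_eq ?_)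
  · filter_upwards [ae_all_iff.2 fun i => isIID_vertex.ae_vertex i hβ] with ω hω
    refine (Finset.abs_sum_le_sum_abs _ _).trans ((Finset.sum_le_sum fun i _ => hω i).trans ?_)
    simp
  · field_simp
    ring

end Remainders

/-! ### Bandwidth limits -/

namespace BandwidthAssumption

variable {h : ℕ → ℝ}

lemma tendsto_inv_mul (hh : BandwidthAssumption h) :
    Tendsto (fun n : ℕ => 1 / ((n : ℝ) * h n)) atTop (𝓝 0) := by
  simp only [one_div]
  exact hh.mul_tendsto.inv_tendsto_atTop

lemma tendsto_inv_sq_mul (hh : BandwidthAssumption h) :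
    Tendsto (fun n : ℕ => 1 / ((n : ℝ) ^ 2 * h n)) atTop (𝓝 0) := by
  have := hh.tendsto_inv_mul.mul (tendsto_one_div_atTop_nhds_zero_nat (𝕜 := ℝ))
  rw [zero_mul] at this
  exact this.congr fun n => by ring

/-- The square of the condition `n h ^ (5 / 2) → 0`. -/
lemma tendsto_sq_mul_pow (hh : BandwidthAssumption h) :
    Tendsto (fun n : ℕ => (n : ℝ) ^ 2 * h n ^ 5) atTop (𝓝 0) := by
  have := hh.mul_rpow_tendsto.pow 2
  rw [zero_pow two_ne_zero] at this
  refine this.congr fun n => ?_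
  rw [mul_pow, ← Real.rpow_natCast (h n ^ (5 / 2 : ℝ)) 2, ← Real.rpow_mul (hh.pos n).le]
  norm_num

lemma tendsto_mul_pow_four (hh : BandwidthAssumption h) :
    Tendsto (fun n : ℕ => (n : ℝ) * h n ^ 4) atTop (𝓝 0) := by
  have h2 : Tendsto (fun n => h n ^ (3 / 2 : ℝ)) atTop (𝓝 0) := by
    have := hh.tendsto_zero.rpow_const (p := (3 / 2 : ℝ)) (Or.inr (by norm_num))
    rwa [Real.zero_rpow (by norm_num)] at this
  have := hh.mul_rpow_tendsto.mul h2
  rw [zero_mul] at this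
  refine this.congr fun n => ?_
  rw [mul_assoc, ← Real.rpow_add (hh.pos n), ← Real.rpow_natCast (h n) 4]
  norm_num

end BandwidthAssumption

/-! ### Perturbation of sums of squares -/

/-- Adding terms which are negligible in mean square does not affect the limit of a normalized sum
of squares. -/
lemma tendsto_sum_add_sq {ι κ : Type*} {l : Filter ι} {A : ι → Finset κ} {a r : ι → κ → ℝ}
    {k : ι → ℝ} {d : ℝ} (hk : ∀ᶠ q in l, 0 ≤ k q)
    (ha : Tendsto (fun q => k q * ∑ i ∈ A q, a q i ^ 2) l (𝓝 d))
    (hr : Tendsto (fun q => k q * ∑ i ∈ A q, r q i ^ 2) l (𝓝 0)) :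
    Tendsto (fun q => k q * ∑ i ∈ A q, (a q i + r q i) ^ 2) l (𝓝 d) := by
  have hcross : Tendsto (fun q => k q * ∑ i ∈ A q, a q i * r q i) l (𝓝 0) := by
    have hlim : Tendsto (fun q => √((k q * ∑ i ∈ A q, a q i ^ 2) *
        (k q * ∑ i ∈ A q, r q i ^ 2))) l (𝓝 0) := by simpa using (ha.mul hr).sqrt
    refine squeeze_zero_norm' ?_ hlim
    filter_upwards [hk] with q hq
    refine Real.abs_le_sqrt ?_
    rw [mul_pow]
    have := Finset.sum_mul_sq_le_sq_mul_sq (A q) (a q) (r q)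
    nlinarith [mul_le_mul_of_nonneg_left this (sq_nonneg (k q))]
  have := (ha.add (hcross.const_mul 2)).add hr
  rw [mul_zero, add_zero, add_zero] at this
  refine this.congr fun q => ?_
  simp only [add_sq, Finset.sum_add_distrib, mul_assoc, ← Finset.mul_sum]
  ring

lemma integral_sum_sq_le_card_mul {Ω κ : Type*} [MeasurableSpace Ω] {P : Measure Ω}
    [IsFiniteMeasure P] {X : κ → Ω → ℝ} {A : Finset κ} {N c : ℝ} (hX : ∀ i, BddMeas (X i))
    (h : ∀ i ∈ A, ∫ ω, X i ω ^ 2 ∂P ≤ c) (hc : 0 ≤ c) (hN : (A.card : ℝ) ≤ N) :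
    ∫ ω, ∑ i ∈ A, X i ω ^ 2 ∂P ≤ N * c := by
  rw [integral_finsetSum _ fun i _ => ((hX i).pow 2).integrable]
  refine (Finset.sum_le_sum h).trans ?_
  rw [Finset.sum_const, nsmul_eq_mul]
  exact mul_le_mul_of_nonneg_right hN hc

/-- Normalized sums of squares which are small in mean tend to zero in probability. -/
lemma tendsto_sum_sq_zero {Ω κ : Type*} [MeasurableSpace Ω] {P : Measure Ω}
    [IsFiniteMeasure P] {X : ℕ → κ → Ω → ℝ} {A : ℕ → Finset κ} {k N c : ℕ → ℝ}
    (hk : ∀ᶠ n in atTop, 0 ≤ k n) (hX : ∀ᶠ n in atTop, ∀ i, BddMeas (X n i))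
    (h : ∀ᶠ n in atTop, ∀ i ∈ A n, ∫ ω, X n i ω ^ 2 ∂P ≤ c n) (hc : ∀ᶠ n in atTop, 0 ≤ c n)
    (hN : ∀ᶠ n in atTop, ((A n).card : ℝ) ≤ N n)
    (hlim : Tendsto (fun n => k n * (N n * c n)) atTop (𝓝 0)) :
    Tendsto (fun q : ℕ × Ω => k q.1 * ∑ i ∈ A q.1, X q.1 i q.2 ^ 2) (probFilter P) (𝓝 0) := by
  refine tendsto_probFilter_zero_of_integral_abs_le
    (X := fun n ω => k n * ∑ i ∈ A n, X n i ω ^ 2) ?_ ?_ hlim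
  · filter_upwards [hX] with n hX
    exact ((BddMeas.sum fun i _ => (hX i).pow 2).const_mul _).integrable
  · filter_upwards [hX, hk, h, hc, hN] with n hX hk h hc hN
    have : ∀ ω, |k n * ∑ i ∈ A n, X n i ω ^ 2| = k n * ∑ i ∈ A n, X n i ω ^ 2 := fun ω =>
      abs_of_nonneg (mul_nonneg hk (Finset.sum_nonneg fun i _ => sq_nonneg _))
    simp only [this]
    rw [integral_const_mul]
    exact mul_le_mul_of_nonneg_left (integral_sum_sq_le_card_mul hX h hc hN) hk

/-! ### Arrays localized by a bandwidth -/

section LocalArray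

variable {E : Type*} [MeasurableSpace E]

/-- Kernels `y n` localized at the scale `h n` around a point, for which the conditional means
given a vertex are `θ + ξ` up to a bias of order `h n ^ 2`, while the second moment is
asymptotically `κ / h n`. -/
structure IsLocalArray (ρ : Measure E) (y : ℕ → E × E × E → ℝ) (h : ℕ → ℝ) (θ : ℝ) (ξ : E → ℝ)
    (κ B : ℝ) : Prop where
  bandwidth : BandwidthAssumption h
  measurable : ∀ n, Measurable (y n)
  kernel : ∀ᶠ n in atTop, IsDyadicKernel ρ (y n) (B / h n) B
  bias : ∀ᶠ n in atTop, ∀ᵐ u ∂ρ, |vertexMean ρ (y n) u - θ - ξ u| ≤ B * h n ^ 2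
  tendsto_sq : Tendsto
    (fun n => h n * ∫ z, ∫ w, y n (z.1, z.2, w) ^ 2 ∂ρ ∂(ρ.prod ρ)) atTop (𝓝 κ)
  pos : 0 < κ
  score_bddMeas : BddMeas ξ
  integral_score : ∫ u, ξ u ∂ρ = 0

namespace IsLocalArray

variable {ρ : Measure E} [IsProbabilityMeasure ρ] {y : ℕ → E × E × E → ℝ} {h : ℕ → ℝ} {θ : ℝ}
  {ξ : E → ℝ} {κ B : ℝ}

lemma bound_nonneg (H : IsLocalArray ρ y h θ ξ κ B) : 0 ≤ B := by
  obtain ⟨n, hn⟩ := H.kernel.exists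
  exact hn.meanBound_nonneg

/-- The bias of the total mean is the average of the biases of the vertex means, because `ξ` is
centered. -/
lemma biasTerm_le (H : IsLocalArray ρ y h θ ξ κ B) :
    ∀ᶠ n in atTop, ∀ᵐ u ∂ρ, |biasTerm ρ (y n) θ ξ u| ≤ 3 * (B * h n ^ 2) := by
  filter_upwards [H.kernel, H.bias] with n hy hb
  have hm : totalMean ρ (y n) - θ = ∫ u, (vertexMean ρ (y n) u - θ - ξ u) ∂ρ := by
    rw [integral_sub (hy.bddMeas_vertexMean.sub (BddMeas.const θ)).integrable
      H.score_bddMeas.integrable, integral_sub hy.bddMeas_vertexMean.integrable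
      (integrable_const _), H.integral_score]
    simp [totalMean]
  have hm' : |totalMean ρ (y n) - θ| ≤ B * h n ^ 2 := by
    rw [hm]
    simpa using norm_integral_le_of_norm_le_const (μ := ρ)
      (f := fun u => vertexMean ρ (y n) u - θ - ξ u) (C := B * h n ^ 2) hb
  filter_upwards [hb] with u hu
  rw [biasTerm]
  refine (abs_sub _ _).trans ?_
  rw [abs_mul, abs_two]
  linarith

/-- A normalization of the pseudo values under which the remainders vanish. -/
structure IsNormalization (h c : ℕ → ℝ) : Prop where
  tendsto_sq : Tendsto (fun n => c n ^ 2) atTop (𝓝 0)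
  tendsto_bias : Tendsto (fun n : ℕ => c n ^ 2 * ((n : ℝ) ^ 2 * h n ^ 4)) atTop (𝓝 0)

variable {c : ℕ → ℝ}

lemma tendsto_vertexRem (H : IsLocalArray ρ y h θ ξ κ B) (hc : IsNormalization h c) :
    Tendsto (fun q : ℕ × ((ℕ → E) × (ℕ × ℕ → E)) => c q.1 ^ 2 *
      ∑ i ∈ Finset.range q.1, vertexRem ρ (y q.1) θ ξ q.1 q.2 i ^ 2)
      (probFilter (shockLaw ρ)) (𝓝 0) := by
  refine tendsto_sum_sq_zero (P := shockLaw ρ) (A := fun n => Finset.range n)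
    (k := fun n => c n ^ 2) (X := fun n i ω => vertexRem ρ (y n) θ ξ n ω i)
    (N := fun n => n) (c := fun n => 2 * (3 * (B * h n ^ 2)) ^ 2 + 256 * B ^ 2 / n +
      256 * (2 * (B / h n * B) + 8 * B ^ 2) / n ^ 2)
    (Eventually.of_forall fun n => sq_nonneg _) ?_ ?_ ?_ ?_ ?_
  · filter_upwards [H.kernel] with n hy i using bddMeas_vertexRem hy H.score_bddMeas i
  · filter_upwards [H.kernel, H.biasTerm_le, eventually_ge_atTop 4] with n hy hb hn i hi
    exact integral_vertexRem_sq_le hy H.score_bddMeas hb hn (Finset.mem_range.1 hi)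
  · have := H.bound_nonneg
    exact Eventually.of_forall fun n => by have := H.bandwidth.pos n; positivity
  · exact Eventually.of_forall fun n => by simp
  · have h1 : Tendsto (fun n : ℕ => 1 / (n : ℝ)) atTop (𝓝 0) :=
      tendsto_one_div_atTop_nhds_zero_nat
    have := (((hc.tendsto_bias.mul h1).const_mul (18 * B ^ 2)).add
      (hc.tendsto_sq.const_mul (256 * B ^ 2))).add
      (((hc.tendsto_sq.mul H.bandwidth.tendsto_inv_mul).const_mul (512 * B ^ 2)).add
        ((hc.tendsto_sq.mul h1).const_mul (2048 * B ^ 2)))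
    simp only [mul_zero, add_zero] at this
    refine this.congr' ?_
    filter_upwards [eventually_gt_atTop 0] with n hn
    have h0 : (n : ℝ) ≠ 0 := by exact_mod_cast hn.ne'
    have := (H.bandwidth.pos n).ne'
    field_simp
    ring

lemma tendsto_edgeRem (H : IsLocalArray ρ y h θ ξ κ B) (hc : IsNormalization h c) :
    Tendsto (fun q : ℕ × ((ℕ → E) × (ℕ × ℕ → E)) => c q.1 ^ 2 *
      ∑ p ∈ pairs (Finset.range q.1), edgeRem ρ (y q.1) q.1 q.2 p ^ 2)
      (probFilter (shockLaw ρ)) (𝓝 0) := by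
  refine tendsto_sum_sq_zero (P := shockLaw ρ)
    (A := fun n => pairs (Finset.range n)) (k := fun n => c n ^ 2)
    (X := fun n p ω => edgeRem ρ (y n) n ω p)
    (N := fun n => n ^ 2) (c := fun n => 16 / n ^ 2 *
      (8 * B ^ 2 + 128 * (2 * (B / h n * B) + 8 * B ^ 2) / n))
    (Eventually.of_forall fun n => sq_nonneg _) ?_ ?_ ?_ ?_ ?_
  · filter_upwards [H.kernel] with n hy i using bddMeas_edgeRem hy i
  · filter_upwards [H.kernel, eventually_ge_atTop 4] with n hy hn p hp
    exact integral_edgeRem_sq_le hy hn hp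
  · have := H.bound_nonneg
    exact Eventually.of_forall fun n => by have := H.bandwidth.pos n; positivity
  · exact Eventually.of_forall fun n => card_pairs_range_le n
  · have h1 : Tendsto (fun n : ℕ => 1 / (n : ℝ)) atTop (𝓝 0) :=
      tendsto_one_div_atTop_nhds_zero_nat
    have := (hc.tendsto_sq.const_mul (128 * B ^ 2)).add
      (((hc.tendsto_sq.mul H.bandwidth.tendsto_inv_mul).const_mul (4096 * B ^ 2)).add
        ((hc.tendsto_sq.mul h1).const_mul (16384 * B ^ 2)))
    simp only [mul_zero, add_zero] at this
    refine this.congr' ?_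
    filter_upwards [eventually_gt_atTop 0] with n hn
    have h0 : (n : ℝ) ≠ 0 := by exact_mod_cast hn.ne'
    have := (H.bandwidth.pos n).ne'
    field_simp
    ring

lemma tendsto_sumRem (H : IsLocalArray ρ y h θ ξ κ B) (hc : IsNormalization h c) :
    Tendsto (fun q : ℕ × ((ℕ → E) × (ℕ × ℕ → E)) => c q.1 * sumRem ρ (y q.1) θ ξ q.1 q.2)
      (probFilter (shockLaw ρ)) (𝓝 0) := by
  refine tendsto_probFilter_zero_of_integral_sq_le
    (X := fun n ω => c n * sumRem ρ (y n) θ ξ n ω)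
    (b := fun n => c n ^ 2 * (2 * (n * (3 * (B * h n ^ 2))) ^ 2 + 128 * B ^ 2)) ?_ ?_ ?_
  · filter_upwards [H.kernel] with n hy using (bddMeas_sumRem hy H.score_bddMeas).const_mul _
  · filter_upwards [H.kernel, H.biasTerm_le, eventually_ge_atTop 4] with n hy hb hn
    exact integral_const_mul_sq_le le_rfl (integral_sumRem_sq_le hy H.score_bddMeas hb hn)
  · have := (hc.tendsto_bias.const_mul (18 * B ^ 2)).add (hc.tendsto_sq.const_mul (128 * B ^ 2))
    simp only [mul_zero, add_zero] at this
    exact this.congr fun n => by ring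

/-! ### The noise -/

/-- The conditional means are bounded, so the localized second moment is asymptotically all
noise. -/
lemma tendsto_mul_integral_edgeVar (H : IsLocalArray ρ y h θ ξ κ B) :
    Tendsto (fun n => h n * ∫ z, edgeVar ρ (y n) z ∂(ρ.prod ρ)) atTop (𝓝 κ) := by
  have h0 : Tendsto (fun n => h n * ∫ z, edgeMean ρ (y n) z ^ 2 ∂(ρ.prod ρ)) atTop (𝓝 0) := by
    have hlim : Tendsto (fun n => h n * B ^ 2) atTop (𝓝 0) := by
      simpa using H.bandwidth.tendsto_zero.mul_const (B ^ 2)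
    refine squeeze_zero' (Eventually.of_forall fun n => mul_nonneg (H.bandwidth.pos n).le
      (integral_nonneg fun _ => sq_nonneg _)) ?_ hlim
    filter_upwards [H.kernel] with n hy
    refine mul_le_mul_of_nonneg_left (integral_sq_le_of_ae_abs_le hy.bddMeas_edgeMean ?_)
      (H.bandwidth.pos n).le
    filter_upwards [hy.edgeMean_le] with z hz
    rwa [abs_of_nonneg (hy.edgeMean_nonneg z)]
  have := H.tendsto_sq.sub h0
  rw [sub_zero] at this
  refine this.congr' ?_
  filter_upwards [H.kernel] with n hy
  have hint : Integrable (fun z : E × E => ∫ w, y n (z.1, z.2, w) ^ 2 ∂ρ) (ρ.prod ρ) :=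
    (BddMeas.integral_right (Z := fun t : (E × E) × E => y n (t.1.1, t.1.2, t.2) ^ 2)
      ((hy.bddMeas.comp (by fun_prop)).pow 2)).integrable
  rw [← mul_sub, ← integral_sub hint (hy.bddMeas_edgeMean.pow 2).integrable]
  simp only [hy.edgeVar_eq]

/-- The variance of the noise, averaged over the pairs, settles down. -/
lemma tendsto_tot_edgeVar (H : IsLocalArray ρ y h θ ξ κ B) :
    Tendsto (fun q : ℕ × ((ℕ → E) × (ℕ × ℕ → E)) => h q.1 / (q.1 : ℝ) ^ 2 *
      tot (fun p => edgeVar ρ (y q.1) (q.2.1 p.1, q.2.1 p.2)) q.1)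
      (probFilter (shockLaw ρ)) (𝓝 (κ / 2)) := by
  have hmean : Tendsto (fun n : ℕ => h n / (n : ℝ) ^ 2 *
      ((pairs (Finset.range n)).card * ∫ z, edgeVar ρ (y n) z ∂(ρ.prod ρ))) atTop (𝓝 (κ / 2)) := by
    have h1 : Tendsto (fun n : ℕ => (1 - 1 / (n : ℝ)) / 2) atTop (𝓝 ((1 - 0) / 2)) :=
      ((tendsto_one_div_atTop_nhds_zero_nat (𝕜 := ℝ)).const_sub 1).div_const 2
    have := h1.mul H.tendsto_mul_integral_edgeVar
    rw [show (1 - 0) / 2 * κ = κ / 2 by ring] at this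
    refine this.congr' ?_
    filter_upwards [eventually_gt_atTop 0] with n hn
    have h0 : (n : ℝ) ≠ 0 := by exact_mod_cast hn.ne'
    rw [card_pairs_range]
    field_simp
  have hdev := tendsto_probFilter_zero_of_integral_sq_le (P := shockLaw ρ)
    (X := fun n ω => h n / (n : ℝ) ^ 2 * (tot (fun p => edgeVar ρ (y n) (ω.1 p.1, ω.1 p.2)) n -
      (pairs (Finset.range n)).card * ∫ z, edgeVar ρ (y n) z ∂(ρ.prod ρ)))
    (b := fun n => (h n / (n : ℝ) ^ 2) ^ 2 * ((B / h n * B) ^ 2 * n ^ 3)) ?_ ?_ ?_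
  · have := hdev.add (hmean.comp tendsto_fst_probFilter)
    rw [zero_add] at this
    exact this.congr fun q => by simp only [Function.comp]; ring
  · filter_upwards [H.kernel] with n hy
    exact ((BddMeas.tot (fun p => hy.bddMeas_edgeVar.comp (by fun_prop)) n).sub
      (BddMeas.const _)).const_mul _
  · filter_upwards [H.kernel] with n hy
    exact integral_const_mul_sq_le le_rfl (hy.integral_tot_edgeVar_sub_sq_le n)
  · have := (tendsto_one_div_atTop_nhds_zero_nat (𝕜 := ℝ)).const_mul (B ^ 4)
    rw [mul_zero] at this
    refine this.congr' ?_
    filter_upwards [eventually_gt_atTop 0] with n hn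
    have h0 : (n : ℝ) ≠ 0 := by exact_mod_cast hn.ne'
    have := (H.bandwidth.pos n).ne'
    field_simp

lemma tendsto_tot_noise_sq (H : IsLocalArray ρ y h θ ξ κ B) :
    Tendsto (fun q : ℕ × ((ℕ → E) × (ℕ × ℕ → E)) => h q.1 / (q.1 : ℝ) ^ 2 *
      tot (fun p => noise ρ (y q.1) q.2 p ^ 2) q.1) (probFilter (shockLaw ρ)) (𝓝 (κ / 2)) := by
  have hdev := tendsto_probFilter_zero_of_integral_sq_le (P := shockLaw ρ)
    (X := fun n ω => h n / (n : ℝ) ^ 2 * (tot (fun p => noise ρ (y n) ω p ^ 2) n -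
      tot (fun p => edgeVar ρ (y n) (ω.1 p.1, ω.1 p.2)) n))
    (b := fun n => (h n / (n : ℝ) ^ 2) ^ 2 * (n ^ 2 * ((B / h n) ^ 2 * (B / h n * B)))) ?_ ?_ ?_
  · have := hdev.add H.tendsto_tot_edgeVar
    rw [zero_add] at this
    exact this.congr fun q => by ring
  · filter_upwards [H.kernel] with n hy
    exact ((BddMeas.tot (fun p => (hy.bddMeas_noise p).pow 2) n).sub
      (BddMeas.tot (fun p => hy.bddMeas_edgeVar.comp (by fun_prop)) n)).const_mul _
  · filter_upwards [H.kernel] with n hy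
    exact integral_const_mul_sq_le le_rfl (hy.integral_tot_noise_sq_sub_sq_le n)
  · have := H.bandwidth.tendsto_inv_sq_mul.const_mul (B ^ 4)
    rw [mul_zero] at this
    refine this.congr' ?_
    filter_upwards [eventually_gt_atTop 0] with n hn
    have h0 : (n : ℝ) ≠ 0 := by exact_mod_cast hn.ne'
    have := (H.bandwidth.pos n).ne'
    field_simp

/-- Each edge contributes to the sums at both of its end points, so the limit is twice the one of
`tendsto_tot_noise_sq`. -/
lemma tendsto_sum_row_noise_sq (H : IsLocalArray ρ y h θ ξ κ B) :
    Tendsto (fun q : ℕ × ((ℕ → E) × (ℕ × ℕ → E)) => h q.1 / (q.1 : ℝ) ^ 2 *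
      ∑ i ∈ Finset.range q.1, row (noise ρ (y q.1) q.2) q.1 i ^ 2)
      (probFilter (shockLaw ρ)) (𝓝 κ) := by
  have hdev := tendsto_probFilter_zero_of_integral_sq_le (P := shockLaw ρ)
    (X := fun n ω => h n / (n : ℝ) ^ 2 * (∑ i ∈ Finset.range n, row (noise ρ (y n) ω) n i ^ 2 -
      2 * tot (fun p => noise ρ (y n) ω p ^ 2) n))
    (b := fun n => (h n / (n : ℝ) ^ 2) ^ 2 * (4 * (B / h n * B) ^ 2 * n ^ 3)) ?_ ?_ ?_
  · have := hdev.add (H.tendsto_tot_noise_sq.const_mul 2)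
    rw [zero_add, mul_div_cancel₀ κ two_ne_zero] at this
    exact this.congr fun q => by ring
  · filter_upwards [H.kernel] with n hy
    exact ((BddMeas.sum fun i _ => (BddMeas.row hy.bddMeas_noise n i).pow 2).sub
      ((BddMeas.tot (fun p => (hy.bddMeas_noise p).pow 2) n).const_mul _)).const_mul _
  · filter_upwards [H.kernel] with n hy
    exact integral_const_mul_sq_le le_rfl (hy.integral_sum_row_noise_sq_sub_le n)
  · have := (tendsto_one_div_atTop_nhds_zero_nat (𝕜 := ℝ)).const_mul (4 * B ^ 4)
    rw [mul_zero] at this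
    refine this.congr' ?_
    filter_upwards [eventually_gt_atTop 0] with n hn
    have h0 : (n : ℝ) ≠ 0 := by exact_mod_cast hn.ne'
    have := (H.bandwidth.pos n).ne'
    field_simp

lemma tendsto_natCast_div_sub (k : ℝ) :
    Tendsto (fun n : ℕ => (n : ℝ) / ((n : ℝ) - k)) atTop (𝓝 1) := by
  have h1 : Tendsto (fun n : ℕ => (1 - k * (1 / (n : ℝ)))⁻¹) atTop (𝓝 (1 - k * 0)⁻¹) :=
    (((tendsto_one_div_atTop_nhds_zero_nat (𝕜 := ℝ)).const_mul k).const_sub 1).inv₀ (by simp)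
  rw [mul_zero, sub_zero, inv_one] at h1
  refine h1.congr' ?_
  filter_upwards [eventually_gt_atTop 0] with n hn
  have h0 : (n : ℝ) ≠ 0 := by exact_mod_cast hn.ne'
  rw [show 1 - k * (1 / (n : ℝ)) = ((n : ℝ) - k) / n by field_simp, inv_div]

end IsLocalArray

end LocalArray

/-! ### Central limit theorem for the noise -/

/-- Bounded convergence along convergence in probability. -/
lemma tendsto_integral_of_probFilter {Ω : Type*} [MeasurableSpace Ω] {P : Measure Ω}
    [IsProbabilityMeasure P] {X : ℕ → Ω → ℝ} {a C : ℝ}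
    (hX : ∀ᶠ n in atTop, Measurable (X n) ∧ ∀ ω, |X n ω| ≤ C)
    (h : Tendsto (fun q : ℕ × Ω => X q.1 q.2) (probFilter P) (𝓝 a)) :
    Tendsto (fun n => ∫ ω, X n ω ∂P) atTop (𝓝 a) := by
  rw [Metric.tendsto_nhds]
  intro ε hε
  set B : ℕ → Set Ω := fun n => {ω | ¬ dist (X n ω) a < ε / 2} with hB
  have hP : Tendsto (fun n => P.real (B n)) atTop (𝓝 0) := by
    have := eventually_probFilter.1 (Metric.tendsto_nhds.1 h (ε / 2) (half_pos hε))
    exact (ENNReal.tendsto_toReal ENNReal.zero_ne_top).comp this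
  have hP' : Tendsto (fun n => (C + |a|) * P.real (B n)) atTop (𝓝 0) := by
    simpa using hP.const_mul (C + |a|)
  filter_upwards [hX, hP'.eventually_lt_const (half_pos hε)] with n hX hn
  have hBm : MeasurableSet (B n) :=
    (measurableSet_lt (hX.1.dist measurable_const) measurable_const).compl
  have hXi : Integrable (X n) P := integrable_of_abs_le hX.1 hX.2
  have hle : ∀ ω, |X n ω - a| ≤ ε / 2 + (B n).indicator (fun _ => C + |a|) ω := by
    intro ω
    by_cases hω : ω ∈ B n
    · rw [Set.indicator_of_mem hω]
      have := abs_sub (X n ω) a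
      have := hX.2 ω
      linarith
    · rw [Set.indicator_of_notMem hω, add_zero]
      exact (not_not.1 hω).le
  have hI : Integrable (fun ω => (B n).indicator (fun _ => C + |a|) ω) P :=
    (integrable_const _).indicator hBm
  have hsub : ∫ ω, X n ω ∂P - a = ∫ ω, (X n ω - a) ∂P := by
    rw [integral_sub hXi (integrable_const _)]; simp
  rw [Real.dist_eq, hsub]
  refine (abs_integral_le_integral_abs).trans_lt
    ((integral_mono (hXi.sub (integrable_const a)).abs ((integrable_const _).fun_add hI)
      hle).trans_lt ?_)
  rw [integral_add (integrable_const _) hI, integral_indicator_const _ hBm]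
  simp only [integral_const, probReal_univ, smul_eq_mul]
  linarith

section Noise

variable {E : Type*} [MeasurableSpace E] {ρ : Measure E} [IsProbabilityMeasure ρ]

lemma measurable_noise {y : E × E × E → ℝ} (hy : Measurable y) (p : ℕ × ℕ) :
    Measurable fun ω => noise ρ y ω p := by
  have h : Measurable (edgeMean ρ y) :=
    (StronglyMeasurable.integral_prod_right (f := fun (z : E × E) w => y (z.1, z.2, w))
      (hy.comp (by fun_prop : Measurable fun t : (E × E) × E =>
        (t.1.1, t.1.2, t.2))).stronglyMeasurable).measurable
  exact (hy.comp (by fun_prop : Measurable fun ω : (ℕ → E) × (ℕ × ℕ → E) =>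
    (ω.1 p.1, ω.1 p.2, ω.2 p))).sub (h.comp (by fun_prop : Measurable
      fun ω : (ℕ → E) × (ℕ × ℕ → E) => (ω.1 p.1, ω.1 p.2)))

/-- Conditionally on the vertices the total noise is a sum of independent variables, hence its
characteristic function is close to the one of a Gaussian with random variance. -/
lemma IsDyadicKernel.norm_integral_cexp_sub_le {y : E × E × E → ℝ} {b B : ℝ}
    (hy : IsDyadicKernel ρ y b B) (n : ℕ) {s : ℝ} (hs : |s| * b ≤ 1) :
    ‖∫ ω, Complex.exp (s * (tot (noise ρ y ω) n : ℂ) * Complex.I) ∂(shockLaw ρ) -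
      ((∫ ω, Real.exp (-(s ^ 2 * tot (fun p => edgeVar ρ y (ω.1 p.1, ω.1 p.2)) n / 2))
        ∂(shockLaw ρ) : ℝ) : ℂ)‖ ≤
      n ^ 2 * (|s| ^ 3 * b * (b * B) + s ^ 4 * (b * B) ^ 2) := by
  have hb := hy.bound_nonneg
  have hw := hy.noiseBound_nonneg
  have hm1 : Measurable fun ω : (ℕ → E) × (ℕ × ℕ → E) =>
      Complex.exp (s * (tot (noise ρ y ω) n : ℂ) * Complex.I) := by
    have := (BddMeas.tot hy.bddMeas_noise n).1
    fun_prop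
  have hm2 : Measurable fun ω : (ℕ → E) × (ℕ × ℕ → E) =>
      (Real.exp (-(s ^ 2 * tot (fun p => edgeVar ρ y (ω.1 p.1, ω.1 p.2)) n / 2)) : ℂ) := by
    have := (BddMeas.tot (fun p => hy.bddMeas_edgeVar.comp (by fun_prop :
      Measurable fun ω : (ℕ → E) × (ℕ × ℕ → E) => (ω.1 p.1, ω.1 p.2))) n).1
    fun_prop
  have hn1 : ∀ ω : (ℕ → E) × (ℕ × ℕ → E),
      ‖Complex.exp (s * (tot (noise ρ y ω) n : ℂ) * Complex.I)‖ ≤ 1 := fun ω => by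
    rw [← Complex.ofReal_mul, Complex.norm_exp_ofReal_mul_I]
  have hn2 : ∀ ω : (ℕ → E) × (ℕ × ℕ → E),
      ‖(Real.exp (-(s ^ 2 * tot (fun p => edgeVar ρ y (ω.1 p.1, ω.1 p.2)) n / 2)) : ℂ)‖ ≤ 1 := by
    intro ω
    rw [Complex.norm_real, Real.norm_of_nonneg (Real.exp_nonneg _), Real.exp_le_one_iff,
      neg_nonpos]
    have : 0 ≤ tot (fun p => edgeVar ρ y (ω.1 p.1, ω.1 p.2)) n :=
      Finset.sum_nonneg fun p _ => edgeVar_nonneg y _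
    positivity
  have hi1 : Integrable (fun ω : (ℕ → E) × (ℕ × ℕ → E) =>
      Complex.exp (s * (tot (noise ρ y ω) n : ℂ) * Complex.I)) (shockLaw ρ) :=
    Integrable.of_bound hm1.aestronglyMeasurable 1 (ae_of_all _ hn1)
  have hi2 : Integrable (fun ω : (ℕ → E) × (ℕ × ℕ → E) =>
      (Real.exp (-(s ^ 2 * tot (fun p => edgeVar ρ y (ω.1 p.1, ω.1 p.2)) n / 2)) : ℂ))
      (shockLaw ρ) :=
    Integrable.of_bound hm2.aestronglyMeasurable 1 (ae_of_all _ hn2)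
  rw [← integral_complex_ofReal, ← integral_sub hi1 hi2]
  have hi : Integrable (fun ω : (ℕ → E) × (ℕ × ℕ → E) =>
      Complex.exp (s * (tot (noise ρ y ω) n : ℂ) * Complex.I) -
      (Real.exp (-(s ^ 2 * tot (fun p => edgeVar ρ y (ω.1 p.1, ω.1 p.2)) n / 2)) : ℂ))
      (shockLaw ρ) := hi1.sub hi2
  rw [shockLaw] at hi ⊢
  rw [integral_prod _ hi]
  refine (norm_integral_le_of_norm_le_const (C := n ^ 2 * (|s| ^ 3 * b * (b * B) +
    s ^ 4 * (b * B) ^ 2)) ?_).trans (by simp)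
  filter_upwards [ae_infinitePi_pair hy.edgeVar_le n] with u hu
  have hi3 : Integrable (fun w : ℕ × ℕ → E =>
      Complex.exp (s * (tot (noise ρ y (u, w)) n : ℂ) * Complex.I))
      (Measure.infinitePi fun _ => ρ) :=
    Integrable.of_bound (hm1.comp measurable_prodMk_left).aestronglyMeasurable 1
      (ae_of_all _ fun w => hn1 (u, w))
  rw [integral_sub hi3 (integrable_const _)]
  simp only [integral_const, probReal_univ, one_smul]
  refine ((hy.isCenteredArray u).norm_integral_cexp_sub_le (pairs (Finset.range n)) hs hu).trans ?_
  exact mul_le_mul_of_nonneg_right (card_pairs_range_le n) (by positivity)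

lemma charFun_gaussianReal_map_mul {κ : ℝ} (hκ : 0 < κ) (t : ℝ) :
    charFun ((gaussianReal 0 1).map fun z : ℝ => √(2 * κ) * z) t =
      (Real.exp (-(t ^ 2 * κ)) : ℂ) := by
  have h2 : ((√(2 * κ) : ℝ) : ℂ) ^ 2 = 2 * κ := by
    rw [← Complex.ofReal_pow, Real.sq_sqrt (by positivity)]; simp
  rw [gaussianReal_map_const_mul (μ := 0) (v := 1) (√(2 * κ)), charFun_gaussianReal]
  push_cast
  congr 1
  simp only [mul_zero, zero_mul, zero_sub, mul_one, h2]
  ring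

/-- The normalization of the total noise. -/
def noiseScale (h : ℕ → ℝ) (n : ℕ) : ℝ := √(h n) * (2 / ((n : ℝ) - 1))

lemma BandwidthAssumption.tendsto_noiseScale_div {h : ℕ → ℝ} (hh : BandwidthAssumption h) :
    Tendsto (fun n : ℕ => noiseScale h n / h n) atTop (𝓝 0) := by
  have hsq : Tendsto (fun n : ℕ => √(1 / ((n : ℝ) * ((n : ℝ) * h n)))) atTop (𝓝 0) := by
    have := ((tendsto_one_div_atTop_nhds_zero_nat (𝕜 := ℝ)).mul
      hh.tendsto_inv_mul).sqrt
    simpa [mul_comm] using this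
  have := (hsq.mul (IsLocalArray.tendsto_natCast_div_sub 1)).const_mul 2
  simp only [zero_mul, mul_zero] at this
  refine this.congr' ?_
  filter_upwards [eventually_gt_atTop 1] with n hn
  have hn' : (1 : ℝ) < n := by exact_mod_cast hn
  have hpos := hh.pos n
  have hs := Real.sqrt_pos.2 hpos
  have e : √(1 / ((n : ℝ) * ((n : ℝ) * h n))) = 1 / (n * √(h n)) := by
    rw [Real.sqrt_div zero_le_one, Real.sqrt_one, ← mul_assoc,
      Real.sqrt_mul (by positivity), Real.sqrt_mul_self (by positivity)]
  have e2 : h n = √(h n) * √(h n) := (Real.mul_self_sqrt hpos.le).symm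
  have hne : (n : ℝ) - 1 ≠ 0 := by linarith
  rw [e, noiseScale]
  generalize √(h n) = s at hs e2
  rw [e2]
  field_simp

lemma BandwidthAssumption.tendsto_noiseScale_sq {h : ℕ → ℝ} (hh : BandwidthAssumption h) :
    Tendsto (fun n : ℕ => (n : ℝ) ^ 2 * noiseScale h n ^ 2 / h n) atTop (𝓝 4) := by
  have := ((IsLocalArray.tendsto_natCast_div_sub 1).pow 2).const_mul 4
  simp only [one_pow, mul_one] at this
  refine this.congr fun n => ?_
  have hpos := hh.pos n
  simp only [noiseScale, mul_pow, Real.sq_sqrt hpos.le]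
  field_simp
  ring

namespace IsLocalArray

variable {y : ℕ → E × E × E → ℝ} {h : ℕ → ℝ} {θ : ℝ} {ξ : E → ℝ} {κ B : ℝ}

lemma tendsto_integral_cexp_tot_noise (H : IsLocalArray ρ y h θ ξ κ B) (t : ℝ) :
    Tendsto (fun n => ∫ ω, Complex.exp ((t * noiseScale h n : ℝ) *
      (tot (noise ρ (y n) ω) n : ℂ) * Complex.I) ∂(shockLaw ρ)) atTop
      (𝓝 (Real.exp (-(t ^ 2 * κ)) : ℂ)) := by
  have h1 := H.bandwidth.tendsto_noiseScale_div
  have h2 := H.bandwidth.tendsto_noiseScale_sq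
  generalize noiseScale h = a at h1 h2 ⊢
  -- the error in the Gaussian approximation
  have herr : Tendsto (fun n : ℕ => (n : ℝ) ^ 2 * (|t * a n| ^ 3 * (B / h n) * (B / h n * B) +
      (t * a n) ^ 4 * (B / h n * B) ^ 2)) atTop (𝓝 0) := by
    have := (((h2.mul h1.abs).const_mul (|t| ^ 3 * B ^ 3)).add
      ((h2.mul ((h1.pow 2).mul H.bandwidth.tendsto_zero)).const_mul (t ^ 4 * B ^ 4)))
    simp only [abs_zero, mul_zero, add_zero] at this
    refine this.congr fun n => ?_
    have hh := H.bandwidth.pos n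
    rw [abs_div, abs_of_pos hh, abs_mul, mul_pow |t|, pow_succ |a n| 2, sq_abs]
    field_simp
  -- the variance of the conditionally Gaussian approximation
  have hvar : Tendsto (fun q : ℕ × ((ℕ → E) × (ℕ × ℕ → E)) => Real.exp (-((t * a q.1) ^ 2 *
      tot (fun p => edgeVar ρ (y q.1) (q.2.1 p.1, q.2.1 p.2)) q.1 / 2)))
      (probFilter (shockLaw ρ)) (𝓝 (Real.exp (-(t ^ 2 * κ)))) := by
    refine (Real.continuous_exp.tendsto _).comp ?_
    have := (((h2.comp tendsto_fst_probFilter).mul H.tendsto_tot_edgeVar).const_mul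
      (t ^ 2 / 2)).neg
    rw [show -(t ^ 2 / 2 * (4 * (κ / 2))) = -(t ^ 2 * κ) by ring] at this
    refine this.congr' ?_
    filter_upwards [tendsto_fst_probFilter.eventually (eventually_gt_atTop 0)] with q hq
    have h0 : (q.1 : ℝ) ≠ 0 := by exact_mod_cast hq.ne'
    have hh := H.bandwidth.pos q.1
    simp only [Function.comp]
    field_simp
  have hgauss : Tendsto (fun n => ∫ ω, Real.exp (-((t * a n) ^ 2 *
      tot (fun p => edgeVar ρ (y n) (ω.1 p.1, ω.1 p.2)) n / 2)) ∂(shockLaw ρ)) atTop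
      (𝓝 (Real.exp (-(t ^ 2 * κ)))) := by
    refine tendsto_integral_of_probFilter (P := shockLaw ρ) (C := 1) ?_ hvar
    filter_upwards [H.kernel] with n hy
    refine ⟨?_, fun ω => ?_⟩
    · have := (BddMeas.tot (fun p => hy.bddMeas_edgeVar.comp (by fun_prop :
        Measurable fun ω : (ℕ → E) × (ℕ × ℕ → E) => (ω.1 p.1, ω.1 p.2))) n).1
      fun_prop
    · rw [abs_of_nonneg (Real.exp_nonneg _), Real.exp_le_one_iff, neg_nonpos]
      have : 0 ≤ tot (fun p => edgeVar ρ (y n) (ω.1 p.1, ω.1 p.2)) n :=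
        Finset.sum_nonneg fun p _ => edgeVar_nonneg _ _
      positivity
  have hsmall : Tendsto (fun n => |t * a n| * (B / h n)) atTop (𝓝 0) := by
    have := h1.abs.const_mul (|t| * B)
    rw [abs_zero, mul_zero] at this
    refine this.congr fun n => ?_
    rw [abs_div, abs_of_pos (H.bandwidth.pos n), abs_mul]
    ring
  have hdiff := squeeze_zero_norm' (a := fun n : ℕ => (n : ℝ) ^ 2 * (|t * a n| ^ 3 * (B / h n) *
    (B / h n * B) + (t * a n) ^ 4 * (B / h n * B) ^ 2)) (t₀ := atTop)
    (f := fun n => ∫ ω, Complex.exp ((t * a n : ℝ) * (tot (noise ρ (y n) ω) n : ℂ) * Complex.I)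
      ∂(shockLaw ρ) - ((∫ ω, Real.exp (-((t * a n) ^ 2 *
        tot (fun p => edgeVar ρ (y n) (ω.1 p.1, ω.1 p.2)) n / 2)) ∂(shockLaw ρ) : ℝ) : ℂ)) ?_ herr
  · have := hdiff.add ((Complex.continuous_ofReal.tendsto _).comp hgauss)
    rw [zero_add] at this
    exact this.congr fun n => sub_add_cancel _ _
  · filter_upwards [H.kernel, hsmall.eventually_le_const one_pos] with n hy hn
    exact hy.norm_integral_cexp_sub_le n hn

/-- The central limit theorem for the noise. -/
theorem tendstoInDistribution_tot_noise (H : IsLocalArray ρ y h θ ξ κ B) :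
    TendstoInDistribution
      (fun n ω => noiseScale h n * tot (noise ρ (y n) ω) n) atTop
      (fun z : ℝ => √(2 * κ) * z) (fun _ => shockLaw ρ) (gaussianReal 0 1) := by
  have hmeas : ∀ n, Measurable fun ω => noiseScale h n * tot (noise ρ (y n) ω) n := fun n =>
    (Finset.measurable_fun_sum _ fun p _ => measurable_noise (H.measurable n) p).const_mul _
  refine ⟨fun n => (hmeas n).aemeasurable, by fun_prop, ?_⟩
  refine ProbabilityMeasure.tendsto_iff_tendsto_charFun.2 fun t => ?_
  have hchar : ∀ n, charFun ((shockLaw ρ).map fun ω => noiseScale h n * tot (noise ρ (y n) ω) n) t =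
      ∫ ω, Complex.exp ((t * noiseScale h n : ℝ) * (tot (noise ρ (y n) ω) n : ℂ) * Complex.I)
        ∂(shockLaw ρ) := by
    intro n
    rw [charFun_apply_real, integral_map (hmeas n).aemeasurable (by fun_prop)]
    refine integral_congr_ae (ae_of_all _ fun ω => ?_)
    simp only
    push_cast
    ring_nf
  simp only [ProbabilityMeasure.coe_mk, charFun_gaussianReal_map_mul H.pos, hchar]
  exact H.tendsto_integral_cexp_tot_noise t

end IsLocalArray

end Noise

/-! ### The two regimes -/

/-- The normalization of the non-degenerate regime. -/
lemma isNormalization_inv_sqrt {h : ℕ → ℝ} (hh : BandwidthAssumption h) :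
    IsLocalArray.IsNormalization h fun n => (√(n : ℝ))⁻¹ := by
  have hsq : ∀ n : ℕ, ((√(n : ℝ))⁻¹) ^ 2 = 1 / n := fun n => by
    rw [inv_pow, Real.sq_sqrt (Nat.cast_nonneg n), one_div]
  refine ⟨?_, ?_⟩
  · simp only [hsq]; exact tendsto_one_div_atTop_nhds_zero_nat
  · simp only [hsq]
    refine hh.tendsto_mul_pow_four.congr fun n => ?_
    rcases eq_or_ne n 0 with rfl | hn
    · simp
    · have : (n : ℝ) ≠ 0 := by exact_mod_cast hn
      field_simp

/-- The normalization of the degenerate regime, in which the bias condition is exactly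
`n h ^ (5 / 2) → 0`. -/
lemma isNormalization_sqrt {h : ℕ → ℝ} (hh : BandwidthAssumption h) :
    IsLocalArray.IsNormalization h fun n => √(h n) := by
  have hsq : ∀ n : ℕ, √(h n) ^ 2 = h n := fun n => Real.sq_sqrt (hh.pos n).le
  refine ⟨by simpa only [hsq] using hh.tendsto_zero, ?_⟩
  simp only [hsq]
  exact hh.tendsto_sq_mul_pow.congr fun n => by ring

lemma abs_le_sqrt_sum_sq {κ : Type*} {A : Finset κ} {x : κ → ℝ} {c : ℝ} (hc : 0 ≤ c) {i : κ}
    (hi : i ∈ A) : c * |x i| ≤ √(c ^ 2 * ∑ j ∈ A, x j ^ 2) := by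
  rw [Real.sqrt_mul (sq_nonneg c), Real.sqrt_sq hc]
  refine mul_le_mul_of_nonneg_left (Real.abs_le_sqrt ?_) hc
  exact Finset.single_le_sum (f := fun j => x j ^ 2) (fun j _ => sq_nonneg _) hi

lemma integral_vertex {E : Type*} [MeasurableSpace E] {ρ : Measure E} [IsProbabilityMeasure ρ]
    (i : ℕ) {φ : E → ℝ} (hφ : Measurable φ) :
    ∫ ω : (ℕ → E) × (ℕ × ℕ → E), φ (ω.1 i) ∂(shockLaw ρ) = ∫ u, φ u ∂ρ := by
  have hU := isIID_vertex (ρ := ρ)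
  have := integral_map (hU.measurable i).aemeasurable (f := φ) (μ := shockLaw ρ)
    hφ.aestronglyMeasurable
  rw [hU.law i] at this
  exact this.symm

namespace IsLocalArray

variable {E : Type*} [MeasurableSpace E] {ρ : Measure E} [IsProbabilityMeasure ρ]
  {y : ℕ → E × E × E → ℝ} {h : ℕ → ℝ} {θ : ℝ} {ξ : E → ℝ} {κ B : ℝ} {c : ℕ → ℝ}

/-- It is enough to control the main parts of the jackknife statistics. -/
lemma jackknifeLimit_of_main (H : IsLocalArray ρ y h θ ξ κ B) (hc : IsNormalization h c)
    (hpos : ∀ᶠ n in atTop, 0 < c n) {τ d : ℝ} (hτ : 0 < τ) (hd : 0 < d)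
    (hsum : TendstoInDistribution (fun n ω => c n * (2 * ∑ i ∈ Finset.range n, ξ (ω.1 i) +
      2 / ((n : ℝ) - 1) * tot (noise ρ (y n) ω) n)) atTop (fun z : ℝ => √τ * z)
      (fun _ => shockLaw ρ) (gaussianReal 0 1))
    (hsq : Tendsto (fun q : ℕ × ((ℕ → E) × (ℕ × ℕ → E)) => c q.1 ^ 2 *
      ∑ i ∈ Finset.range q.1, (2 * ξ (q.2.1 i) +
        2 / ((q.1 : ℝ) - 2) * row (noise ρ (y q.1) q.2) q.1 i) ^ 2) (probFilter (shockLaw ρ)) (𝓝 d))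
    (hcorr : Tendsto (fun q : ℕ × ((ℕ → E) × (ℕ × ℕ → E)) => c q.1 ^ 2 *
      ∑ p ∈ pairs (Finset.range q.1), (2 / ((q.1 : ℝ) - 1) * noise ρ (y q.1) q.2 p) ^ 2)
      (probFilter (shockLaw ρ)) (𝓝 (d - τ)))
    {M : ℕ × ((ℕ → E) × (ℕ × ℕ → E)) → ℝ} (hM : Tendsto M (probFilter (shockLaw ρ)) (𝓝 0))
    (hle : ∀ᶠ q in probFilter (shockLaw ρ), ∀ i < q.1, c q.1 * |2 * ξ (q.2.1 i) +
        2 / ((q.1 : ℝ) - 2) * row (noise ρ (y q.1) q.2) q.1 i| ≤ M q) :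
    JackknifeLimit (shockLaw ρ) (fun n ω p => y n (ω.1 p.1, ω.1 p.2, ω.2 p)) θ c
      (fun q => M q + √(c q.1 ^ 2 *
        ∑ i ∈ Finset.range q.1, vertexRem ρ (y q.1) θ ξ q.1 q.2 i ^ 2)) τ d := by
  have hmeas : ∀ n (p : ℕ × ℕ), Measurable fun ω : (ℕ → E) × (ℕ × ℕ → E) =>
      y n (ω.1 p.1, ω.1 p.2, ω.2 p) := fun n p => (H.measurable n).comp (by fun_prop)
  have hn4 : ∀ᶠ q : ℕ × ((ℕ → E) × (ℕ × ℕ → E)) in probFilter (shockLaw ρ), 4 ≤ q.1 :=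
    tendsto_fst_probFilter.eventually (eventually_ge_atTop 4)
  have hcpos := tendsto_fst_probFilter (P := shockLaw ρ) |>.eventually hpos
  refine ⟨hmeas, hpos, hτ, hd, ?_, ?_, ?_, ?_, ?_⟩
  · refine tendstoInDistribution_of_tendstoInMeasure_sub _ _ hsum
      (tendstoInMeasure_of_probFilter ?_) fun n =>
        ((Finset.measurable_fun_sum _ fun i _ => measurable_V (hmeas n) n i θ).const_mul
          _).aemeasurable
    refine (H.tendsto_sumRem hc).congr' ?_
    filter_upwards [hn4] with q hq
    simp only [Pi.sub_apply, sum_V_eq_main_add_rem hq q.2 (ρ := ρ) (ξ := ξ)]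
    ring
  · refine (tendsto_sum_add_sq (Eventually.of_forall fun q => sq_nonneg _) hsq
      (H.tendsto_vertexRem hc)).congr' ?_
    filter_upwards [hn4] with q hq
    congr 1
    refine Finset.sum_congr rfl fun i hi => ?_
    rw [V_eq_main_add_rem hq q.2 (Finset.mem_range.1 hi)]
  · refine (tendsto_sum_add_sq (Eventually.of_forall fun q => sq_nonneg _) hcorr
      (H.tendsto_edgeRem hc)).congr' ?_
    filter_upwards [hn4] with q hq
    congr 1
    refine Finset.sum_congr rfl fun p hp => ?_
    rw [Q_eq_main_add_rem hq q.2 hp]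
  · have := hM.add (H.tendsto_vertexRem hc).sqrt
    simpa using this
  · filter_upwards [hn4, hle, hcpos] with q hq hle hc i hi
    rw [V_eq_main_add_rem hq q.2 hi (ρ := ρ) (ξ := ξ)]
    refine (mul_le_mul_of_nonneg_left (abs_add_le _ _) hc.le).trans ?_
    rw [mul_add]
    exact add_le_add (hle i hi) (abs_le_sqrt_sum_sq hc.le (Finset.mem_range.2 hi))

lemma tendsto_sum_row_noise_sq_scaled (H : IsLocalArray ρ y h θ ξ κ B) :
    Tendsto (fun q : ℕ × ((ℕ → E) × (ℕ × ℕ → E)) => h q.1 *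
      ∑ i ∈ Finset.range q.1, (2 / ((q.1 : ℝ) - 2) * row (noise ρ (y q.1) q.2) q.1 i) ^ 2)
      (probFilter (shockLaw ρ)) (𝓝 (4 * κ)) := by
  have h1 := (((tendsto_natCast_div_sub 2).pow 2).const_mul 4).comp
    (tendsto_fst_probFilter (P := shockLaw ρ))
  rw [one_pow, mul_one] at h1
  refine (h1.mul H.tendsto_sum_row_noise_sq).congr' ?_
  filter_upwards [tendsto_fst_probFilter.eventually (eventually_gt_atTop 0)] with q hq
  have h0 : (q.1 : ℝ) ≠ 0 := by exact_mod_cast hq.ne'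
  simp only [Function.comp, mul_pow, ← Finset.mul_sum]
  field_simp
  ring

lemma tendsto_sum_noise_sq_scaled (H : IsLocalArray ρ y h θ ξ κ B) :
    Tendsto (fun q : ℕ × ((ℕ → E) × (ℕ × ℕ → E)) => h q.1 *
      ∑ p ∈ pairs (Finset.range q.1), (2 / ((q.1 : ℝ) - 1) * noise ρ (y q.1) q.2 p) ^ 2)
      (probFilter (shockLaw ρ)) (𝓝 (2 * κ)) := by
  have h1 := (((tendsto_natCast_div_sub 1).pow 2).const_mul 4).comp
    (tendsto_fst_probFilter (P := shockLaw ρ))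
  rw [one_pow, mul_one] at h1
  have h2 := h1.mul H.tendsto_tot_noise_sq
  rw [show 4 * (κ / 2) = 2 * κ by ring] at h2
  refine h2.congr' ?_
  filter_upwards [tendsto_fst_probFilter.eventually (eventually_gt_atTop 0)] with q hq
  have h0 : (q.1 : ℝ) ≠ 0 := by exact_mod_cast hq.ne'
  simp only [Function.comp, mul_pow, ← Finset.mul_sum, tot]
  field_simp
  ring

/-! ### The non-degenerate regime -/

lemma tendsto_sum_score_sq (H : IsLocalArray ρ y h θ ξ κ B) :
    Tendsto (fun q : ℕ × ((ℕ → E) × (ℕ × ℕ → E)) => (√(q.1 : ℝ))⁻¹ ^ 2 *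
      ∑ i ∈ Finset.range q.1, (2 * ξ (q.2.1 i)) ^ 2)
      (probFilter (shockLaw ρ)) (𝓝 (4 * ∫ u, ξ u ^ 2 ∂ρ)) := by
  obtain ⟨hm, C, hC⟩ := H.score_bddMeas
  set v := ∫ u, ξ u ^ 2 ∂ρ with hv
  have hC0 : 0 ≤ C := by
    obtain ⟨u⟩ : Nonempty E := nonempty_of_isProbabilityMeasure ρ
    exact (abs_nonneg _).trans (hC u)
  have hη : BddMeas fun u => ξ u ^ 2 - v := (H.score_bddMeas.pow 2).sub (BddMeas.const v)
  obtain ⟨hηm, C', hC'⟩ := hη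
  have harr : IsCenteredArray (shockLaw ρ) (fun (i : ℕ) ω => ξ (ω.1 i) ^ 2 - v)
      (fun _ => ∫ u, (ξ u ^ 2 - v) ^ 2 ∂ρ) C' := by
    refine ⟨fun i => hηm.comp (by fun_prop), isIID_vertex.indep.comp (fun _ u => ξ u ^ 2 - v)
      fun _ => hηm, fun i ω => hC' _, fun i => ?_, fun i => integral_vertex i (hηm.pow_const 2)⟩
    rw [integral_vertex i hηm,
      integral_sub (H.score_bddMeas.pow 2).integrable (integrable_const _)]
    simp [hv]
  have hdev := tendsto_probFilter_zero_of_integral_sq_le (P := shockLaw ρ)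
    (X := fun n ω => 1 / (n : ℝ) * ∑ i ∈ Finset.range n, (ξ (ω.1 i) ^ 2 - v))
    (b := fun n => (1 / (n : ℝ)) ^ 2 * (n * ∫ u, (ξ u ^ 2 - v) ^ 2 ∂ρ)) ?_ ?_ ?_
  · have := (hdev.add_const v).const_mul 4
    rw [zero_add] at this
    refine this.congr' ?_
    filter_upwards [tendsto_fst_probFilter.eventually (eventually_gt_atTop 0)] with q hq
    have h0 : (q.1 : ℝ) ≠ 0 := by exact_mod_cast hq.ne'
    rw [inv_pow, Real.sq_sqrt (Nat.cast_nonneg _)]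
    simp only [mul_pow, ← Finset.mul_sum, Finset.sum_sub_distrib, Finset.sum_const,
      Finset.card_range, nsmul_eq_mul]
    field_simp
    ring
  · exact Eventually.of_forall fun n => (BddMeas.sum fun i _ =>
      (BddMeas.comp ⟨hηm, C', hC'⟩ (by fun_prop))).const_mul _
  · refine Eventually.of_forall fun n => integral_const_mul_sq_le le_rfl ?_
    have := harr.integral_sum_sq (Finset.range n) fun _ => 1
    simp only [one_mul, one_pow, Finset.sum_const, Finset.card_range, nsmul_eq_mul] at this
    exact this.le
  · have := (tendsto_one_div_atTop_nhds_zero_nat (𝕜 := ℝ)).mul_const (∫ u, (ξ u ^ 2 - v) ^ 2 ∂ρ)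
    rw [zero_mul] at this
    refine this.congr' ?_
    filter_upwards [eventually_gt_atTop 0] with n hn
    have h0 : (n : ℝ) ≠ 0 := by exact_mod_cast hn.ne'
    field_simp

lemma tendstoInDistribution_sum_score (H : IsLocalArray ρ y h θ ξ κ B) :
    TendstoInDistribution (fun (n : ℕ) (ω : (ℕ → E) × (ℕ × ℕ → E)) =>
      (√(n : ℝ))⁻¹ * (2 * ∑ i ∈ Finset.range n, ξ (ω.1 i))) atTop
      (fun z : ℝ => √(4 * ∫ u, ξ u ^ 2 ∂ρ) * z) (fun _ => shockLaw ρ) (gaussianReal 0 1) := by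
  have hm := H.score_bddMeas.1
  have hξ0 : BddMeas fun ω : (ℕ → E) × (ℕ × ℕ → E) => ξ (ω.1 0) :=
    H.score_bddMeas.comp (by fun_prop)
  have hmean : ∫ ω : (ℕ → E) × (ℕ × ℕ → E), ξ (ω.1 0) ∂(shockLaw ρ) = 0 :=
    (integral_vertex 0 hm).trans H.integral_score
  have hvar : Var[fun ω : (ℕ → E) × (ℕ × ℕ → E) => ξ (ω.1 0); shockLaw ρ] = ∫ u, ξ u ^ 2 ∂ρ := by
    rw [variance_of_integral_eq_zero hξ0.1.aemeasurable hmean]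
    exact integral_vertex 0 (hm.pow_const 2)
  have hv0 : 0 ≤ ∫ u, ξ u ^ 2 ∂ρ := integral_nonneg fun _ => sq_nonneg _
  have hlaw : HasLaw (fun z : ℝ => √(∫ u, ξ u ^ 2 ∂ρ) * z)
      (gaussianReal 0 Var[fun ω : (ℕ → E) × (ℕ × ℕ → E) => ξ (ω.1 0); shockLaw ρ].toNNReal)
      (gaussianReal 0 1) := by
    refine ⟨by fun_prop, ?_⟩
    rw [gaussianReal_map_const_mul, mul_zero, mul_one, hvar]
    congr 1
    ext
    simp [Real.sq_sqrt hv0, hv0]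
  have hident : ∀ i : ℕ, IdentDistrib (fun ω : (ℕ → E) × (ℕ × ℕ → E) => ξ (ω.1 i))
      (fun ω => ξ (ω.1 0)) (shockLaw ρ) (shockLaw ρ) := fun i => by
    have hU := isIID_vertex (ρ := ρ)
    have : IdentDistrib (fun ω : (ℕ → E) × (ℕ × ℕ → E) => ω.1 i) (fun ω => ω.1 0)
        (shockLaw ρ) (shockLaw ρ) :=
      ⟨(hU.measurable i).aemeasurable, (hU.measurable 0).aemeasurable,
        (hU.law i).trans (hU.law 0).symm⟩
    exact this.comp hm
  have hclt := tendstoInDistribution_inv_sqrt_mul_sum_sub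
    (X := fun (i : ℕ) (ω : (ℕ → E) × (ℕ × ℕ → E)) => ξ (ω.1 i)) hlaw
    (MemLp.of_bound hξ0.1.aestronglyMeasurable _ (ae_of_all _ hξ0.2.choose_spec))
    (isIID_vertex.indep.comp (fun _ => ξ) fun _ => hm) hident
  have h2 := hclt.continuous_comp (g := fun x : ℝ => 2 * x) (by fun_prop)
  have e1 : (fun z : ℝ => √(4 * ∫ u, ξ u ^ 2 ∂ρ) * z) =
      (fun x : ℝ => 2 * x) ∘ fun z : ℝ => √(∫ u, ξ u ^ 2 ∂ρ) * z := by
    funext z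
    rw [Real.sqrt_mul (by norm_num), show (4 : ℝ) = 2 ^ 2 by norm_num, Real.sqrt_sq (by norm_num)]
    simp only [Function.comp]
    ring
  rw [e1]
  convert h2 using 3 with n ω
  simp only [Function.comp, hmean]
  ring

/-- When the score is not degenerate, the vertex shocks dominate the noise. -/
theorem jackknifeLimit_nondegenerate (H : IsLocalArray ρ y h θ ξ κ B)
    (hξ : 0 < ∫ u, ξ u ^ 2 ∂ρ) :
    ∃ m, JackknifeLimit (shockLaw ρ) (fun n ω p => y n (ω.1 p.1, ω.1 p.2, ω.2 p)) θ
      (fun n => (√(n : ℝ))⁻¹) m (4 * ∫ u, ξ u ^ 2 ∂ρ) (4 * ∫ u, ξ u ^ 2 ∂ρ) := by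
  have hpos : ∀ᶠ n : ℕ in atTop, 0 < (√(n : ℝ))⁻¹ := by
    filter_upwards [eventually_gt_atTop 0] with n hn
    have : (0 : ℝ) < n := by exact_mod_cast hn
    positivity
  have hposq := tendsto_fst_probFilter (P := shockLaw ρ) |>.eventually hpos
  have hinv := H.bandwidth.tendsto_inv_mul.comp (tendsto_fst_probFilter (P := shockLaw ρ))
  have hscale : ∀ n : ℕ, ((√(n : ℝ))⁻¹) ^ 2 = 1 / ((n : ℝ) * h n) * h n := fun n => by
    have := (H.bandwidth.pos n).ne'
    rw [inv_pow, Real.sq_sqrt (Nat.cast_nonneg n), ← div_div, div_mul_cancel₀ _ this, one_div]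
  have hrow : Tendsto (fun q : ℕ × ((ℕ → E) × (ℕ × ℕ → E)) => (√(q.1 : ℝ))⁻¹ ^ 2 *
      ∑ i ∈ Finset.range q.1, (2 / ((q.1 : ℝ) - 2) * row (noise ρ (y q.1) q.2) q.1 i) ^ 2)
      (probFilter (shockLaw ρ)) (𝓝 0) := by
    have := hinv.mul H.tendsto_sum_row_noise_sq_scaled
    rw [zero_mul] at this
    exact this.congr fun q => by rw [hscale]; simp only [Function.comp]; ring
  have hedge : Tendsto (fun q : ℕ × ((ℕ → E) × (ℕ × ℕ → E)) => (√(q.1 : ℝ))⁻¹ ^ 2 *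
      ∑ p ∈ pairs (Finset.range q.1), (2 / ((q.1 : ℝ) - 1) * noise ρ (y q.1) q.2 p) ^ 2)
      (probFilter (shockLaw ρ)) (𝓝 0) := by
    have := hinv.mul H.tendsto_sum_noise_sq_scaled
    rw [zero_mul] at this
    exact this.congr fun q => by rw [hscale]; simp only [Function.comp]; ring
  have htot : Tendsto (fun q : ℕ × ((ℕ → E) × (ℕ × ℕ → E)) =>
      (√(q.1 : ℝ))⁻¹ * (2 / ((q.1 : ℝ) - 1) * tot (noise ρ (y q.1) q.2) q.1))
      (probFilter (shockLaw ρ)) (𝓝 0) := by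
    refine tendsto_probFilter_zero_of_integral_sq_le (P := shockLaw ρ)
      (X := fun n ω => (√(n : ℝ))⁻¹ * (2 / ((n : ℝ) - 1) * tot (noise ρ (y n) ω) n))
      (b := fun n => (√(n : ℝ))⁻¹ ^ 2 * (16 / (n : ℝ) ^ 2 * (n ^ 2 * (B / h n * B)))) ?_ ?_ ?_
    · filter_upwards [H.kernel] with n hy
      exact ((BddMeas.tot hy.bddMeas_noise n).const_mul _).const_mul _
    · filter_upwards [H.kernel, eventually_ge_atTop 4] with n hy hn
      exact integral_const_mul_sq_le le_rfl
        (integral_const_mul_sq_le (sq_two_div_sub_one_le hn) (hy.integral_tot_noise_sq_le n))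
    · have := H.bandwidth.tendsto_inv_mul.const_mul (16 * B ^ 2)
      rw [mul_zero] at this
      refine this.congr' ?_
      filter_upwards [eventually_gt_atTop 0] with n hn
      have h0 : (n : ℝ) ≠ 0 := by exact_mod_cast hn.ne'
      have := (H.bandwidth.pos n).ne'
      rw [hscale]
      field_simp
  obtain ⟨hm, C, hC⟩ := H.score_bddMeas
  refine ⟨_, H.jackknifeLimit_of_main (isNormalization_inv_sqrt H.bandwidth) hpos
    (by positivity) (by positivity) ?_ ?_ ?_ (M := fun q => (√(q.1 : ℝ))⁻¹ * (2 * C) +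
      √((√(q.1 : ℝ))⁻¹ ^ 2 * ∑ i ∈ Finset.range q.1,
        (2 / ((q.1 : ℝ) - 2) * row (noise ρ (y q.1) q.2) q.1 i) ^ 2)) ?_ ?_⟩
  · refine tendstoInDistribution_of_tendstoInMeasure_sub _ _ H.tendstoInDistribution_sum_score
      (tendstoInMeasure_of_probFilter (htot.congr fun q => ?_)) fun n => ?_
    · simp only [Pi.sub_apply]; ring
    · refine Measurable.aemeasurable (Measurable.const_mul (Measurable.add (Measurable.const_mul
        (Finset.measurable_fun_sum _ fun i _ => hm.comp (by fun_prop)) _)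
        (Measurable.const_mul (Finset.measurable_fun_sum _ fun p _ =>
          measurable_noise (H.measurable n) p) _)) _)
  · exact tendsto_sum_add_sq (Eventually.of_forall fun q => sq_nonneg _) H.tendsto_sum_score_sq hrow
  -- here `τ = d`, so the correction terms have to vanish
  · rw [sub_self]; exact hedge
  · have h1 : Tendsto (fun n : ℕ => (√(n : ℝ))⁻¹) atTop (𝓝 0) :=
      (Real.tendsto_sqrt_atTop.comp tendsto_natCast_atTop_atTop).inv_tendsto_atTop
    have := ((h1.comp (tendsto_fst_probFilter (P := shockLaw ρ))).mul_const (2 * C)).add hrow.sqrt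
    simpa using this
  · filter_upwards [hposq] with q hc i hi
    refine (mul_le_mul_of_nonneg_left (abs_add_le _ _) hc.le).trans ?_
    rw [mul_add]
    refine add_le_add (mul_le_mul_of_nonneg_left ?_ hc.le)
      (abs_le_sqrt_sum_sq (x := fun i => 2 / ((q.1 : ℝ) - 2) * row (noise ρ (y q.1) q.2) q.1 i)
        hc.le (Finset.mem_range.2 hi))
    rw [abs_mul, abs_two]
    exact mul_le_mul_of_nonneg_left (hC _) zero_le_two

/-! ### The degenerate regime -/

/-- Fourth moments control the largest pseudo value when the noise dominates; the second moments
would only show that it is bounded. -/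
lemma tendsto_sum_row_noise_pow_four (H : IsLocalArray ρ y h θ ξ κ B) :
    Tendsto (fun q : ℕ × ((ℕ → E) × (ℕ × ℕ → E)) => ∑ i ∈ Finset.range q.1,
      (√(h q.1) * (2 / ((q.1 : ℝ) - 2) * row (noise ρ (y q.1) q.2) q.1 i)) ^ 4)
      (probFilter (shockLaw ρ)) (𝓝 0) := by
  refine tendsto_probFilter_zero_of_integral_abs_le (P := shockLaw ρ)
    (X := fun n ω => ∑ i ∈ Finset.range n,
      (√(h n) * (2 / ((n : ℝ) - 2) * row (noise ρ (y n) ω) n i)) ^ 4)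
    (b := fun n => n * (h n ^ 2 * ((16 / (n : ℝ) ^ 2) ^ 2 *
      (3 * (n * (B / h n * B)) ^ 2 + n * ((B / h n) ^ 2 * (B / h n * B)))))) ?_ ?_ ?_
  · filter_upwards [H.kernel] with n hy
    exact (BddMeas.sum fun i _ =>
      (((BddMeas.row hy.bddMeas_noise n i).const_mul _).const_mul _).pow 4).integrable
  · filter_upwards [H.kernel, eventually_ge_atTop 4] with n hy hn
    have habs : ∀ ω, |∑ i ∈ Finset.range n,
        (√(h n) * (2 / ((n : ℝ) - 2) * row (noise ρ (y n) ω) n i)) ^ 4| = ∑ i ∈ Finset.range n,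
        (√(h n) * (2 / ((n : ℝ) - 2) * row (noise ρ (y n) ω) n i)) ^ 4 := fun ω =>
      abs_of_nonneg (Finset.sum_nonneg fun i _ => by positivity)
    simp only [habs]
    rw [integral_finsetSum _ fun i _ =>
      ((((BddMeas.row hy.bddMeas_noise n i).const_mul _).const_mul _).pow 4).integrable]
    have hterm : ∀ i ∈ Finset.range n, ∫ ω, (√(h n) * (2 / ((n : ℝ) - 2) *
        row (noise ρ (y n) ω) n i)) ^ 4 ∂(shockLaw ρ) ≤ h n ^ 2 * ((16 / (n : ℝ) ^ 2) ^ 2 *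
      (3 * (n * (B / h n * B)) ^ 2 + n * ((B / h n) ^ 2 * (B / h n * B)))) := by
      intro i hi
      have hs : √(h n) ^ 4 = h n ^ 2 := by
        rw [show 4 = 2 * 2 by norm_num, pow_mul, Real.sq_sqrt (H.bandwidth.pos n).le]
      have hk : (2 / ((n : ℝ) - 2)) ^ 4 ≤ (16 / (n : ℝ) ^ 2) ^ 2 := by
        rw [show 4 = 2 * 2 by norm_num, pow_mul]
        exact pow_le_pow_left₀ (sq_nonneg _) (sq_two_div_sub_two_le hn) 2
      simp only [mul_pow _ _ 4, hs]
      rw [integral_const_mul, integral_const_mul]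
      refine mul_le_mul_of_nonneg_left ?_ (sq_nonneg _)
      refine mul_le_mul hk ?_ (integral_nonneg fun ω => by positivity) (sq_nonneg _)
      exact hy.integral_row_noise_pow_four_le (Finset.mem_range.1 hi)
    refine (Finset.sum_le_sum hterm).trans (le_of_eq ?_)
    rw [Finset.sum_const, Finset.card_range, nsmul_eq_mul]
  · have := ((tendsto_one_div_atTop_nhds_zero_nat (𝕜 := ℝ)).const_mul (768 * B ^ 4)).add
      (H.bandwidth.tendsto_inv_sq_mul.const_mul (256 * B ^ 4))
    simp only [mul_zero, add_zero] at this
    refine this.congr' ?_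
    filter_upwards [eventually_gt_atTop 0] with n hn
    have h0 : (n : ℝ) ≠ 0 := by exact_mod_cast hn.ne'
    have := (H.bandwidth.pos n).ne'
    field_simp
    ring

/-- When the score is degenerate, the noise dominates, and the jackknife variance estimator is
twice too large. -/
theorem jackknifeLimit_degenerate (H : IsLocalArray ρ y h θ (fun _ => 0) κ B) :
    ∃ m, JackknifeLimit (shockLaw ρ) (fun n ω p => y n (ω.1 p.1, ω.1 p.2, ω.2 p)) θ
      (fun n => √(h n)) m (2 * κ) (4 * κ) := by
  have hκ := H.pos
  have hsq : ∀ n : ℕ, √(h n) ^ 2 = h n := fun n => Real.sq_sqrt (H.bandwidth.pos n).le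
  refine ⟨_, H.jackknifeLimit_of_main (isNormalization_sqrt H.bandwidth)
    (Eventually.of_forall fun n => Real.sqrt_pos.2 (H.bandwidth.pos n)) (by positivity)
    (by positivity) ?_ ?_ ?_ (M := fun q => √√(∑ i ∈ Finset.range q.1,
      (√(h q.1) * (2 / ((q.1 : ℝ) - 2) * row (noise ρ (y q.1) q.2) q.1 i)) ^ 4)) ?_ ?_⟩
  · convert H.tendstoInDistribution_tot_noise using 3 with n ω
    simp only [Finset.sum_const_zero, mul_zero, zero_add, noiseScale]
    ring
  · simpa only [hsq, mul_zero, zero_add] using H.tendsto_sum_row_noise_sq_scaled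
  · rw [show 4 * κ - 2 * κ = 2 * κ by ring]
    simpa only [hsq] using H.tendsto_sum_noise_sq_scaled
  · simpa using H.tendsto_sum_row_noise_pow_four.sqrt.sqrt
  · refine Eventually.of_forall fun q i hi => ?_
    simp only [mul_zero, zero_add]
    rw [← abs_of_nonneg (Real.sqrt_nonneg (h q.1)), ← abs_mul]
    refine Real.abs_le_sqrt (Real.le_sqrt_of_sq_le ?_)
    rw [← pow_mul]
    have := Finset.single_le_sum (f := fun j => (√(h q.1) * (2 / ((q.1 : ℝ) - 2) *
      row (noise ρ (y q.1) q.2) q.1 j)) ^ 4) (fun j _ => by positivity) (Finset.mem_range.2 hi)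
    simpa [abs_of_nonneg (Real.sqrt_nonneg (h q.1))] using this

end IsLocalArray

/-! ### Reduction to the canonical probability space -/

/-- The index set of the edge shocks. -/
abbrev Edge : Type := {p : ℕ × ℕ // p.1 < p.2}

/-- All the shocks of a dyadic array. -/
def shocks {Ω : Type*} (U : ℕ → Ω → unitInterval) (W : ℕ × ℕ → Ω → unitInterval) (ω : Ω) :
    (ℕ → unitInterval) × (Edge → unitInterval) :=
  (fun i => U i ω, fun e => W e.1 ω)

section Shocks

variable {Ω : Type*} [MeasurableSpace Ω] {P : Measure Ω} {U : ℕ → Ω → unitInterval}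
  {W : ℕ × ℕ → Ω → unitInterval}

lemma IsIIDUniform.measurable_shocks (h : IsIIDUniform P U W) : Measurable (shocks U W) :=
  (measurable_pi_lambda _ h.measurable_vertex).prodMk
    (measurable_pi_lambda _ fun e => h.measurable_edge e.1 e.2)

lemma IsIIDUniform.map_shocks [IsProbabilityMeasure P] (h : IsIIDUniform P U W) :
    P.map (shocks U W) = (Measure.infinitePi fun _ : ℕ => (volume : Measure unitInterval)).prod
      (Measure.infinitePi fun _ : Edge => (volume : Measure unitInterval)) := by
  have hU : Measurable fun ω i => U i ω := measurable_pi_lambda _ h.measurable_vertex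
  have hW : Measurable fun ω (e : Edge) => W e.1 ω :=
    measurable_pi_lambda _ fun e => h.measurable_edge e.1 e.2
  have hmeas : ∀ s, Measurable (Sum.elim U (fun e : Edge => W e.1) s) := by
    rintro (i | e)
    · exact h.measurable_vertex i
    · exact h.measurable_edge e.1 e.2
  have hind : IndepFun (fun ω i => U i ω) (fun ω (e : Edge) => W e.1 ω) P := by
    have hdisj : Disjoint (Set.range (Sum.inl : ℕ → ℕ ⊕ Edge)) (Set.range Sum.inr) :=
      Set.isCompl_range_inl_range_inr.disjoint
    have := indep_iSup_of_disjoint (fun s => (hmeas s).comap_le) h.indep hdisj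
    rw [iSup_range, iSup_range] at this
    rw [IndepFun_iff_Indep]
    simp only [MeasurableSpace.pi, MeasurableSpace.comap_iSup, MeasurableSpace.comap_comp]
    exact this
  change P.map (fun ω => ((fun i => U i ω), (fun e : Edge => W e.1 ω))) = _
  rw [(indepFun_iff_map_prod_eq_prod_map_map hU.aemeasurable hW.aemeasurable).1 hind]
  have h1 := (h.indep.precomp Sum.inl_injective).map_fun_eq_infinitePi_map
    fun i => h.measurable_vertex i
  have h2 := (h.indep.precomp Sum.inr_injective).map_fun_eq_infinitePi_map
    fun e : Edge => h.measurable_edge e.1 e.2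
  simp only [h.law_vertex] at h1
  have hlaw : ∀ e : Edge, P.map (W e.1) = volume := fun e => h.law_edge e.1 e.2
  simp only [hlaw] at h2
  rw [h1, h2]

/-- Forgetting the edge shocks which are not used. -/
def restrictEdges (ω : (ℕ → unitInterval) × (ℕ × ℕ → unitInterval)) :
    (ℕ → unitInterval) × (Edge → unitInterval) :=
  (ω.1, fun e => ω.2 e.1)

lemma measurable_restrictEdges : Measurable restrictEdges := by
  unfold restrictEdges; fun_prop

lemma map_restrictEdges : (shockLaw (volume : Measure unitInterval)).map restrictEdges =
    (Measure.infinitePi fun _ : ℕ => (volume : Measure unitInterval)).prod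
      (Measure.infinitePi fun _ : Edge => (volume : Measure unitInterval)) := by
  have h := Measure.map_prod_map (Measure.infinitePi fun _ : ℕ => (volume : Measure unitInterval))
    (Measure.infinitePi fun _ : ℕ × ℕ => (volume : Measure unitInterval)) measurable_id
    (show Measurable ({p : ℕ × ℕ | p.1 < p.2}.domRestrict (π := fun _ => unitInterval)) from
      measurable_pi_lambda _ fun e => measurable_pi_apply e.1)
  rw [Measure.map_id, Measure.infinitePi_map_restrict'] at h
  exact h.symm

/-- Convergence in distribution of functions of the shocks may be checked on the canonical space. -/
lemma IsIIDUniform.tendstoInDistribution [IsProbabilityMeasure P] (h : IsIIDUniform P U W)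
    {E : Type*} [TopologicalSpace E] [MeasurableSpace E] [OpensMeasurableSpace E]
    {Ω' : Type*} [MeasurableSpace Ω'] {P' : Measure Ω'} [IsProbabilityMeasure P'] {Z : Ω' → E}
    {T : ℕ → (ℕ → unitInterval) × (Edge → unitInterval) → E} (hT : ∀ n, Measurable (T n))
    (hlim : TendstoInDistribution (fun n ω => T n (restrictEdges ω)) atTop Z
      (fun _ => shockLaw volume) P') :
    TendstoInDistribution (fun n ω => T n (shocks U W ω)) atTop Z (fun _ => P) P' := by
  refine ⟨fun n => ((hT n).comp h.measurable_shocks).aemeasurable, hlim.aemeasurable_limit, ?_⟩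
  refine hlim.tendsto.congr fun n => Subtype.ext ?_
  change (shockLaw volume).map (T n ∘ restrictEdges) = P.map (T n ∘ shocks U W)
  rw [← Measure.map_map (hT n) measurable_restrictEdges, ← Measure.map_map (hT n)
    h.measurable_shocks, map_restrictEdges, h.map_shocks]

lemma IsIIDUniform.map_triple [IsProbabilityMeasure P] (h : IsIIDUniform P U W) :
    P.map (fun ω => ((U 0 ω, U 1 ω), W (0, 1) ω)) =
      ((volume : Measure unitInterval).prod volume).prod volume := by
  let φ : (ℕ → unitInterval) × (Edge → unitInterval) →
      (unitInterval × unitInterval) × unitInterval :=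
    Prod.map (fun u => (u 0, u 1)) fun w => w ⟨(0, 1), zero_lt_one⟩
  have hφ1 : Measurable fun u : ℕ → unitInterval => (u 0, u 1) := by fun_prop
  have hφ2 : Measurable fun w : Edge → unitInterval => w ⟨(0, 1), zero_lt_one⟩ :=
    measurable_pi_apply _
  have hU : IsIID (Measure.infinitePi fun _ : ℕ => (volume : Measure unitInterval)) volume
      fun i u => u i :=
    ⟨fun i => measurable_pi_apply i, fun i => Measure.infinitePi_map_eval _ i,
      iIndepFun_infinitePi (X := fun _ x => x) fun _ => measurable_id⟩
  have h1 : P.map (φ ∘ shocks U W) = ((volume : Measure unitInterval).prod volume).prod volume := by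
    rw [← Measure.map_map (hφ1.prodMap hφ2) h.measurable_shocks, h.map_shocks,
      ← Measure.map_prod_map _ _ hφ1 hφ2, hU.map_prodMk zero_ne_one, Measure.infinitePi_map_eval]
  exact h1

end Shocks

/-! ### The statistics as functions of the shocks -/

lemma pairAvg_congr {y y' : ℕ × ℕ → ℝ} (h : ∀ p : ℕ × ℕ, p.1 < p.2 → y p = y' p) :
    pairAvg y = pairAvg y' := by
  funext A
  rw [pairAvg, pairAvg]
  congr 1
  exact Finset.sum_congr rfl fun p hp => h p (Finset.mem_filter.1 hp).2

/-- The values of a kernel on the edges, extended by zero. -/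
def edgeArray (y : unitInterval × unitInterval × unitInterval → ℝ)
    (t : (ℕ → unitInterval) × (Edge → unitInterval)) (p : ℕ × ℕ) : ℝ :=
  if hp : p.1 < p.2 then y (t.1 p.1, t.1 p.2, t.2 ⟨p, hp⟩) else 0

lemma measurable_edgeArray {y : unitInterval × unitInterval × unitInterval → ℝ}
    (hy : Measurable y) (p : ℕ × ℕ) : Measurable fun t => edgeArray y t p := by
  by_cases hp : p.1 < p.2
  · simp only [edgeArray, hp, dif_pos]
    exact hy.comp (by fun_prop)
  · simp only [edgeArray, hp, dif_neg, not_false_eq_true]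
    exact measurable_const

lemma pairAvg_edgeArray_restrictEdges (y : unitInterval × unitInterval × unitInterval → ℝ)
    (ω : (ℕ → unitInterval) × (ℕ × ℕ → unitInterval)) :
    pairAvg (edgeArray y (restrictEdges ω)) =
      pairAvg fun p => y (ω.1 p.1, ω.1 p.2, ω.2 p) :=
  pairAvg_congr fun p hp => by rw [edgeArray, dif_pos hp]; rfl

/-- The kernel whose values are averaged by the density estimator. -/
def kdeKernel (K : ℝ → ℝ) (x b : ℝ) (F : unitInterval × unitInterval × unitInterval → ℝ)
    (t : unitInterval × unitInterval × unitInterval) : ℝ :=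
  1 / b * K ((x - F t) / b)

lemma kde_eq_pairAvg {Ω : Type*} (K : ℝ → ℝ) (x b : ℝ)
    (F : unitInterval × unitInterval × unitInterval → ℝ) (U : ℕ → Ω → unitInterval)
    (W : ℕ × ℕ → Ω → unitInterval) (ω : Ω) :
    kde K x b (array F U W ω) = pairAvg (edgeArray (kdeKernel K x b F) (shocks U W ω)) := by
  have : kde K x b (array F U W ω) =
      pairAvg fun p => kdeKernel K x b F (U p.1 ω, U p.2 ω, W p ω) := rfl
  rw [this]
  exact pairAvg_congr fun p hp => by rw [edgeArray, dif_pos hp]; rfl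

/-! ### Smoothing of a density by a kernel -/

section Smoothing

/-- Bounded nonnegative kernels supported in `[-R, R]`, with vanishing first moment. -/
structure IsBump (k : ℝ → ℝ) (R D : ℝ) : Prop where
  measurable : Measurable k
  nonneg : ∀ s, 0 ≤ k s
  le : ∀ s, k s ≤ D
  eq_zero : ∀ s, R < |s| → k s = 0
  integral_mul_eq_zero : ∫ s, s * k s = 0

variable {k : ℝ → ℝ} {R D : ℝ}

lemma IsBump.integrable_mul (hk : IsBump k R D) {φ : ℝ → ℝ} (hφ : Measurable φ) {M : ℝ}
    (hM : ∀ s, |s| ≤ R → |φ s| ≤ M) : Integrable fun s => k s * φ s := by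
  have hsupp : Function.support (fun s => k s * φ s) ⊆ Set.Icc (-R) R := by
    intro s hs
    by_contra h
    refine hs ?_
    have : R < |s| := by
      rw [Set.mem_Icc, ← abs_le, not_le] at h
      exact h
    simp only [hk.eq_zero s this, zero_mul]
  rw [← integrableOn_iff_integrable_of_support_subset hsupp]
  refine Measure.integrableOn_of_bounded (M := D * M) (by simp)
    (hk.measurable.mul hφ).aestronglyMeasurable ?_
  refine ae_restrict_of_forall_mem measurableSet_Icc fun s hs => ?_
  rw [Real.norm_eq_abs, abs_mul, abs_of_nonneg (hk.nonneg s)]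
  exact mul_le_mul (hk.le s) (hM s (abs_le.2 hs)) (abs_nonneg _) ((hk.nonneg s).trans (hk.le s))

lemma IsBump.integrable (hk : IsBump k R D) : Integrable k := by
  simpa using hk.integrable_mul (φ := fun _ => 1) measurable_const (M := 1) (by simp)

lemma integral_rescaled {h : ℝ} (hh : 0 < h) (x : ℝ) (k g : ℝ → ℝ) :
    ∫ t, 1 / h * k ((x - t) / h) * g t = ∫ s, k s * g (x - h * s) := by
  have h1 := Measure.integral_comp_mul_left (fun u => k ((x - (x - u)) / h) * g (x - u)) h
  have h2 := integral_sub_left_eq_self (fun t => k ((x - t) / h) * g t) volume x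
  rw [h2] at h1
  simp only [mul_assoc]
  rw [integral_const_mul]
  have h3 : ∀ s : ℝ, (x - (x - h * s)) / h = s := fun s => by field_simp; ring
  simp only [h3] at h1
  rw [h1, abs_of_pos (inv_pos.2 hh), smul_eq_mul, one_div]

/-- The points reached by a kernel with bandwidth `h` at `x` stay in `[a, b]`. -/
def Fits (a b x h R : ℝ) : Prop := ∀ s, |s| ≤ R → x - h * s ∈ Set.Icc a b

lemma eventually_fits {a b x R : ℝ} (hx : x ∈ Set.Ioo a b) {h : ℕ → ℝ} (hpos : ∀ n, 0 < h n)
    (hh : Tendsto h atTop (𝓝 0)) : ∀ᶠ n in atTop, Fits a b x (h n) R := by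
  have h1 : Tendsto (fun n => h n * R) atTop (𝓝 0) := by simpa using hh.mul_const R
  filter_upwards [h1.eventually_lt_const (sub_pos.2 hx.1), h1.eventually_lt_const (sub_pos.2 hx.2)]
    with n h1 h2 s hs
  have := mul_le_mul_of_nonneg_left (abs_le.1 hs).1 (hpos n).le
  have := mul_le_mul_of_nonneg_left (abs_le.1 hs).2 (hpos n).le
  exact ⟨by linarith, by linarith⟩

lemma IsBump.rescaled_eq_zero (hk : IsBump k R D) {a b x h t : ℝ} (hh : 0 < h)
    (hfit : Fits a b x h R) (ht : t ∉ Set.Icc a b) : 1 / h * k ((x - t) / h) = 0 := by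
  rw [hk.eq_zero, mul_zero]
  by_contra hs
  refine ht ?_
  have := hfit _ (not_lt.1 hs)
  rwa [mul_div_cancel₀ _ hh.ne', sub_sub_cancel] at this

/-- Smoothing preserves upper bounds. -/
lemma IsBump.integral_rescaled_le (hk : IsBump k R D) {g : ℝ → ℝ} (hg0 : ∀ t, 0 ≤ g t)
    {a b x h M : ℝ} (hh : 0 < h) (hfit : Fits a b x h R) (hM : ∀ t ∈ Set.Icc a b, g t ≤ M) :
    ∫ t, 1 / h * k ((x - t) / h) * g t ≤ M * ∫ s, k s := by
  rw [integral_rescaled hh, ← integral_const_mul]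
  refine integral_mono_of_nonneg (ae_of_all _ fun s => mul_nonneg (hk.nonneg s) (hg0 _))
    (hk.integrable.const_mul M) (ae_of_all _ fun s => ?_)
  rcases le_or_gt |s| R with hs | hs
  · simp only [mul_comm M]
    exact mul_le_mul_of_nonneg_left (hM _ (hfit s hs)) (hk.nonneg s)
  · simp [hk.eq_zero s hs]

lemma taylor_bound {g : ℝ → ℝ} {O : Set ℝ} (hO : IsOpen O) (hg : ContDiffOn ℝ 2 g O) {a b C : ℝ}
    (hab : Set.Icc a b ⊆ O) (hC : ∀ y ∈ Set.Icc a b, |iteratedDeriv 2 g y| ≤ C) {x t : ℝ}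
    (hx : x ∈ Set.Icc a b) (ht : t ∈ Set.Icc a b) :
    |g t - g x - deriv g x * (t - x)| ≤ C * (t - x) ^ 2 := by
  have hg1 : ContDiffOn ℝ 1 (deriv g) O := ((contDiffOn_succ_iff_deriv_of_isOpen (n := 1) hO).1
    (by simpa [one_add_one_eq_two] using hg)).2.2
  have hd : ∀ y ∈ Set.Icc a b, HasDerivAt g (deriv g y) y := fun y hy =>
    ((hg.differentiableOn (by norm_num)).differentiableAt
      (hO.mem_nhds (hab hy))).hasDerivAt
  have hd2 : ∀ y ∈ Set.Icc a b, HasDerivAt (deriv g) (iteratedDeriv 2 g y) y := fun y hy => by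
    have := ((hg1.differentiableOn (by norm_num)).differentiableAt
      (hO.mem_nhds (hab hy))).hasDerivAt
    rwa [iteratedDeriv_succ, iteratedDeriv_one]
  have hseg : Set.uIcc x t ⊆ Set.Icc a b := Set.uIcc_subset_Icc hx ht
  have hC0 : 0 ≤ C := (abs_nonneg _).trans (hC x hx)
  have hderiv : ∀ y ∈ Set.uIcc x t, |deriv g y - deriv g x| ≤ C * |t - x| := by
    intro y hy
    have h1 := (convex_uIcc x t).norm_image_sub_le_of_norm_hasDerivWithin_le
      (fun z hz => (hd2 z (hseg hz)).hasDerivWithinAt) (fun z hz => hC z (hseg hz))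
      Set.left_mem_uIcc hy
    refine h1.trans (mul_le_mul_of_nonneg_left ?_ hC0)
    rw [Real.norm_eq_abs]
    exact Set.abs_sub_left_of_mem_uIcc hy
  have hlin : ∀ y ∈ Set.Icc a b,
      HasDerivAt (fun y => g y - deriv g x * y) (deriv g y - deriv g x) y := fun y hy => by
    have := (hd y hy).fun_sub ((hasDerivAt_id' y).const_mul (deriv g x))
    rwa [mul_one] at this
  have h2 := (convex_uIcc x t).norm_image_sub_le_of_norm_hasDerivWithin_le
    (f := fun y => g y - deriv g x * y) (f' := fun y => deriv g y - deriv g x) (C := C * |t - x|)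
    (fun z hz => (hlin z (hseg hz)).hasDerivWithinAt) hderiv
    Set.left_mem_uIcc Set.right_mem_uIcc
  rw [Real.norm_eq_abs, Real.norm_eq_abs, mul_assoc, ← sq, sq_abs] at h2
  convert h2 using 2
  ring

/-- The bias of kernel smoothing is of second order. -/
lemma IsBump.abs_integral_rescaled_sub_le (hk : IsBump k R D) {g : ℝ → ℝ} (hgm : Measurable g)
    {O : Set ℝ} (hO : IsOpen O) (hg : ContDiffOn ℝ 2 g O) {a b C : ℝ} (hab : Set.Icc a b ⊆ O)
    (hC : ∀ y ∈ Set.Icc a b, |iteratedDeriv 2 g y| ≤ C) {x h : ℝ} (hh : 0 < h)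
    (hx : x ∈ Set.Icc a b) (hfit : Fits a b x h R) :
    |(∫ t, 1 / h * k ((x - t) / h) * g t) - g x * ∫ s, k s| ≤ C * (∫ s, k s * s ^ 2) * h ^ 2 := by
  obtain ⟨M, hM⟩ := isCompact_Icc.exists_bound_of_continuousOn (hg.continuousOn.mono hab)
  have hi1 : Integrable fun s => k s * g (x - h * s) :=
    hk.integrable_mul (hgm.comp (by fun_prop)) fun s hs => hM _ (hfit s hs)
  have hi2 : Integrable fun s => k s * s := hk.integrable_mul measurable_id fun s hs => hs
  have hi3 : Integrable fun s => k s * s ^ 2 := hk.integrable_mul (by fun_prop) (M := R ^ 2)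
    fun s hs => by
      rw [abs_pow]
      exact pow_le_pow_left₀ (abs_nonneg _) hs 2
  have h0 : ∫ s, k s * s = 0 := by
    rw [← hk.integral_mul_eq_zero]
    exact integral_congr_ae (ae_of_all _ fun s => mul_comm _ _)
  have hi4 : Integrable fun s => k s * g (x - h * s) - g x * k s :=
    hi1.sub (hk.integrable.const_mul _)
  have key : (∫ t, 1 / h * k ((x - t) / h) * g t) - g x * ∫ s, k s =
      ∫ s, (k s * g (x - h * s) - g x * k s + deriv g x * h * (k s * s)) := by
    rw [integral_rescaled hh, integral_add hi4 (hi2.const_mul _),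
      integral_sub hi1 (hk.integrable.const_mul _), integral_const_mul, integral_const_mul, h0]
    ring
  rw [key, mul_right_comm, ← integral_const_mul]
  rw [← Real.norm_eq_abs]
  refine norm_integral_le_of_norm_le (hi3.const_mul _) (ae_of_all _ fun s => ?_)
  rcases le_or_gt |s| R with hs | hs
  · have := taylor_bound hO hg hab hC hx (hfit s hs)
    have e : k s * g (x - h * s) - g x * k s + deriv g x * h * (k s * s) =
        k s * (g (x - h * s) - g x - deriv g x * (x - h * s - x)) := by ring
    rw [e, Real.norm_eq_abs, abs_mul, abs_of_nonneg (hk.nonneg s)]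
    refine (mul_le_mul_of_nonneg_left this (hk.nonneg s)).trans (le_of_eq ?_)
    ring
  · simp [hk.eq_zero s hs]

end Smoothing

/-! ### Integration against measures with a local density -/

section LocalDensity

variable {ν : Measure ℝ} {g : ℝ → ℝ} {O : Set ℝ}

lemma integral_eq_integral_mul_of_restrict (hgm : Measurable g)
    (hg0 : ∀ t, 0 ≤ g t)
    (hν : ν.restrict O = (volume.restrict O).withDensity fun t => ENNReal.ofReal (g t))
    {φ : ℝ → ℝ} (hφ : ∀ t, t ∉ O → φ t = 0) : ∫ t, φ t ∂ν = ∫ t, φ t * g t := by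
  have h1 : ∀ t, t ∉ O → φ t * g t = 0 := fun t ht => by rw [hφ t ht, zero_mul]
  rw [← setIntegral_eq_integral_of_forall_compl_eq_zero hφ, hν,
    integral_withDensity_eq_integral_toReal_smul (by fun_prop) (ae_of_all _ fun t =>
      ENNReal.ofReal_lt_top), ← setIntegral_eq_integral_of_forall_compl_eq_zero h1]
  refine integral_congr_ae (ae_of_all _ fun t => ?_)
  simp only [smul_eq_mul, ENNReal.toReal_ofReal (hg0 t)]
  exact mul_comm _ _

/-- A density with bounded derivative on an interval is bounded there. -/
lemma density_le_of_deriv_le [IsProbabilityMeasure ν]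
    (hν : ν.restrict O = (volume.restrict O).withDensity fun t => ENNReal.ofReal (g t))
    (hO : IsOpen O) (hg : ContDiffOn ℝ 1 g O) {a b C : ℝ} (hlt : a < b) (hab : Set.Icc a b ⊆ O)
    (hC : ∀ y ∈ Set.Icc a b, |deriv g y| ≤ C) {t : ℝ} (ht : t ∈ Set.Icc a b) :
    g t ≤ 1 / (b - a) + C * (b - a) := by
  by_contra! hcon
  have hba : 0 < b - a := sub_pos.2 hlt
  have hC0 : 0 ≤ C := (abs_nonneg _).trans (hC t ht)
  have hlow : ∀ y ∈ Set.Icc a b, g t - C * (b - a) ≤ g y := by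
    intro y hy
    have h1 := (convex_Icc a b).norm_image_sub_le_of_norm_deriv_le (f := g)
      (fun z hz => (hg.differentiableOn (by norm_num)).differentiableAt (hO.mem_nhds (hab hz)))
      hC hy ht
    have h2 : |t - y| ≤ b - a := abs_le.2 ⟨by linarith [hy.2, ht.1], by linarith [hy.1, ht.2]⟩
    have h3 := (le_abs_self _).trans (h1.trans (mul_le_mul_of_nonneg_left h2 hC0))
    linarith
  have hmass : ν (Set.Icc a b) = ∫⁻ y in Set.Icc a b, ENNReal.ofReal (g y) := by
    have h1 := congrArg (fun m => m (Set.Icc a b)) hν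
    simp only [withDensity_apply _ measurableSet_Icc, Measure.restrict_restrict measurableSet_Icc,
      Measure.restrict_apply measurableSet_Icc, Set.inter_eq_left.2 hab] at h1
    exact h1
  have h1 : ENNReal.ofReal (g t - C * (b - a)) * volume (Set.Icc a b) ≤ ν (Set.Icc a b) := by
    rw [hmass, ← setLIntegral_const]
    exact setLIntegral_mono' measurableSet_Icc fun y hy => ENNReal.ofReal_le_ofReal (hlow y hy)
  have h2 := h1.trans prob_le_one
  rw [Real.volume_Icc, ← ENNReal.ofReal_mul' hba.le, ENNReal.ofReal_le_one] at h2
  have h3 : 1 / (b - a) < g t - C * (b - a) := by linarith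
  rw [div_lt_iff₀ hba] at h3
  linarith

end LocalDensity

/-! ### Conditional laws -/

/-- The conditional law of a function of two independent variables given the first one. -/
lemma condDistrib_ae_eq_map {Ω A S : Type*} [MeasurableSpace Ω] [MeasurableSpace A]
    [MeasurableSpace S] {P : Measure Ω} [IsProbabilityMeasure P] {Z : Ω → A} {T : Ω → S}
    (hZ : Measurable Z) (hT : Measurable T) {β : Measure S} [IsProbabilityMeasure β]
    (hlaw : P.map (fun ω => (Z ω, T ω)) = (P.map Z).prod β) {G : A × S → ℝ} (hG : Measurable G) :
    ∀ᵐ z ∂(P.map Z), condDistrib (fun ω => G (Z ω, T ω)) Z P z = β.map fun d => G (z, d) := by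
  set κ : Kernel A ℝ := (Kernel.id ×ₖ Kernel.const A β).map G with hκ
  have hκz : ∀ z, κ z = β.map fun d => G (z, d) := fun z => by
    rw [hκ, Kernel.map_apply _ hG, Kernel.prod_apply, Kernel.id_apply, Kernel.const_apply,
      Measure.dirac_prod, Measure.map_map hG measurable_prodMk_left]
    rfl
  have hX : Measurable fun ω => G (Z ω, T ω) := hG.comp (hZ.prodMk hT)
  have : IsProbabilityMeasure (P.map Z) := Measure.isProbabilityMeasure_map hZ.aemeasurable
  have := condDistrib_ae_eq_of_measure_eq_compProd (κ := κ) Z hX.aemeasurable (μ := P) ?_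
  · filter_upwards [this] with z hz
    rw [hz, hκz]
  · have h1 : P.map (fun ω => (Z ω, G (Z ω, T ω))) =
        ((P.map Z).prod β).map fun p => (p.1, G p) := by
      rw [← hlaw, Measure.map_map (by fun_prop) (hZ.prodMk hT)]
      rfl
    have hm : Measurable fun p : A × S => (p.1, G p) := by fun_prop
    rw [h1]
    ext s hs
    rw [Measure.map_apply hm hs, Measure.prod_apply (hm hs), Measure.compProd_apply hs]
    refine lintegral_congr fun z => ?_
    have hGz : Measurable fun d => G (z, d) := hG.comp measurable_prodMk_left
    rw [hκz, Measure.map_apply hGz (measurable_prodMk_left hs)]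
    rfl

/-! ### The smoothing kernel -/

namespace KernelAssumption

variable {K : ℝ → ℝ}

lemma measurable (hK : KernelAssumption K) : Measurable K := by
  obtain ⟨p, q, hp, hq, hpq⟩ :=
    hK.bounded_variation.locallyBoundedVariationOn.exists_monotoneOn_sub_monotoneOn
  rw [hpq]
  exact (monotoneOn_univ.1 hp).measurable.sub (monotoneOn_univ.1 hq).measurable

lemma exists_isBump (hK : KernelAssumption K) :
    ∃ R D, 0 ≤ D ∧ IsBump K R D ∧ IsBump (fun s => K s ^ 2) R (D ^ 2) := by
  obtain ⟨D, hD⟩ := hK.bounded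
  obtain ⟨R, hR⟩ := hK.bounded_support.subset_closedBall 0
  have h0 : ∀ s, R < |s| → K s = 0 := fun s hs => by
    by_contra h
    have := hR h
    rw [mem_closedBall_zero_iff, Real.norm_eq_abs] at this
    linarith
  have hle : ∀ s, K s ≤ D := fun s => (le_abs_self _).trans (hD s)
  refine ⟨R, D, (hK.nonneg 0).trans (hle 0), ⟨hK.measurable, hK.nonneg, hle, h0,
    hK.integral_mul_eq_zero⟩, ⟨hK.measurable.pow_const 2, fun s => sq_nonneg _,
    fun s => pow_le_pow_left₀ (hK.nonneg s) (hle s) 2, fun s hs => by simp [h0 s hs], ?_⟩⟩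
  have h1 := integral_neg_eq_self (fun s => s * K s ^ 2) volume
  simp only [hK.symmetric, neg_mul, integral_neg] at h1
  linarith

lemma integral_sq_pos (hK : KernelAssumption K) : 0 < ∫ s, K s ^ 2 := by
  obtain ⟨R, D, -, hb, hb2⟩ := hK.exists_isBump
  rw [integral_pos_iff_support_of_nonneg (fun s => sq_nonneg _) hb2.integrable]
  have h1 : 0 < ∫ s, K s := by rw [hK.integral_eq_one]; exact one_pos
  rw [integral_pos_iff_support_of_nonneg hK.nonneg hb.integrable] at h1
  have : Function.support (fun s => K s ^ 2) = Function.support K := by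
    ext s; simp
  rwa [this]

end KernelAssumption

/-! ### Consequences of the assumptions on the data -/

/-- A measure with a density `g` near `[a, b]` which is twice continuously differentiable there. -/
structure HasSmoothDensity (ν : Measure ℝ) (g : ℝ → ℝ) (O : Set ℝ) (a b C : ℝ) : Prop where
  measurable : Measurable g
  nonneg : ∀ t, 0 ≤ g t
  restrict_eq : ν.restrict O = (volume.restrict O).withDensity fun t => ENNReal.ofReal (g t)
  contDiffOn : ContDiffOn ℝ 2 g O
  second_deriv_le : ∀ y ∈ Set.Icc a b, |iteratedDeriv 2 g y| ≤ C

lemma HasSmoothDensity.abs_integral_sub_le {ν : Measure ℝ} {g : ℝ → ℝ} {O : Set ℝ} {a b C : ℝ}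
    (hν : HasSmoothDensity ν g O a b C) (hO : IsOpen O) (hab : Set.Icc a b ⊆ O) {k : ℝ → ℝ}
    {R D : ℝ} (hk : IsBump k R D) {x h : ℝ} (hh : 0 < h) (hx : x ∈ Set.Icc a b)
    (hfit : Fits a b x h R) :
    |(∫ t, 1 / h * k ((x - t) / h) ∂ν) - g x * ∫ s, k s| ≤ C * (∫ s, k s * s ^ 2) * h ^ 2 := by
  rw [integral_eq_integral_mul_of_restrict hν.measurable hν.nonneg hν.restrict_eq fun t ht =>
    hk.rescaled_eq_zero hh hfit fun h => ht (hab h)]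
  exact hk.abs_integral_rescaled_sub_le hν.measurable hO hν.contDiffOn hab hν.second_deriv_le hh hx
    hfit

section Data

variable {F : unitInterval × unitInterval × unitInterval → ℝ} {f : ℝ → ℝ}
  {f₁ : ℝ → unitInterval → ℝ} {f₁₂ : ℝ → unitInterval × unitInterval → ℝ} {a b : ℝ}

/-- The assumptions on the data, expressed through the map `F` alone: the laws of
`F (U₁, U₂, W)`, also given `U₁` and given `(U₁, U₂)`, have densities near `[a, b]`. -/
structure SmoothMap (F : unitInterval × unitInterval × unitInterval → ℝ) (f : ℝ → ℝ)
    (f₁ : ℝ → unitInterval → ℝ) (a b C : ℝ) (O : Set ℝ) : Prop where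
  measurable : Measurable F
  symm : ∀ u v w, F (u, v, w) = F (v, u, w)
  isOpen : IsOpen O
  subset : Set.Icc a b ⊆ O
  density : HasSmoothDensity (Measure.map F (volume.prod (volume.prod volume))) f O a b C
  measurable_vertex : Measurable (Function.uncurry f₁)
  density_vertex : ∀ᵐ u : unitInterval, HasSmoothDensity
    (Measure.map (fun z : unitInterval × unitInterval => F (u, z)) (volume.prod volume))
    (fun t => f₁ t u) O a b C
  density_edge : ∀ᵐ z ∂((volume : Measure unitInterval).prod volume), ∃ g : ℝ → ℝ,
    (∀ t, 0 ≤ g t) ∧ Measurable g ∧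
    (Measure.map (fun w => F (z.1, z.2, w)) volume).restrict O =
      (volume.restrict O).withDensity (fun t => ENNReal.ofReal (g t)) ∧
    ∀ t ∈ Set.Icc a b, g t ≤ C

/-- The assumptions on the conditional laws become statements about the sections of `F`. Of the
densities given both vertices only a uniform bound is used; it follows from the bound on their
derivative, because a probability density cannot be large on all of `[a, b]`. -/
lemma DataAssumption.exists_smoothMap {Ω : Type*} [MeasurableSpace Ω] {P : Measure Ω}
    [IsProbabilityMeasure P] {U : ℕ → Ω → unitInterval} {W : ℕ × ℕ → Ω → unitInterval}
    (hd : DataAssumption P F U W f f₁ f₁₂ a b) (hlt : a < b) :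
    ∃ C O, SmoothMap F f f₁ a b C O := by
  obtain ⟨O, hO, hab, hf, hf2, hf₁, hf₁2, hf₁₂, hf₁₂2⟩ := hd.densities
  obtain ⟨C, hC⟩ := hd.second_deriv_bounded
  obtain ⟨C₁, hC₁⟩ := hd.cond_second_deriv_bounded
  obtain ⟨C₂, hC₂⟩ := hd.cond_deriv_bounded
  -- a density on `[a, b]` is at most `1 / (b - a)` somewhere, hence at most
  -- `1 / (b - a) + C₂ (b - a)` everywhere
  set C' := max (max C C₁) (1 / (b - a) + C₂ * (b - a)) with hC'
  have hU0 := hd.shocks.measurable_vertex 0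
  have hU1 := hd.shocks.measurable_vertex 1
  have hW := hd.shocks.measurable_edge (0, 1) zero_lt_one
  have htriple := hd.shocks.map_triple
  have htriple' : P.map (fun ω => (U 0 ω, (U 1 ω, W (0, 1) ω))) =
      (volume : Measure unitInterval).prod (volume.prod volume) := by
    rw [← Measure.prodAssoc_prod, ← htriple, Measure.map_map (by fun_prop) (by fun_prop)]
    rfl
  have hpair : P.map (fun ω => (U 0 ω, U 1 ω)) = (volume : Measure unitInterval).prod volume := by
    have := congrArg (Measure.map Prod.fst) htriple
    rw [Measure.map_map measurable_fst (by fun_prop), Measure.map_fst_prod, measure_univ,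
      one_smul] at this
    exact this
  have hlaw0 := hd.shocks.law_vertex 0
  refine ⟨C', O, hd.measurable_map, hd.symmetric_map, hO, hab, ?_, hf₁.measurable, ?_, ?_⟩
  · refine ⟨hf.measurable, hf.nonneg, ?_, hf2, fun y hy =>
      (hC y hy).trans ((le_max_left _ _).trans (le_max_left _ _))⟩
    rw [← hf.restrict_eq, ← htriple', Measure.map_map hd.measurable_map (by fun_prop)]
    rfl
  · have h1 := condDistrib_ae_eq_map (P := P) hU0 (hU1.prodMk hW)
      (by rw [hlaw0]; exact htriple') hd.measurable_map
    have h2 := hf₁.restrict_eq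
    rw [hlaw0] at h1 h2
    filter_upwards [h1, h2, hf₁2, hC₁] with u h1 h2 h3 h4
    refine ⟨hf₁.measurable.comp measurable_prodMk_right, fun t => hf₁.nonneg t u, ?_, h3,
      fun y hy => (h4 y hy).trans ((le_max_right _ _).trans (le_max_left _ _))⟩
    rw [← h2, ← h1]
    rfl
  · have h1 := condDistrib_ae_eq_map (P := P) (hU0.prodMk hU1) hW
      (G := fun p : (unitInterval × unitInterval) × unitInterval => F (p.1.1, p.1.2, p.2))
      (by rw [hpair]; exact htriple) (hd.measurable_map.comp (by fun_prop))
    have h2 := hf₁₂.restrict_eq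
    rw [hpair] at h1 h2
    rw [Measure.volume_eq_prod] at hf₁₂2 hC₂
    filter_upwards [h1, h2, hf₁₂2, hC₂] with z h1 h2 h3 h4
    have h5 : (Measure.map (fun w => F (z.1, z.2, w)) volume).restrict O =
        (volume.restrict O).withDensity (fun t => ENNReal.ofReal (f₁₂ t z)) := by
      rw [← h2, ← h1]
      rfl
    refine ⟨fun t => f₁₂ t z, fun t => hf₁₂.nonneg t z,
      hf₁₂.measurable.comp measurable_prodMk_right, h5, fun t ht => ?_⟩
    have : IsProbabilityMeasure (Measure.map (fun w => F (z.1, z.2, w))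
        (volume : Measure unitInterval)) :=
      Measure.isProbabilityMeasure_map (hd.measurable_map.comp (by fun_prop)).aemeasurable
    exact (density_le_of_deriv_le h5 hO h3 hlt hab h4 ht).trans (le_max_right _ _)

end Data

/-! ### The localized array of the density estimator -/

namespace SmoothMap

variable {F : unitInterval × unitInterval × unitInterval → ℝ} {f : ℝ → ℝ}
  {f₁ : ℝ → unitInterval → ℝ} {a b C : ℝ} {O : Set ℝ} {K : ℝ → ℝ} {R D x h : ℝ}

lemma measurable_kdeKernel (H : SmoothMap F f f₁ a b C O) (hK : Measurable K) (x h : ℝ) :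
    Measurable (kdeKernel K x h F) := by
  have := H.measurable
  unfold kdeKernel
  fun_prop

lemma bddMeas_kdeKernel (H : SmoothMap F f f₁ a b C O) (hK : IsBump K R D) (hh : 0 < h) :
    BddMeas (kdeKernel K x h F) := by
  refine ⟨H.measurable_kdeKernel hK.measurable x h, 1 / h * D, fun t => ?_⟩
  rw [kdeKernel, abs_mul, abs_of_pos (by positivity), abs_of_nonneg (hK.nonneg _)]
  exact mul_le_mul_of_nonneg_left (hK.le _) (by positivity)

lemma isDyadicKernel (H : SmoothMap F f f₁ a b C O) (hK : IsBump K R D) (hK1 : ∫ s, K s = 1)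
    {B : ℝ} (hDB : D ≤ B) (hCB : C ≤ B) (hh : 0 < h) (hfit : Fits a b x h R) :
    IsDyadicKernel volume (kdeKernel K x h F) (B / h) B := by
  refine ⟨H.measurable_kdeKernel hK.measurable x h, fun u v w => ?_, fun t => ?_, fun t => ?_, ?_⟩
  · rw [kdeKernel, kdeKernel, H.symm]
  · exact mul_nonneg (by positivity) (hK.nonneg _)
  · rw [kdeKernel, one_div, inv_mul_eq_div]
    exact div_le_div_of_nonneg_right ((hK.le _).trans hDB) hh.le
  · filter_upwards [H.density_edge] with z ⟨g, hg0, hgm, hg, hgC⟩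
    have hm : Measurable fun w => F (z.1, z.2, w) := H.measurable.comp (by fun_prop)
    have hφ : Measurable fun t => 1 / h * K ((x - t) / h) := by
      have := hK.measurable; fun_prop
    have h1 : edgeMean volume (kdeKernel K x h F) z = ∫ t, 1 / h * K ((x - t) / h)
        ∂(Measure.map (fun w => F (z.1, z.2, w)) volume) := by
      rw [integral_map hm.aemeasurable hφ.aestronglyMeasurable]
      rfl
    rw [h1, integral_eq_integral_mul_of_restrict hgm hg0 hg fun t ht =>
      hK.rescaled_eq_zero hh hfit fun h => ht (H.subset h)]
    refine (hK.integral_rescaled_le hg0 hh hfit hgC).trans ?_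
    rwa [hK1, mul_one]

lemma vertexMean_kdeKernel (H : SmoothMap F f f₁ a b C O) (hK : IsBump K R D) (hh : 0 < h)
    (u : unitInterval) : vertexMean volume (kdeKernel K x h F) u =
      ∫ t, 1 / h * K ((x - t) / h) ∂(Measure.map (fun z : unitInterval × unitInterval => F (u, z))
        (volume.prod volume)) := by
  have hm : Measurable fun z : unitInterval × unitInterval => F (u, z) :=
    H.measurable.comp (by fun_prop)
  have hφ : Measurable fun t => 1 / h * K ((x - t) / h) := by
    have := hK.measurable; fun_prop
  have hb : BddMeas fun z : unitInterval × unitInterval => kdeKernel K x h F (u, z) :=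
    (H.bddMeas_kdeKernel hK hh).comp (by fun_prop)
  rw [integral_map hm.aemeasurable hφ.aestronglyMeasurable]
  exact (integral_prod (fun z : unitInterval × unitInterval => kdeKernel K x h F (u, z))
    hb.integrable).symm

lemma integral_triple (H : SmoothMap F f f₁ a b C O) {φ : ℝ → ℝ} (hφ : BddMeas φ) :
    ∫ u : unitInterval, ∫ v : unitInterval, ∫ w : unitInterval, φ (F (u, v, w)) =
      ∫ t, φ t ∂(Measure.map F (volume.prod (volume.prod volume))) := by
  rw [integral_map H.measurable.aemeasurable hφ.1.aestronglyMeasurable,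
    integral_prod _ (hφ.comp H.measurable).integrable]
  refine integral_congr_ae (ae_of_all _ fun u => ?_)
  exact (integral_prod (fun z : unitInterval × unitInterval => φ (F (u, z)))
    (hφ.comp (H.measurable.comp (by fun_prop))).integrable).symm

lemma bddMeas_rescaled {k : ℝ → ℝ} (hk : IsBump k R D) (x : ℝ) (hh : 0 < h) :
    BddMeas fun t => 1 / h * k ((x - t) / h) := by
  refine ⟨by have := hk.measurable; fun_prop, 1 / h * D, fun t => ?_⟩
  rw [abs_mul, abs_of_pos (by positivity), abs_of_nonneg (hk.nonneg _)]
  exact mul_le_mul_of_nonneg_left (hk.le _) (by positivity)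

lemma abs_vertexMean_sub_le (H : SmoothMap F f f₁ a b C O) (hK : IsBump K R D)
    (hK1 : ∫ s, K s = 1) (hh : 0 < h) (hx : x ∈ Set.Icc a b) (hfit : Fits a b x h R) :
    ∀ᵐ u : unitInterval, |vertexMean volume (kdeKernel K x h F) u - f₁ x u| ≤
      C * (∫ s, K s * s ^ 2) * h ^ 2 := by
  filter_upwards [H.density_vertex] with u hu
  have := hu.abs_integral_sub_le H.isOpen H.subset hK hh hx hfit
  rwa [hK1, mul_one, ← H.vertexMean_kdeKernel hK hh] at this

lemma abs_totalMean_sub_le (H : SmoothMap F f f₁ a b C O) (hK : IsBump K R D)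
    (hK1 : ∫ s, K s = 1) (hh : 0 < h) (hx : x ∈ Set.Icc a b) (hfit : Fits a b x h R) :
    |totalMean volume (kdeKernel K x h F) - f x| ≤ C * (∫ s, K s * s ^ 2) * h ^ 2 := by
  have := H.density.abs_integral_sub_le H.isOpen H.subset hK hh hx hfit
  rw [hK1, mul_one, ← H.integral_triple (bddMeas_rescaled hK x hh)] at this
  exact this

/-- The second moment of the localized kernel is again a smoothed density, with kernel `K ^ 2`. -/
lemma mul_integral_sq_eq (H : SmoothMap F f f₁ a b C O)
    (hK : IsBump K R D) (hK2 : IsBump (fun s => K s ^ 2) R (D ^ 2)) (hh : 0 < h) :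
    h * ∫ z, ∫ w, kdeKernel K x h F (z.1, z.2, w) ^ 2 ∂volume
        ∂((volume : Measure unitInterval).prod volume) =
      ∫ t, 1 / h * K ((x - t) / h) ^ 2 ∂(Measure.map F (volume.prod (volume.prod volume))) := by
  have hint : Integrable (fun z : unitInterval × unitInterval =>
      ∫ w, kdeKernel K x h F (z.1, z.2, w) ^ 2) (volume.prod volume) :=
    (BddMeas.integral_right (Z := fun t : (unitInterval × unitInterval) × unitInterval =>
      kdeKernel K x h F (t.1.1, t.1.2, t.2) ^ 2)
      (((H.bddMeas_kdeKernel hK hh).comp (by fun_prop)).pow 2)).integrable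
  rw [integral_prod _ hint, ← H.integral_triple (bddMeas_rescaled hK2 x hh)]
  simp only [← integral_const_mul]
  congr! 6 with u v w
  rw [kdeKernel]
  field_simp

/-- The density estimator averages a localized dyadic array. -/
theorem exists_isLocalArray (H : SmoothMap F f f₁ a b C O) (hK : KernelAssumption K) {h : ℕ → ℝ}
    (hh : BandwidthAssumption h) (hx : x ∈ Set.Ioo a b) (hfx : 0 < f x) :
    ∃ ξ κ B, IsLocalArray volume (fun n => kdeKernel K x (h n) F) h (f x) ξ κ B ∧
      ∀ᵐ u : unitInterval, ξ u = f₁ x u - f x := by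
  obtain ⟨R, D, hD, hb, hb2⟩ := hK.exists_isBump
  have hK1 := hK.integral_eq_one
  have hx' := Set.Ioo_subset_Icc_self hx
  have hfit := eventually_fits (R := R) hx hh.pos hh.tendsto_zero
  set c := C * ∫ s, K s * s ^ 2 with hc
  set B := max (max D C) c with hB
  have hDB : D ≤ B := (le_max_left _ _).trans (le_max_left _ _)
  have hCB : C ≤ B := (le_max_right _ _).trans (le_max_left _ _)
  have hcB : c ≤ B := le_max_right _ _
  have hkernel : ∀ᶠ n in atTop, IsDyadicKernel volume (kdeKernel K x (h n) F) (B / h n) B := by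
    filter_upwards [hfit] with n hn using H.isDyadicKernel hb hK1 hDB hCB (hh.pos n) hn
  have hvertex : ∀ᶠ n in atTop, ∀ᵐ u : unitInterval,
      |vertexMean volume (kdeKernel K x (h n) F) u - f₁ x u| ≤ B * h n ^ 2 := by
    filter_upwards [hfit] with n hn
    filter_upwards [H.abs_vertexMean_sub_le hb hK1 (hh.pos n) hx' hn] with u hu
    exact hu.trans (mul_le_mul_of_nonneg_right hcB (sq_nonneg _))
  -- the conditional density is essentially bounded at `x`, which allows to truncate it
  obtain ⟨M, hM⟩ : ∃ M, ∀ᵐ u : unitInterval, |f₁ x u - f x| ≤ M := by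
    obtain ⟨n, hn1, hn2⟩ := (hkernel.and hvertex).exists
    refine ⟨B + B * h n ^ 2 + f x, ?_⟩
    filter_upwards [hn1.vertexMean_le, hn2] with u h1 h2
    have h3 := hn1.vertexMean_nonneg u
    have h4 := hn1.meanBound_nonneg
    have h5 : 0 ≤ B * h n ^ 2 := mul_nonneg h4 (sq_nonneg _)
    rw [abs_le] at h2 ⊢
    exact ⟨by linarith [h2.2], by linarith [h2.1]⟩
  set ξ : unitInterval → ℝ := fun u => max (-M) (min M (f₁ x u - f x)) with hξ
  have hξae : ∀ᵐ u, ξ u = f₁ x u - f x := by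
    filter_upwards [hM] with u hu
    rw [abs_le] at hu
    rw [hξ]
    simp only
    rw [min_eq_right hu.2, max_eq_right hu.1]
  have hM0 : 0 ≤ M := by
    obtain ⟨u, hu⟩ := hM.exists
    exact (abs_nonneg _).trans hu
  have hξb : BddMeas ξ := by
    have hm : Measurable (f₁ x) := H.measurable_vertex.comp measurable_prodMk_left
    exact ⟨by fun_prop, M, fun u => abs_le.2 ⟨le_max_left _ _, max_le (by linarith)
      (min_le_left _ _)⟩⟩
  have hbias : ∀ᶠ n in atTop, ∀ᵐ u : unitInterval,
      |vertexMean volume (kdeKernel K x (h n) F) u - f x - ξ u| ≤ B * h n ^ 2 := by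
    filter_upwards [hvertex] with n hn
    filter_upwards [hn, hξae] with u h1 h2
    rwa [h2, sub_sub, add_sub_cancel]
  have hsq : Tendsto (fun n => h n ^ 2) atTop (𝓝 0) := by simpa using hh.tendsto_zero.pow 2
  refine ⟨ξ, f x * ∫ s, K s ^ 2, B, ⟨hh, fun n => H.measurable_kdeKernel hb.measurable x (h n),
    hkernel, hbias, ?_, mul_pos hfx hK.integral_sq_pos, hξb, ?_⟩, hξae⟩
  · rw [tendsto_iff_dist_tendsto_zero]
    have hlim := hsq.const_mul (C * ∫ s, K s ^ 2 * s ^ 2)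
    rw [mul_zero] at hlim
    refine squeeze_zero' (Eventually.of_forall fun _ => dist_nonneg) ?_ hlim
    filter_upwards [hfit] with n hn
    rw [Real.dist_eq, H.mul_integral_sq_eq hb hb2 (hh.pos n)]
    exact H.density.abs_integral_sub_le H.isOpen H.subset hb2 (hh.pos n) hx' hn
  · -- both the mean of the vertex means and the total mean approximate `f x`
    have hlim := hsq.const_mul (2 * B)
    rw [mul_zero] at hlim
    have hle : ∀ᶠ n in atTop, |∫ u, ξ u| ≤ 2 * B * h n ^ 2 := by
      filter_upwards [hkernel, hbias, hfit] with n hn hb' hfit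
      have h1 : ∫ u, (vertexMean volume (kdeKernel K x (h n) F) u - f x - ξ u) =
          totalMean volume (kdeKernel K x (h n) F) - f x - ∫ u, ξ u := by
        rw [integral_sub (hn.bddMeas_vertexMean.sub (BddMeas.const (f x))).integrable
          hξb.integrable, integral_sub hn.bddMeas_vertexMean.integrable (integrable_const _)]
        simp [totalMean]
      have h2 : |∫ u, (vertexMean volume (kdeKernel K x (h n) F) u - f x - ξ u)| ≤ B * h n ^ 2 := by
        simpa using norm_integral_le_of_norm_le_const (μ := (volume : Measure unitInterval))
          (f := fun u => vertexMean volume (kdeKernel K x (h n) F) u - f x - ξ u)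
          (C := B * h n ^ 2) hb'
      have h3 := (H.abs_totalMean_sub_le hb hK1 (hh.pos n) hx' hfit).trans
        (mul_le_mul_of_nonneg_right hcB (sq_nonneg (h n)))
      rw [h1] at h2
      rw [abs_le] at h2 h3 ⊢
      exact ⟨by linarith [h2.2, h3.1], by linarith [h2.1, h3.2]⟩
    have := ge_of_tendsto hlim hle
    exact abs_nonpos_iff.1 this

end SmoothMap

/-- The first order projection matters only almost everywhere. -/
lemma IsLocalArray.of_score_ae_eq_zero {E : Type*} [MeasurableSpace E] {ρ : Measure E}
    {y : ℕ → E × E × E → ℝ} {h : ℕ → ℝ} {θ : ℝ} {ξ : E → ℝ} {κ B : ℝ}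
    (H : IsLocalArray ρ y h θ ξ κ B) (hξ : ∀ᵐ u ∂ρ, ξ u = 0) :
    IsLocalArray ρ y h θ (fun _ => 0) κ B := by
  refine ⟨H.bandwidth, H.measurable, H.kernel, ?_, H.tendsto_sq, H.pos, BddMeas.const 0, by simp⟩
  filter_upwards [H.bias] with n hn
  filter_upwards [hn, hξ] with u h1 h2
  rwa [h2] at h1

/-- Non-degeneracy means that the score has positive variance. -/
lemma nonDegenerateAt_iff {Ω : Type*} [MeasurableSpace Ω] {P : Measure Ω} [IsProbabilityMeasure P]
    {U : ℕ → Ω → unitInterval} {f₁ : ℝ → unitInterval → ℝ} {x θ : ℝ} {ξ : unitInterval → ℝ}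
    (hU : Measurable (U 0)) (hlaw : P.map (U 0) = volume) (hf₁ : Measurable (f₁ x))
    (hξ : BddMeas ξ) (hξ0 : ∫ u, ξ u = 0) (hξae : ∀ᵐ u, ξ u = f₁ x u - θ) :
    NonDegenerateAt P U f₁ x ↔ 0 < ∫ u, ξ u ^ 2 := by
  have hvar : Var[fun ω => f₁ x (U 0 ω); P] = ∫ u, ξ u ^ 2 := by
    have h1 := variance_map (μ := P) (Y := U 0) (X := f₁ x) (by rw [hlaw]; exact hf₁.aemeasurable)
      hU.aemeasurable
    have h2 : Var[f₁ x; volume] = Var[fun u => ξ u + θ; volume] :=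
      variance_congr (by filter_upwards [hξae] with u hu; rw [hu]; ring)
    rw [hlaw, h2, variance_add_const hξ.1.aestronglyMeasurable,
      variance_of_integral_eq_zero hξ.1.aemeasurable hξ0] at h1
    exact h1.symm
  rw [NonDegenerateAt, hvar]
  exact ⟨fun ⟨L, h1, h2⟩ => h1.trans_le h2, fun h => ⟨_, h, le_rfl⟩⟩

end DyadicKDE

end

theorem theorem2 {Ω : Type*} [MeasurableSpace Ω] (P : Measure Ω) [IsProbabilityMeasure P]
    (F : unitInterval × unitInterval × unitInterval → ℝ)
    (U : ℕ → Ω → unitInterval) (W : ℕ × ℕ → Ω → unitInterval)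
    (f : ℝ → ℝ) (f₁ : ℝ → unitInterval → ℝ) (f₁₂ : ℝ → unitInterval × unitInterval → ℝ)
    (a b : ℝ) (hdata : DyadicKDE.DataAssumption P F U W f f₁ f₁₂ a b)
    (K : ℝ → ℝ) (hK : DyadicKDE.KernelAssumption K)
    (h : ℕ → ℝ) (hh : DyadicKDE.BandwidthAssumption h)
    (x : ℝ) (hx : x ∈ interior (Set.Icc a b)) (hfx : 0 < f x) :
    TendstoInDistribution
      (fun n ω => DyadicKDE.jelMod K x (h n) (DyadicKDE.array F U W ω) n (f x)) atTop
      (fun z : ℝ => ((z ^ 2 : ℝ) : EReal)) (fun _ => P) (gaussianReal 0 1) ∧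
    (DyadicKDE.NonDegenerateAt P U f₁ x →
      TendstoInDistribution
        (fun n ω => DyadicKDE.jel K x (h n) (DyadicKDE.array F U W ω) n (f x)) atTop
        (fun z : ℝ => ((z ^ 2 : ℝ) : EReal)) (fun _ => P) (gaussianReal 0 1)) ∧
    (¬ DyadicKDE.NonDegenerateAt P U f₁ x →
      TendstoInDistribution
        (fun n ω => DyadicKDE.jel K x (h n) (DyadicKDE.array F U W ω) n (f x)) atTop
        (fun z : ℝ => ((1 / 2 * z ^ 2 : ℝ) : EReal)) (fun _ => P) (gaussianReal 0 1)) := by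
  open DyadicKDE in
  rw [interior_Icc] at hx
  obtain ⟨C, O, H⟩ := hdata.exists_smoothMap (hx.1.trans hx.2)
  obtain ⟨ξ, κ, B, hloc, hξae⟩ := H.exists_isLocalArray hK hh hx hfx
  have hmeas := fun n => H.measurable_kdeKernel hK.measurable x (h n)
  have hnd := nonDegenerateAt_iff (hdata.shocks.measurable_vertex 0)
    (hdata.shocks.law_vertex 0) (H.measurable_vertex.comp measurable_prodMk_left)
    hloc.score_bddMeas hloc.integral_score hξae
  have hjel : ∀ {g : ℝ → EReal}, TendstoInDistribution (fun n ω => elStat n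
      (V (pairAvg fun p => kdeKernel K x (h n) F (ω.1 p.1, ω.1 p.2, ω.2 p)) n (f x))) atTop g
      (fun _ => shockLaw volume) (gaussianReal 0 1) →
      TendstoInDistribution (fun n ω => jel K x (h n) (array F U W ω) n (f x)) atTop g
        (fun _ => P) (gaussianReal 0 1) := by
    intro g hg
    have := hdata.shocks.tendstoInDistribution
      (T := fun n t => elStat n (V (pairAvg (edgeArray (kdeKernel K x (h n) F) t)) n (f x)))
      (fun n => (measurable_elStat n).comp (measurable_pi_lambda _ fun i =>
        measurable_V (measurable_edgeArray (hmeas n)) n i (f x)))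
      (by simpa only [pairAvg_edgeArray_restrictEdges] using hg)
    simpa only [jel, kde_eq_pairAvg] using this
  have hjelMod : TendstoInDistribution (fun n ω => elStat n
      (Vmod (pairAvg fun p => kdeKernel K x (h n) F (ω.1 p.1, ω.1 p.2, ω.2 p)) n (f x))) atTop
      (fun z : ℝ => ((z ^ 2 : ℝ) : EReal)) (fun _ => shockLaw volume) (gaussianReal 0 1) →
      TendstoInDistribution (fun n ω => jelMod K x (h n) (array F U W ω) n (f x)) atTop
        (fun z : ℝ => ((z ^ 2 : ℝ) : EReal)) (fun _ => P) (gaussianReal 0 1) := by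
    intro hg
    have := hdata.shocks.tendstoInDistribution
      (T := fun n t => elStat n (Vmod (pairAvg (edgeArray (kdeKernel K x (h n) F) t)) n (f x)))
      (fun n => (measurable_elStat n).comp (measurable_pi_lambda _ fun i =>
        measurable_Vmod (measurable_edgeArray (hmeas n)) n i (f x)))
      (by simpa only [pairAvg_edgeArray_restrictEdges] using hg)
    simpa only [jelMod, kde_eq_pairAvg] using this
  by_cases hdeg : NonDegenerateAt P U f₁ x
  · have hpos := hnd.1 hdeg
    obtain ⟨m, hm⟩ := hloc.jackknifeLimit_nondegenerate hpos
    refine ⟨hjelMod hm.tendsto_elStat_Vmod, fun _ => hjel ?_, fun h => absurd hdeg h⟩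
    have h1 := hm.tendsto_elStat_V
    rw [div_self hm.var_pos.ne'] at h1
    simpa only [one_mul] using h1
  · have hzero : ∫ u, ξ u ^ 2 = 0 :=
      le_antisymm (not_lt.1 fun h => hdeg (hnd.2 h)) (integral_nonneg fun _ => sq_nonneg _)
    have hae : ∀ᵐ u, ξ u = 0 := by
      have := (integral_eq_zero_iff_of_nonneg (fun u => sq_nonneg (ξ u))
        (hloc.score_bddMeas.pow 2).integrable).1 hzero
      filter_upwards [this] with u hu
      simpa using hu
    obtain ⟨m, hm⟩ := (hloc.of_score_ae_eq_zero hae).jackknifeLimit_degenerate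
    refine ⟨hjelMod hm.tendsto_elStat_Vmod, fun h => absurd h hdeg, fun _ => hjel ?_⟩
    have h1 := hm.tendsto_elStat_V
    have hκ := hloc.pos.ne'
    rwa [show 2 * κ / (4 * κ) = 1 / 2 by field_simp; norm_num] at h1
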